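/- Corollary 1.2. Let $\{s_{ij}: i,j=1,2,\dots\}$ be i.i.d. complex random variables with $\mathbf E s_{11}=0$, $\mathbf E|s_{11}|^2=1$, and put $\mathbf s_k=\mathbf s_k(N)=(s_{1k},\dots,s_{Nk})^T$. Let $K=K(N)$ with $K/N\to c>0$ as $N\to\infty$, let $L$ be a fixed positive integer and $\sigma^2>0$. For each $N$ let $\gamma_k(\ell)=\gamma_k^N(\ell)\in\mathbb C$ and $T_k=T_k^N\ge 0$ ($1\le k\le K$, $1\le\ell\le L$) be random variables such that the family of all of them is independent of $(\mathbf s_1,\dots,\mathbf s_K)$. Put $$\boldsymbol\beta_k=\sqrt{T_k}\,(\gamma_k(1)\mathbf s_k^T,\dots,\gamma_k(L)\mathbf s_k^T)^T\in\mathbb C^{NL},\qquad C=\frac1N\sum_{k=2}^K\boldsymbol\beta_k\boldsymbol\beta_k^*,\qquad \mathrm{SIR}_1=\frac1N\boldsymbol\beta_1^*(C+\sigma^2I)^{-1}\boldsymbol\beta_1 .$$ Assume that: 1. almost surely, the empirical distribution of the vectors $T_k(|\gamma_k(1)|^2,\dots,|\gamma_k(L)|^2)^T$, $2\le k\le K$,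 converges weakly to a (nonrandom) probability distribution $G$ on $\mathbb R^L$; and 2. for all $\ell\ne\ell'$ and all positive $a_1,\dots,a_L$, almost surely $$\frac1{K-1}\sum_{k=2}^K\frac{T_k\gamma_k(\ell)\overline{\gamma_k(\ell')}}{1+\sum_{m}a_mT_k|\gamma_k(m)|^2}\to0\qquad(N\to\infty).$$ Let $(\delta_1,\dots,\delta_L)$ have distribution $G$. Then there is a nonrandom Hermitian positive definite $L\times L$ matrix $A=(a_{\ell,\ell'})$ with the following properties. (a) $A=\mathrm{diag}(a_1,\dots,a_L)$, where $(a_1,\dots,a_L)$ is the unique vector of positive numbers satisfying $$a_\ell=\frac1{c\,\mathbf E\big(\delta_\ell/(1+\sum_m a_m\delta_m)\big)+\sigma^2},\qquad \ell=1,\dots,L;$$ in particular $A$ depends only on $c$, $\sigma^2$ and $G$. (b) For every random vector $\boldsymbol\alpha=(\alpha_1,\dots,\alpha_L)^T\in\mathbb C^L$ such that $(|\alpha_1|^2,\dots,|\alpha_L|^2)$ has distribution $G$ and $\mathbf E\,\alpha_\ell\bar\alpha_{\ell'}/(1+\sum_m b_m|\alpha_m|^2)=0$ for all $\ell\ne\ell'$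 and all positive $b_1,\dots,b_L$, the matrix $A$ is the unique Hermitian positive definite solution of $$A=\Big(c\,\mathbf E\frac{\boldsymbol\alpha\boldsymbol\alpha^*}{1+\boldsymbol\alpha^*A\boldsymbol\alpha}+\sigma^2I_L\Big)^{-1}.$$ (c) With probability one, as $N\to\infty$, $$\mathrm{SIR}_1=T_1\sum_{\ell,\ell'=1}^L\overline{\gamma_1(\ell)}\,\gamma_1(\ell')\,a_{\ell,\ell'}+o\Big(T_1\sum_{\ell=1}^L|\gamma_1(\ell)|^2\Big).$$ Consequently, with probability one: if the sequence $T_1\sum_\ell|\gamma_1(\ell)|^2$, $N=1,2,\dots$, is bounded, then $\mathrm{SIR}_1-T_1\sum_{\ell,\ell'}\overline{\gamma_1(\ell)}\gamma_1(\ell')a_{\ell,\ell'}\to0$; and if $T_1$ and the $\gamma_1(\ell)$ do not depend on $N$, or converge to limits (denoted by the same letters on the right), then $$\lim_{N\to\infty}\mathrm{SIR}_1=T_1\sum_{\ell,\ell'=1}^L\overline{\gamma_1(\ell)}\,\gamma_1(\ell')\,a_{\ell,\ell'} .$$ -/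

import Mathlib

open MeasureTheory ProbabilityTheory Filter Topology Asymptotics
open scoped NNReal Matrix ComplexOrder

namespace CDMA

/-- The signature sequence of user `k`, of length `N`, from the array `s`
(rows, columns and users are numbered from `0`). -/
def sig (s : ℕ → ℕ → ℂ) (N k : ℕ) : Fin N → ℂ := fun i => s i k

/-- The vector `β = √T (γ(1) sᵀ, …, γ(L) sᵀ)ᵀ` in `ℂ^{LN}`; the coordinate `(ℓ, i)` is the
`i`-th coordinate of the `ℓ`-th block. -/
noncomputable def beta {L N : ℕ} (T : ℝ) (γ : Fin L → ℂ) (v : Fin N → ℂ) :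
    Fin L × Fin N → ℂ :=
  fun p => (Real.sqrt T : ℂ) * (γ p.1 * v p.2)

/-- `C = (1/N) ∑ β_k β_k^*`, the sum over all `K` users except the first one (the user `0`). -/
noncomputable def interference {L : ℕ} (N K : ℕ) (s : ℕ → ℕ → ℂ) (T : ℕ → ℝ)
    (γ : ℕ → Fin L → ℂ) : Matrix (Fin L × Fin N) (Fin L × Fin N) ℂ :=
  (1 / (N : ℂ)) • ∑ k ∈ Finset.Ico 1 K,
    Matrix.vecMulVec (beta (T k) (γ k) (sig s N k)) (star (beta (T k) (γ k) (sig s N k)))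

/-- The signal-to-interference ratio `(1/N) β₁^* (C + σ² I)⁻¹ β₁` of the first user (user `0`),
as a complex number. -/
noncomputable def SIR {L : ℕ} (N K : ℕ) (σ : ℝ) (s : ℕ → ℕ → ℂ) (T : ℕ → ℝ)
    (γ : ℕ → Fin L → ℂ) : ℂ :=
  (1 / (N : ℂ)) *
    (star (beta (T 0) (γ 0) (sig s N 0)) ⬝ᵥ
      (interference N K s T γ + ((σ : ℂ) ^ 2) • 1)⁻¹ *ᵥ beta (T 0) (γ 0) (sig s N 0))

/-- `T ∑_{ℓ,ℓ'} conj(γ(ℓ)) γ(ℓ') a_{ℓ,ℓ'}`. -/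
noncomputable def limitSIR {L : ℕ} (A : Matrix (Fin L) (Fin L) ℂ) (T : ℝ) (γ : Fin L → ℂ) : ℂ :=
  (T : ℂ) * ∑ ℓ, ∑ ℓ', star (γ ℓ) * γ ℓ' * A ℓ ℓ'

/-- The empirical distribution of `x k`, `1 ≤ k < K` (all the `K` users except the user `0`). It is
a probability measure as soon as `2 ≤ K`. Convergence in `FiniteMeasure` is weak convergence. -/
noncomputable def empirical {E : Type*} [MeasurableSpace E] (K : ℕ) (x : ℕ → E) :
    FiniteMeasure E :=
  ((K - 1 : ℕ) : ℝ≥0)⁻¹ • ∑ k ∈ Finset.Ico 1 K, (diracProba (x k)).toFiniteMeasure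

/-- The cross average
`(1/(K-1)) ∑ T_k γ_k(ℓ) conj(γ_k(ℓ')) / (1 + ∑_m a_m T_k |γ_k(m)|²)`
over all the users except the user `0`. -/
noncomputable def crossAverage {L : ℕ} (K : ℕ) (T : ℕ → ℝ) (γ : ℕ → Fin L → ℂ) (a : Fin L → ℝ)
    (ℓ ℓ' : Fin L) : ℂ :=
  (1 / ((K : ℂ) - 1)) * ∑ k ∈ Finset.Ico 1 K,
    (T k : ℂ) * γ k ℓ * star (γ k ℓ') / ((1 + ∑ m, a m * (T k * ‖γ k m‖ ^ 2) : ℝ) : ℂ)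

/-- The equations `a_ℓ = 1 / (c E[δ_ℓ / (1 + ∑_m a_m δ_m)] + σ²)` for all `ℓ`, where `δ ∼ G`. -/
def SolvesDiag {L : ℕ} (c σ : ℝ) (G : ProbabilityMeasure (Fin L → ℝ)) (a : Fin L → ℝ) : Prop :=
  ∀ ℓ, a ℓ = 1 / (c * (∫ δ, δ ℓ / (1 + ∑ m, a m * δ m) ∂(G : Measure (Fin L → ℝ))) + σ ^ 2)

/-- The matrix `E[α α^* / (1 + α^* A α)]`, where `α ∼ H`. -/
noncomputable def expectMatrix {L : ℕ} (H : ProbabilityMeasure (Fin L → ℂ))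
    (A : Matrix (Fin L) (Fin L) ℂ) : Matrix (Fin L) (Fin L) ℂ :=
  Matrix.of fun ℓ ℓ' =>
    ∫ α, α ℓ * star (α ℓ') / (1 + star α ⬝ᵥ A *ᵥ α) ∂(H : Measure (Fin L → ℂ))

/-- The equation `A = (c E[α α^* / (1 + α^* A α)] + σ² I)⁻¹`, where `α ∼ H`. -/
def SolvesMatrix {L : ℕ} (c σ : ℝ) (H : ProbabilityMeasure (Fin L → ℂ))
    (A : Matrix (Fin L) (Fin L) ℂ) : Prop :=
  A = ((c : ℂ) • expectMatrix H A + ((σ : ℂ) ^ 2) • 1)⁻¹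

/-- `E[α_ℓ conj(α_ℓ') / (1 + ∑_m a_m |α_m|²)] = 0` for all `ℓ ≠ ℓ'` and all positive `a`,
where `α ∼ H`. -/
def CrossMomentsVanish {L : ℕ} (H : ProbabilityMeasure (Fin L → ℂ)) : Prop :=
  ∀ ℓ ℓ' : Fin L, ℓ ≠ ℓ' → ∀ a : Fin L → ℝ, (∀ m, 0 < a m) →
    ∫ α, α ℓ * star (α ℓ') / ((1 + ∑ m, a m * ‖α m‖ ^ 2 : ℝ) : ℂ)
      ∂(H : Measure (Fin L → ℂ)) = 0

end CDMA

/-! Let w be the vector √T₁ γ₁ and let R be the resolvent (C + σ²)⁻¹, cut into L × L blocks of size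
N. Then SIR₁ = w* M w, where M is the L × L matrix with entries (1/N) s₁* R_{ℓℓ'} s₁. Everything in
(c) follows from M → A = diag(a) almost surely (`ae_tendsto_blockForm`), because the error in SIR₁
is at most T₁ ∑ |γ₁(ℓ)|² times the sum of the moduli of the entries of M - A.

Why M → A: the resolvent R does not involve s₁, so M concentrates around the matrix m of normalized
block traces of R. A fourth moment bound for quadratic forms (`integral_quadForm_pow_four_le`) makes
the error summable in N. Removing one user from C is a rank one update, so the Sherman–Morrison
formula and the same concentration, applied to every user, give (S(m) + σ²) m ≈ 1 with S(X) = (1/N)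
∑ w_k w_k* / (1 + w_k* X w_k). The assumptions on the empirical distribution and on the cross
averages say that diag(a) solves the same equation up to o(1).

It remains to see that two approximate solutions are close (`abs_qf_sub_le`). The map S is antitone
up to scaling: if X' ≤ tX with t ≥ 1, then S(X) ≤ t S(X'). Testing the two equations at the extremal
generalized eigenvector of the pair (m, A) bounds the extremal ratio by 1 + O(error/σ²), thanks to
the term σ². This is a quantitative statement at finite N and needs no extraction of limits; it uses
the assumptions only at the one vector a, so null sets depending on a do no harm. With zero errors
it gives uniqueness in (a) and (b) (`eq_diagonal_of_solves`). Existence of a comes from the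
Knaster–Tarski theorem.

The entries have only two moments and the weights may have none. Hence entries are replaced by
bounded centred ones (level n), and weights of squared length above B by zero. The cost is
controlled by laws of large numbers for squares and by the tail of G, with N → ∞ first, then n → ∞,
then B → ∞. -/

namespace CDMA

/-! ### Quadratic forms and stability of antitone matrix equations. -/

section Forms

variable {ι : Type*} [Fintype ι]

/-- The squared Euclidean norm of a complex vector. -/
noncomputable def nsq (v : ι → ℂ) : ℝ := ∑ i, ‖v i‖ ^ 2

/-- The real part of the quadratic form of a complex matrix. -/
noncomputable def qf (B : Matrix ι ι ℂ) (y : ι → ℂ) : ℝ := (star y ⬝ᵥ B *ᵥ y).re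

lemma nsq_nonneg (v : ι → ℂ) : 0 ≤ nsq v := Finset.sum_nonneg fun _ _ => by positivity

lemma nsq_eq_zero {v : ι → ℂ} : nsq v = 0 ↔ v = 0 := by
  unfold nsq
  rw [Finset.sum_eq_zero_iff_of_nonneg (fun _ _ => by positivity)]
  simp [funext_iff]

lemma nsq_pos {v : ι → ℂ} (h : v ≠ 0) : 0 < nsq v :=
  lt_of_le_of_ne (nsq_nonneg v) fun h' => h (nsq_eq_zero.1 h'.symm)

lemma star_dotProduct_self (v : ι → ℂ) : star v ⬝ᵥ v = (nsq v : ℂ) := by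
  simp [dotProduct, nsq, Complex.conj_mul']

lemma qf_add (A B : Matrix ι ι ℂ) (y : ι → ℂ) : qf (A + B) y = qf A y + qf B y := by
  simp [qf, Matrix.add_mulVec, dotProduct_add]

lemma qf_sub (A B : Matrix ι ι ℂ) (y : ι → ℂ) : qf (A - B) y = qf A y - qf B y := by
  simp [qf, Matrix.sub_mulVec, dotProduct_sub]

lemma qf_smul (r : ℝ) (B : Matrix ι ι ℂ) (y : ι → ℂ) : qf ((r : ℂ) • B) y = r * qf B y := by
  simp [qf, Matrix.smul_mulVec, dotProduct_smul]

lemma qf_vec_smul (r : ℝ) (B : Matrix ι ι ℂ) (y : ι → ℂ) :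
    qf B ((r : ℂ) • y) = r ^ 2 * qf B y := by
  simp [qf, Matrix.mulVec_smul, dotProduct_smul]
  ring

lemma qf_one [DecidableEq ι] (y : ι → ℂ) : qf 1 y = nsq y := by
  simp [qf, star_dotProduct_self]

lemma qf_diagonal [DecidableEq ι] (a : ι → ℝ) (y : ι → ℂ) :
    qf (Matrix.diagonal fun i => (a i : ℂ)) y = ∑ i, a i * ‖y i‖ ^ 2 := by
  simp only [qf, dotProduct, Matrix.mulVec_diagonal, Complex.re_sum]
  refine Finset.sum_congr rfl fun i _ => ?_
  have : star y i * ((a i : ℂ) * y i) = ((a i * ‖y i‖ ^ 2 : ℝ) : ℂ) := by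
    push_cast
    rw [← Complex.conj_mul']
    simp
    ring
  rw [this, Complex.ofReal_re]

lemma qf_pos {B : Matrix ι ι ℂ} (hB : B.PosDef) {y : ι → ℂ} (hy : y ≠ 0) : 0 < qf B y := by
  have := hB.dotProduct_mulVec_pos hy
  exact (Complex.lt_def.1 this).1

lemma qf_nonneg {B : Matrix ι ι ℂ} (hB : B.PosSemidef) (y : ι → ℂ) : 0 ≤ qf B y := by
  have := hB.dotProduct_mulVec_nonneg y
  exact (Complex.le_def.1 this).1

lemma dotProduct_mulVec_im {B : Matrix ι ι ℂ} (hB : B.IsHermitian) (y : ι → ℂ) :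
    (star y ⬝ᵥ B *ᵥ y).im = 0 :=
  hB.im_star_dotProduct_mulVec_self y

lemma dotProduct_mulVec_eq_qf {B : Matrix ι ι ℂ} (hB : B.IsHermitian) (y : ι → ℂ) :
    star y ⬝ᵥ B *ᵥ y = (qf B y : ℂ) :=
  Complex.ext (by simp [qf]) (by simp [dotProduct_mulVec_im hB])

lemma posSemidef_of_qf {B : Matrix ι ι ℂ} (hB : B.IsHermitian) (h : ∀ y, 0 ≤ qf B y) :
    B.PosSemidef := by
  refine Matrix.PosSemidef.of_dotProduct_mulVec_nonneg hB fun y => ?_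
  rw [dotProduct_mulVec_eq_qf hB]
  exact_mod_cast h y

lemma continuous_qf (B : Matrix ι ι ℂ) : Continuous (qf B) := by
  unfold qf dotProduct Matrix.mulVec dotProduct
  fun_prop

/-- The Rayleigh quotient of a pair of Hermitian forms attains its maximum, at a generalized
eigenvector. -/
lemma exists_max_ratio [Nonempty ι] {m a : Matrix ι ι ℂ} (hm : m.IsHermitian) (ha : a.PosDef) :
    ∃ t : ℝ, ∃ v : ι → ℂ, v ≠ 0 ∧ (∀ y, qf m y ≤ t * qf a y) ∧ m *ᵥ v = (t : ℂ) • (a *ᵥ v) := by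
  obtain ⟨v, hv, hmax⟩ := (isCompact_sphere (0 : ι → ℂ) 1).exists_isMaxOn
    (NormedSpace.sphere_nonempty.2 zero_le_one)
    (f := fun y => qf m y / qf a y) (by
      refine ContinuousOn.div (continuous_qf m).continuousOn (continuous_qf a).continuousOn ?_
      intro y hy
      exact (qf_pos ha (ne_zero_of_mem_unit_sphere ⟨y, hy⟩)).ne')
  have hv0 : v ≠ 0 := ne_zero_of_mem_unit_sphere ⟨v, hv⟩
  have hle : ∀ y, qf m y ≤ (qf m v / qf a v) * qf a y := by
    intro y
    by_cases hy : y = 0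
    · subst hy; simp [qf]
    have hn : 0 < ‖y‖ := norm_pos_iff.2 hy
    have h1 : ((‖y‖⁻¹ : ℝ) : ℂ) • y ∈ Metric.sphere (0 : ι → ℂ) 1 := by
      simp [norm_smul, hn.ne']
    have h2 := hmax h1
    simp only [Set.mem_ofPred_eq, qf_vec_smul] at h2
    rw [mul_div_mul_left _ _ (by positivity)] at h2
    exact (div_le_iff₀ (qf_pos ha hy)).1 h2
  refine ⟨qf m v / qf a v, v, hv0, hle, ?_⟩
  set t := qf m v / qf a v with ht
  have hH : (((t : ℝ) : ℂ) • a - m).IsHermitian := by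
    refine Matrix.IsHermitian.sub ?_ hm
    unfold Matrix.IsHermitian
    rw [Matrix.conjTranspose_smul, ha.isHermitian.eq]
    simp
  -- Maximality of t makes t a - m positive semidefinite, with a form vanishing at v; such a form
  -- has v in its kernel, which is the eigenvector equation.
  have hP : (((t : ℝ) : ℂ) • a - m).PosSemidef :=
    posSemidef_of_qf hH fun y => by rw [qf_sub, qf_smul]; linarith [hle y]
  have h0 : star v ⬝ᵥ (((t : ℝ) : ℂ) • a - m) *ᵥ v = 0 := by
    rw [dotProduct_mulVec_eq_qf hH, qf_sub, qf_smul, ht, div_mul_cancel₀ _ (qf_pos ha hv0).ne']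
    simp
  rw [hP.dotProduct_mulVec_zero_iff, Matrix.sub_mulVec, Matrix.smul_mulVec, sub_eq_zero] at h0
  exact h0.symm

lemma sum_norm_sq_le (u : ι → ℂ) : (∑ i, ‖u i‖) ^ 2 ≤ Fintype.card ι * nsq u := by
  simpa [nsq] using sq_sum_le_card_mul_sum_sq (s := Finset.univ) (f := fun i => ‖u i‖)

lemma abs_re_dotProduct_mulVec_le {E : Matrix ι ι ℂ} {e : ℝ} (hE : ∀ i j, ‖E i j‖ ≤ e)
    (u v : ι → ℂ) : |(star u ⬝ᵥ E *ᵥ v).re| ≤ e * ((∑ i, ‖u i‖) * ∑ i, ‖v i‖) := by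
  refine (Complex.abs_re_le_norm _).trans ?_
  simp only [dotProduct, Matrix.mulVec]
  rw [Finset.sum_mul_sum, Finset.mul_sum]
  refine (norm_sum_le _ _).trans (Finset.sum_le_sum fun i _ => ?_)
  rw [Finset.mul_sum, Finset.mul_sum]
  refine (norm_sum_le _ _).trans (Finset.sum_le_sum fun j _ => ?_)
  simp only [norm_mul, Pi.star_apply, norm_star]
  nlinarith [mul_le_mul_of_nonneg_left (hE i j)
    (mul_nonneg (norm_nonneg (u i)) (norm_nonneg (v j)))]

lemma qf_add_vec {H : Matrix ι ι ℂ} (hH : H.IsHermitian) (u v : ι → ℂ) :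
    qf H (u + v) = qf H u + qf H v + 2 * (star u ⬝ᵥ H *ᵥ v).re := by
  have h : (star v ⬝ᵥ H *ᵥ u).re = (star u ⬝ᵥ H *ᵥ v).re := by
    have : star v ⬝ᵥ H *ᵥ u = star (star u ⬝ᵥ H *ᵥ v) := by
      rw [Matrix.star_dotProduct, Matrix.star_mulVec, hH.eq, ← Matrix.dotProduct_mulVec]
    rw [this]
    simp
  simp only [qf, star_add, Matrix.mulVec_add, dotProduct_add, add_dotProduct, Complex.add_re, h]
  ring

/-- Polarization: z is the phase that turns the cross term of the form at e_i + z e_j into 2‖H i j‖,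
and the diagonal form at that vector is at most 2(a_i + a_j). -/
lemma norm_entry_le_of_qf [DecidableEq ι] {H : Matrix ι ι ℂ} (hH : H.IsHermitian)
    {a : ι → ℝ} (ha : ∀ i, 0 < a i)
    {θ : ℝ} (h : ∀ y, |qf H y| ≤ θ * qf (Matrix.diagonal fun i => (a i : ℂ)) y) (i j : ι) :
    ‖H i j‖ ≤ 2 * θ * (a i + a j) := by
  have hs : ∀ (k : ι) (z : ℂ), qf (Matrix.diagonal fun i => (a i : ℂ)) (Pi.single k z)
      = a k * ‖z‖ ^ 2 := by
    intro k z
    rw [qf_diagonal, Finset.sum_eq_single k]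
    · simp
    · intro b _ hb; simp [hb]
    · simp
  have hθ : 0 ≤ θ := by
    have h1 := (abs_nonneg _).trans (h (Pi.single i 1))
    rw [hs] at h1
    simp only [norm_one, one_pow, mul_one] at h1
    exact nonneg_of_mul_nonneg_left h1 (ha i)
  obtain ⟨z, hz, hzH⟩ : ∃ z : ℂ, ‖z‖ ≤ 1 ∧ (H i j * z).re = ‖H i j‖ := by
    by_cases h0 : H i j = 0
    · exact ⟨0, by simp, by simp [h0]⟩
    · refine ⟨star (H i j) / (‖H i j‖ : ℂ), by simp [h0], ?_⟩
      have h2 : H i j * (star (H i j) / (‖H i j‖ : ℂ)) = (‖H i j‖ : ℂ) := by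
        rw [← mul_div_assoc, ← starRingEnd_apply, Complex.mul_conj']
        field_simp
      rw [h2, Complex.ofReal_re]
  have h3 : star (Pi.single i (1 : ℂ) : ι → ℂ) ⬝ᵥ H *ᵥ Pi.single j z = H i j * z := by
    simp [mul_comm]
  have h4 := qf_add_vec hH (Pi.single i 1) (Pi.single j z)
  rw [h3, hzH] at h4
  have h5 := h (Pi.single i 1 + Pi.single j z)
  have h6 := h (Pi.single i 1)
  have h7 := h (Pi.single j z)
  have hz2 : ‖z‖ ^ 2 ≤ 1 := by nlinarith [norm_nonneg z]
  have h8 : qf (Matrix.diagonal fun i => (a i : ℂ)) (Pi.single i 1 + Pi.single j z)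
      ≤ 2 * (a i + a j) := by
    have h9 : qf (Matrix.diagonal fun i => (a i : ℂ)) (Pi.single i 1 + Pi.single j z) ≤
        2 * qf (Matrix.diagonal fun i => (a i : ℂ)) (Pi.single i 1)
        + 2 * qf (Matrix.diagonal fun i => (a i : ℂ)) (Pi.single j z) := by
      simp only [qf_diagonal]
      rw [Finset.mul_sum, Finset.mul_sum, ← Finset.sum_add_distrib]
      refine Finset.sum_le_sum fun k _ => ?_
      have := norm_add_le ((Pi.single i 1 : ι → ℂ) k) ((Pi.single j z : ι → ℂ) k)
      have h10 : ‖(Pi.single i 1 + Pi.single j z : ι → ℂ) k‖ ^ 2 ≤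
          2 * ‖(Pi.single i 1 : ι → ℂ) k‖ ^ 2 + 2 * ‖(Pi.single j z : ι → ℂ) k‖ ^ 2 := by
        rw [Pi.add_apply]
        nlinarith [norm_nonneg ((Pi.single i 1 : ι → ℂ) k + (Pi.single j z : ι → ℂ) k),
          sq_nonneg (‖(Pi.single i 1 : ι → ℂ) k‖ - ‖(Pi.single j z : ι → ℂ) k‖)]
      nlinarith [mul_le_mul_of_nonneg_left h10 (ha k).le]
    rw [hs, hs] at h9
    simp only [norm_one, one_pow, mul_one] at h9
    nlinarith [mul_le_mul_of_nonneg_left hz2 (ha j).le]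
  rw [hs] at h6 h7
  simp only [norm_one, one_pow, mul_one] at h6
  have h11 : θ * (a j * ‖z‖ ^ 2) ≤ θ * a j := by
    refine mul_le_mul_of_nonneg_left ?_ hθ
    nlinarith [mul_le_mul_of_nonneg_left hz2 (ha j).le]
  have h12 := mul_le_mul_of_nonneg_left h8 hθ
  have hai := mul_nonneg hθ (ha i).le
  have haj := mul_nonneg hθ (ha j).le
  nlinarith [abs_le.1 h5, abs_le.1 h6, abs_le.1 h7]

/-- A map `S` on matrices which is antitone up to scaling: `B' ≤ t B` with `t ≥ 1` implies
`S B ≤ t S B'` (inequalities between quadratic forms). -/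
def ScaledAntitone (S : Matrix ι ι ℂ → Matrix ι ι ℂ) : Prop :=
  ∀ B B' : Matrix ι ι ℂ, B.PosDef → B'.PosDef → ∀ t : ℝ, 1 ≤ t →
    (∀ y, qf B' y ≤ t * qf B y) → ∀ y, qf (S B) y ≤ t * qf (S B') y

lemma posDef_diagonal_ofReal {ι : Type*} [DecidableEq ι] {a : ι → ℝ} (ha : ∀ i, 0 < a i) :
    (Matrix.diagonal fun i => (a i : ℂ)).PosDef :=
  Matrix.PosDef.diagonal fun i => by exact_mod_cast ha i

/-- An approximate solution `m` of `(S m + r) m = 1` is close to a diagonal approximate solution,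
when `S` is antitone up to scaling. -/
theorem abs_qf_sub_le [DecidableEq ι] {S : Matrix ι ι ℂ → Matrix ι ι ℂ} (hS : ScaledAntitone S)
    {a : ι → ℝ} (ha : ∀ i, 0 < a i) {m : Matrix ι ι ℂ} (hm : m.PosDef) {r η η' : ℝ} (hr : 0 < r)
    (hη : 0 ≤ η) (hη' : 0 ≤ η')
    (h1 : ∀ u, |qf (S (Matrix.diagonal fun i => (a i : ℂ))) u + r * nsq u -
      qf (Matrix.diagonal fun i => ((a i)⁻¹ : ℂ)) u| ≤ η * nsq u)
    (h2 : ∀ v, |(star ((Matrix.diagonal fun i => (a i : ℂ)) *ᵥ v) ⬝ᵥ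
      ((S m + (r : ℂ) • 1) * m - 1) *ᵥ v).re| ≤
        η' * nsq ((Matrix.diagonal fun i => (a i : ℂ)) *ᵥ v)) (y : ι → ℂ) :
    |qf (m - Matrix.diagonal fun i => (a i : ℂ)) y| ≤
      (η + η') / r * qf (Matrix.diagonal fun i => (a i : ℂ)) y := by
  set A : Matrix ι ι ℂ := Matrix.diagonal fun i => (a i : ℂ) with hA
  have hAP : A.PosDef := posDef_diagonal_ofReal ha
  cases isEmpty_or_nonempty ι
  · simp [qf]
  have hA0 : ∀ v, A *ᵥ v = 0 → v = 0 := by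
    intro v hv
    by_contra hne
    have := qf_pos hAP hne
    simp [qf, hv] at this
  have hAv : ∀ v, (star (A *ᵥ v) ⬝ᵥ v).re =
      qf (Matrix.diagonal fun i => ((a i)⁻¹ : ℂ)) (A *ᵥ v) := by
    intro v
    unfold qf
    rw [Matrix.mulVec_mulVec, hA, Matrix.diagonal_mul_diagonal]
    congr 3
    have : (Matrix.diagonal fun i => ((a i : ℂ)⁻¹ * (a i : ℂ))) = (1 : Matrix ι ι ℂ) := by
      rw [← Matrix.diagonal_one]
      congr 1
      funext i
      exact inv_mul_cancel₀ (by exact_mod_cast (ha i).ne')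
    rw [this, Matrix.one_mulVec]
  -- At a generalized eigenvector, testing the equation of m against u = A v leaves only forms at u:
  -- m v becomes t u, and v itself becomes A⁻¹ u.
  have key : ∀ (t : ℝ) (v : ι → ℂ), m *ᵥ v = (t : ℂ) • (A *ᵥ v) →
      (star (A *ᵥ v) ⬝ᵥ ((S m + (r : ℂ) • 1) * m - 1) *ᵥ v).re =
        t * qf (S m) (A *ᵥ v) + t * (r * nsq (A *ᵥ v)) -
          qf (Matrix.diagonal fun i => ((a i)⁻¹ : ℂ)) (A *ᵥ v) := by
    intro t v hv
    rw [Matrix.sub_mulVec, ← Matrix.mulVec_mulVec, hv, Matrix.one_mulVec, dotProduct_sub,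
      Complex.sub_re, hAv, Matrix.mulVec_smul, dotProduct_smul]
    have : (star (A *ᵥ v) ⬝ᵥ (S m + (r : ℂ) • 1) *ᵥ A *ᵥ v).re
        = qf (S m) (A *ᵥ v) + r * nsq (A *ᵥ v) := by
      have := qf_add (S m) ((r : ℂ) • 1) (A *ᵥ v)
      rw [qf_smul, qf_one] at this
      exact this
    rw [smul_eq_mul, Complex.re_ofReal_mul, this]
    ring
  set θ := (η + η') / r with hθ
  have hθ0 : 0 ≤ θ := by positivity
  -- If the largest ratio t of m to A exceeds 1, then S A ≤ t S m. Subtracting the two tested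
  -- equations cancels A⁻¹ and leaves (t - 1) r |u|² ≤ (η + η') |u|².
  have hup : qf m y ≤ (1 + θ) * qf A y := by
    obtain ⟨t, v, hv, hle, hmv⟩ := exists_max_ratio hm.isHermitian hAP
    have ht : t ≤ 1 + θ := by
      by_contra! hlt
      have ht1 : 1 ≤ t := by linarith
      have hu : 0 < nsq (A *ᵥ v) := nsq_pos fun h => hv (hA0 v h)
      have e1 := hS A m hAP hm t ht1 hle (A *ᵥ v)
      have e2 := abs_le.1 (h2 v)
      rw [key t v hmv] at e2
      have e3 := abs_le.1 (h1 (A *ᵥ v))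
      have e4 : (t - 1) * r * nsq (A *ᵥ v) ≤ (η + η') * nsq (A *ᵥ v) := by nlinarith
      have e5 := le_of_mul_le_mul_right e4 hu
      have e6 : t - 1 ≤ θ := (le_div_iff₀ hr).2 e5
      linarith
    exact (hle y).trans (mul_le_mul_of_nonneg_right ht (qf_nonneg hAP.posSemidef y))
  -- The same argument with m and A exchanged. A largest ratio s ≤ 1 of A to m already means A ≤ m,
  -- and otherwise m v = s⁻¹ A v brings `key` back.
  have hlow : (1 - θ) * qf A y ≤ qf m y := by
    obtain ⟨s, v, hv, hle, hmv⟩ := exists_max_ratio hAP.isHermitian hm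
    have hs0 : 0 < s := by
      have := (qf_pos hAP hv).trans_le (hle v)
      exact pos_of_mul_pos_left this (qf_pos hm hv).le
    by_cases hs1 : s ≤ 1
    · have := hle y
      nlinarith [qf_nonneg hAP.posSemidef y, qf_nonneg hm.posSemidef y]
    push Not at hs1
    have hmv' : m *ᵥ v = ((s⁻¹ : ℝ) : ℂ) • (A *ᵥ v) := by
      rw [hmv, smul_smul]
      have : ((s⁻¹ : ℝ) : ℂ) * (s : ℂ) = 1 := by
        rw [← Complex.ofReal_mul, inv_mul_cancel₀ hs0.ne', Complex.ofReal_one]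
      rw [this, one_smul]
    have ht : 1 - θ ≤ s⁻¹ := by
      have hu : 0 < nsq (A *ᵥ v) := nsq_pos fun h => hv (hA0 v h)
      have e1 := hS m A hm hAP s hs1.le hle (A *ᵥ v)
      have e1' : s⁻¹ * qf (S m) (A *ᵥ v) ≤ qf (S A) (A *ᵥ v) := by
        rw [inv_mul_le_iff₀ hs0]; exact e1
      have e2 := abs_le.1 (h2 v)
      rw [key _ v hmv'] at e2
      have e3 := abs_le.1 (h1 (A *ᵥ v))
      have e4 : (1 - s⁻¹) * r * nsq (A *ᵥ v) ≤ (η + η') * nsq (A *ᵥ v) := by nlinarith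
      have e5 := le_of_mul_le_mul_right e4 hu
      have e6 : 1 - s⁻¹ ≤ θ := (le_div_iff₀ hr).2 e5
      linarith
    have h3 : s⁻¹ * qf A y ≤ qf m y := by
      rw [inv_mul_le_iff₀ hs0]; exact hle y
    exact (mul_le_mul_of_nonneg_right ht (qf_nonneg hAP.posSemidef y)).trans h3
  rw [qf_sub, abs_le]
  constructor <;> linarith

/-- Entrywise form of `abs_qf_sub_le`. -/
theorem norm_sub_diagonal_le [DecidableEq ι] {S : Matrix ι ι ℂ → Matrix ι ι ℂ}
    (hS : ScaledAntitone S)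
    {a : ι → ℝ} (ha : ∀ i, 0 < a i) {m : Matrix ι ι ℂ} (hm : m.PosDef) {r η η' b : ℝ} (hr : 0 < r)
    (hη : 0 ≤ η) (hη' : 0 ≤ η') (hb : ∀ i, (a i)⁻¹ ≤ b)
    (h1 : ∀ i j, ‖(S (Matrix.diagonal fun i => (a i : ℂ)) + (r : ℂ) • 1 -
      Matrix.diagonal fun i => ((a i)⁻¹ : ℂ)) i j‖ ≤ η)
    (h2 : ∀ i j, ‖((S m + (r : ℂ) • 1) * m - 1) i j‖ ≤ η') (i j : ι) :
    ‖(m - Matrix.diagonal fun i => (a i : ℂ)) i j‖ ≤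
      2 * (Fintype.card ι * (η + b * η') / r) * (a i + a j) := by
  have hb0 : 0 ≤ b := (inv_nonneg.2 (ha i).le).trans (hb i)
  refine norm_entry_le_of_qf (hm.isHermitian.sub (posDef_diagonal_ofReal ha).isHermitian) ha ?_ i j
  intro y
  have := abs_qf_sub_le hS ha hm (η := Fintype.card ι * η) (η' := Fintype.card ι * (b * η')) hr
    (by positivity) (by positivity) (fun u => ?_) (fun v => ?_) y
  · rwa [← mul_add] at this
  · have e := abs_re_dotProduct_mulVec_le h1 u u
    have e2 : (star u ⬝ᵥ (S (Matrix.diagonal fun i => (a i : ℂ)) + (r : ℂ) • 1 -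
      Matrix.diagonal fun i => ((a i)⁻¹ : ℂ)) *ᵥ u).re =
      qf (S (Matrix.diagonal fun i => (a i : ℂ))) u + r * nsq u -
      qf (Matrix.diagonal fun i => ((a i)⁻¹ : ℂ)) u := by
      have := qf_sub (S (Matrix.diagonal fun i => (a i : ℂ)) + (r : ℂ) • 1)
        (Matrix.diagonal fun i => ((a i)⁻¹ : ℂ)) u
      rw [qf_add, qf_smul, qf_one] at this
      exact this
    rw [e2] at e
    nlinarith [mul_le_mul_of_nonneg_left (sum_norm_sq_le u) hη]
  · set u := (Matrix.diagonal fun i => (a i : ℂ)) *ᵥ v with hu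
    have e := abs_re_dotProduct_mulVec_le h2 u v
    -- The entrywise error is a bilinear form in u and v = A⁻¹ u; this is where the bound b on A⁻¹
    -- enters, and the cardinality comes from comparing ℓ¹ with ℓ² norms.
    have e3 : ∑ i, ‖v i‖ ≤ b * ∑ i, ‖u i‖ := by
      rw [Finset.mul_sum]
      refine Finset.sum_le_sum fun i _ => ?_
      have : ‖u i‖ = a i * ‖v i‖ := by
        simp [hu, Matrix.mulVec_diagonal, abs_of_pos (ha i)]
      rw [this, ← mul_assoc]
      have := hb i
      rw [inv_le_iff_one_le_mul₀ (ha i)] at this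
      nlinarith [norm_nonneg (v i)]
    have hu0 : 0 ≤ ∑ i, ‖u i‖ := Finset.sum_nonneg fun _ _ => norm_nonneg _
    have e4 := mul_le_mul_of_nonneg_left (sum_norm_sq_le u) (mul_nonneg hb0 hη')
    have e5 := mul_le_mul_of_nonneg_left (mul_le_mul_of_nonneg_left e3 hu0) hη'
    nlinarith

/-- A positive definite solution of `(S m + r) m = 1` agrees with any diagonal one. -/
theorem eq_diagonal_of_solves [DecidableEq ι] {S : Matrix ι ι ℂ → Matrix ι ι ℂ}
    (hS : ScaledAntitone S)
    {a : ι → ℝ} (ha : ∀ i, 0 < a i) {m : Matrix ι ι ℂ} (hm : m.PosDef) {r : ℝ} (hr : 0 < r)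
    (h1 : (S (Matrix.diagonal fun i => (a i : ℂ)) + (r : ℂ) • 1) *
      Matrix.diagonal (fun i => (a i : ℂ)) = 1)
    (h2 : (S m + (r : ℂ) • 1) * m = 1) : m = Matrix.diagonal fun i => (a i : ℂ) := by
  have h1' : S (Matrix.diagonal fun i => (a i : ℂ)) + (r : ℂ) • 1 -
      (Matrix.diagonal fun i => ((a i)⁻¹ : ℂ)) = 0 := by
    rw [sub_eq_zero]
    have e : (Matrix.diagonal fun i => (a i : ℂ)) * (Matrix.diagonal fun i => ((a i)⁻¹ : ℂ)) =
        (1 : Matrix ι ι ℂ) := by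
      rw [Matrix.diagonal_mul_diagonal, ← Matrix.diagonal_one]
      congr 1
      funext i
      exact mul_inv_cancel₀ (by exact_mod_cast (ha i).ne')
    calc _ = (S (Matrix.diagonal fun i => (a i : ℂ)) + (r : ℂ) • 1) *
          ((Matrix.diagonal fun i => (a i : ℂ)) * (Matrix.diagonal fun i => ((a i)⁻¹ : ℂ))) := by
            rw [e, mul_one]
      _ = _ := by rw [← mul_assoc, h1, one_mul]
  ext i j
  have := norm_sub_diagonal_le hS ha hm (b := ∑ i, (a i)⁻¹) hr le_rfl le_rfl
    (fun i => Finset.single_le_sum (f := fun i => (a i)⁻¹)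
      (fun i _ => (inv_pos.2 (ha i)).le) (Finset.mem_univ i))
    (fun i j => by rw [h1']; simp) (fun i j => by rw [h2]; simp) i j
  simp only [mul_zero, add_zero, zero_div, zero_mul, norm_le_zero_iff, Matrix.sub_apply] at this
  exact sub_eq_zero.1 this

end Forms

/-! ### The scalar fixed point equations: existence and uniqueness. -/

section FixedPoint

variable {L : ℕ}

lemma sum_mul_nonneg {a δ : Fin L → ℝ} (ha : ∀ m, 0 ≤ a m) (hδ : ∀ m, 0 ≤ δ m) :
    0 ≤ ∑ m, a m * δ m := Finset.sum_nonneg fun m _ => mul_nonneg (ha m) (hδ m)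

lemma frac_nonneg {a δ : Fin L → ℝ} (ha : ∀ m, 0 ≤ a m) (hδ : ∀ m, 0 ≤ δ m) (ℓ : Fin L) :
    0 ≤ δ ℓ / (1 + ∑ m, a m * δ m) :=
  div_nonneg (hδ ℓ) (by linarith [sum_mul_nonneg ha hδ])

lemma mul_frac_le_one {a δ : Fin L → ℝ} (ha : ∀ m, 0 ≤ a m) (hδ : ∀ m, 0 ≤ δ m) (ℓ : Fin L) :
    a ℓ * (δ ℓ / (1 + ∑ m, a m * δ m)) ≤ 1 := by
  have h := sum_mul_nonneg ha hδ
  rw [← mul_div_assoc, div_le_one (by linarith)]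
  have := Finset.single_le_sum (f := fun m => a m * δ m) (fun m _ => mul_nonneg (ha m) (hδ m))
    (Finset.mem_univ ℓ)
  linarith

/-- This bound makes the expectations finite although δ need not have any moment. -/
lemma frac_le_inv {a δ : Fin L → ℝ} (ha : ∀ m, 0 < a m) (hδ : ∀ m, 0 ≤ δ m) (ℓ : Fin L) :
    δ ℓ / (1 + ∑ m, a m * δ m) ≤ (a ℓ)⁻¹ := by
  rw [← mul_one (a ℓ)⁻¹, le_inv_mul_iff₀ (ha ℓ)]
  exact mul_frac_le_one (fun m => (ha m).le) hδ ℓ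

/-- Antitonicity up to scaling, pointwise in δ. Since t ≥ 1, the constant 1 in the denominator is
also absorbed: 1 + b·δ ≤ t (1 + a·δ). -/
lemma frac_le_mul_frac {a b δ : Fin L → ℝ} (ha : ∀ m, 0 ≤ a m) (hb : ∀ m, 0 ≤ b m) {t : ℝ}
    (ht : 1 ≤ t) (h : ∀ m, b m ≤ t * a m) (hδ : ∀ m, 0 ≤ δ m) (ℓ : Fin L) :
    δ ℓ / (1 + ∑ m, a m * δ m) ≤ t * (δ ℓ / (1 + ∑ m, b m * δ m)) := by
  have h1 := sum_mul_nonneg ha hδ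
  have h2 := sum_mul_nonneg hb hδ
  rw [← mul_div_assoc, div_le_div_iff₀ (by linarith) (by linarith)]
  have h3 : ∑ m, b m * δ m ≤ t * ∑ m, a m * δ m := by
    rw [Finset.mul_sum]
    exact Finset.sum_le_sum fun m _ => by nlinarith [mul_le_mul_of_nonneg_right (h m) (hδ m)]
  have : 1 + ∑ m, b m * δ m ≤ t * (1 + ∑ m, a m * δ m) := by linarith
  nlinarith [mul_le_mul_of_nonneg_left this (hδ ℓ)]

lemma measurable_frac (a : Fin L → ℝ) (ℓ : Fin L) :
    Measurable fun δ : Fin L → ℝ => δ ℓ / (1 + ∑ m, a m * δ m) := by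
  fun_prop

variable {G : ProbabilityMeasure (Fin L → ℝ)}

lemma integrable_frac (hG : ∀ᵐ δ ∂(G : Measure (Fin L → ℝ)), ∀ m, 0 ≤ δ m) {a : Fin L → ℝ}
    (ha : ∀ m, 0 < a m) (ℓ : Fin L) :
    Integrable (fun δ => δ ℓ / (1 + ∑ m, a m * δ m)) (G : Measure (Fin L → ℝ)) := by
  refine Integrable.of_bound (measurable_frac a ℓ).aestronglyMeasurable (a ℓ)⁻¹ ?_
  filter_upwards [hG] with δ hδ
  rw [Real.norm_of_nonneg (frac_nonneg (fun m => (ha m).le) hδ ℓ)]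
  exact frac_le_inv ha hδ ℓ

lemma integral_frac_nonneg (hG : ∀ᵐ δ ∂(G : Measure (Fin L → ℝ)), ∀ m, 0 ≤ δ m) {a : Fin L → ℝ}
    (ha : ∀ m, 0 ≤ a m) (ℓ : Fin L) :
    0 ≤ ∫ δ, δ ℓ / (1 + ∑ m, a m * δ m) ∂(G : Measure (Fin L → ℝ)) := by
  refine integral_nonneg_of_ae ?_
  filter_upwards [hG] with δ hδ using frac_nonneg ha hδ ℓ

lemma integral_frac_le_mul (hG : ∀ᵐ δ ∂(G : Measure (Fin L → ℝ)), ∀ m, 0 ≤ δ m) {a b : Fin L → ℝ}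
    (ha : ∀ m, 0 < a m) (hb : ∀ m, 0 < b m) {t : ℝ} (ht : 1 ≤ t) (h : ∀ m, b m ≤ t * a m)
    (ℓ : Fin L) :
    ∫ δ, δ ℓ / (1 + ∑ m, a m * δ m) ∂(G : Measure (Fin L → ℝ)) ≤
      t * ∫ δ, δ ℓ / (1 + ∑ m, b m * δ m) ∂(G : Measure (Fin L → ℝ)) := by
  rw [← integral_const_mul]
  refine integral_mono_ae (integrable_frac hG ha ℓ) ((integrable_frac hG hb ℓ).const_mul t) ?_
  filter_upwards [hG] with δ hδ
  exact frac_le_mul_frac (fun m => (ha m).le) (fun m => (hb m).le) ht h hδ ℓ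

/-- The integrand ε δ_ℓ / (1 + ε ∑ δ_m) is at most 1 and tends to 0 with ε, so dominated convergence
applies without moments. The number ε becomes the lower end of the box in the Knaster–Tarski
argument and keeps the fixed point positive. -/
lemma exists_subsolution (hG : ∀ᵐ δ ∂(G : Measure (Fin L → ℝ)), ∀ m, 0 ≤ δ m) (c : ℝ) {r : ℝ}
    (hr : 0 < r) : ∃ ε : ℝ, 0 < ε ∧ ε ≤ 1 / r ∧ ∀ ℓ,
      ε * (c * (∫ δ, δ ℓ / (1 + ∑ m, ε * δ m) ∂(G : Measure (Fin L → ℝ))) + r) ≤ 1 := by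
  have hlim : ∀ ℓ, Tendsto (fun n : ℕ => (1 / ((n : ℝ) + 1)) * (c *
      (∫ δ, δ ℓ / (1 + ∑ m, (1 / ((n : ℝ) + 1)) * δ m) ∂(G : Measure (Fin L → ℝ))) + r))
      atTop (𝓝 0) := by
    intro ℓ
    have h1 : Tendsto (fun n : ℕ => ∫ δ, (1 / ((n : ℝ) + 1)) *
        (δ ℓ / (1 + ∑ m, (1 / ((n : ℝ) + 1)) * δ m)) ∂(G : Measure (Fin L → ℝ)))
        atTop (𝓝 (∫ _, (0 : ℝ) ∂(G : Measure (Fin L → ℝ)))) := by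
      refine tendsto_integral_of_dominated_convergence (fun _ => 1)
        (fun n => ((measurable_frac _ ℓ).const_mul _).aestronglyMeasurable) (integrable_const _)
        (fun n => ?_) ?_
      · filter_upwards [hG] with δ hδ
        have hn : (0 : ℝ) < 1 / ((n : ℝ) + 1) := by positivity
        have h1 := frac_nonneg (a := fun _ => 1 / ((n : ℝ) + 1)) (fun _ => hn.le) hδ ℓ
        rw [Real.norm_of_nonneg (mul_nonneg hn.le h1)]
        exact mul_frac_le_one (a := fun _ => 1 / ((n : ℝ) + 1)) (fun _ => hn.le) hδ ℓ
      · refine Eventually.of_forall fun δ => ?_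
        have h2 := tendsto_one_div_add_atTop_nhds_zero_nat (𝕜 := ℝ)
        have h3 : Tendsto (fun n : ℕ => 1 + ∑ m, (1 / ((n : ℝ) + 1)) * δ m) atTop
            (𝓝 (1 + ∑ m, 0 * δ m)) :=
          tendsto_const_nhds.add (tendsto_finsetSum _ fun m _ => h2.mul_const _)
        have := h2.mul ((tendsto_const_nhds (x := δ ℓ)).div h3 (by simp))
        simpa using this
    have h2 := (h1.const_mul c).add
      ((tendsto_one_div_add_atTop_nhds_zero_nat (𝕜 := ℝ)).mul_const r)
    simp only [integral_zero, mul_zero, zero_mul, add_zero] at h2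
    refine h2.congr fun n => ?_
    rw [integral_const_mul]
    ring
  have h1 : ∀ᶠ n : ℕ in atTop, ∀ ℓ : Fin L, (1 / ((n : ℝ) + 1)) * (c *
      (∫ δ, δ ℓ / (1 + ∑ m, (1 / ((n : ℝ) + 1)) * δ m) ∂(G : Measure (Fin L → ℝ))) + r) ≤ 1 :=
    eventually_all.2 fun ℓ => (hlim ℓ).eventually_le_const zero_lt_one
  have h2 : ∀ᶠ n : ℕ in atTop, 1 / ((n : ℝ) + 1) ≤ 1 / r :=
    (tendsto_one_div_add_atTop_nhds_zero_nat (𝕜 := ℝ)).eventually_le_const (by positivity)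
  obtain ⟨n, hn1, hn2⟩ := (h1.and h2).exists
  exact ⟨1 / ((n : ℝ) + 1), by positivity, hn2, hn1⟩

/-- Existence of a positive solution of the fixed point equations, by the Knaster–Tarski theorem. -/
theorem exists_solvesDiag (hG : ∀ᵐ δ ∂(G : Measure (Fin L → ℝ)), ∀ m, 0 ≤ δ m) {c σ : ℝ}
    (hc : 0 < c) (hσ : 0 < σ) : ∃ a : Fin L → ℝ, (∀ ℓ, 0 < a ℓ) ∧ SolvesDiag c σ G a := by
  obtain ⟨ε, hε, hε1, hsub⟩ := exists_subsolution hG c (r := σ ^ 2) (by positivity)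
  -- A nonempty interval [ε, 1/σ²] is a complete lattice, hence so is the box over it; instance
  -- search finds this through `Fact`.
  have : Fact (ε ≤ 1 / σ ^ 2) := ⟨hε1⟩
  set F : (Fin L → ℝ) → Fin L → ℝ := fun a ℓ =>
    1 / (c * (∫ δ, δ ℓ / (1 + ∑ m, a m * δ m) ∂(G : Measure (Fin L → ℝ))) + σ ^ 2) with hF
  have hden : ∀ a : Fin L → ℝ, (∀ m, 0 < a m) → ∀ ℓ, σ ^ 2 ≤
      c * (∫ δ, δ ℓ / (1 + ∑ m, a m * δ m) ∂(G : Measure (Fin L → ℝ))) + σ ^ 2 := by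
    intro a ha ℓ
    have := mul_nonneg hc.le (integral_frac_nonneg hG (fun m => (ha m).le) ℓ)
    linarith
  have hσ2 : 0 < σ ^ 2 := by positivity
  have hmono : ∀ a b : Fin L → ℝ, (∀ m, 0 < a m) → (∀ m, a m ≤ b m) → ∀ ℓ, F a ℓ ≤ F b ℓ := by
    intro a b ha hab ℓ
    have hb : ∀ m, 0 < b m := fun m => (ha m).trans_le (hab m)
    refine one_div_le_one_div_of_le (hσ2.trans_le (hden b hb ℓ)) ?_
    have := integral_frac_le_mul hG hb ha le_rfl (fun m => by rw [one_mul]; exact hab m) ℓ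
    rw [one_mul] at this
    nlinarith
  have hup : ∀ a : Fin L → ℝ, (∀ m, 0 < a m) → ∀ ℓ, F a ℓ ≤ 1 / σ ^ 2 := fun a ha ℓ =>
    one_div_le_one_div_of_le hσ2 (hden a ha ℓ)
  have hlow : ∀ a : Fin L → ℝ, (∀ m, ε ≤ a m) → ∀ ℓ, ε ≤ F a ℓ := by
    intro a ha ℓ
    refine le_trans ?_ (hmono (fun _ => ε) a (fun _ => hε) ha ℓ)
    rw [hF, le_div_iff₀ (hσ2.trans_le (hden _ (fun _ => hε) ℓ))]
    exact hsub ℓ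
  let f : (Fin L → Set.Icc ε (1 / σ ^ 2)) →o (Fin L → Set.Icc ε (1 / σ ^ 2)) :=
    { toFun := fun a ℓ => ⟨F (fun m => (a m : ℝ)) ℓ, hlow _ (fun m => (a m).2.1) ℓ,
        hup _ (fun m => hε.trans_le (a m).2.1) ℓ⟩
      monotone' := fun a b hab ℓ =>
        Subtype.mk_le_mk.2 (hmono _ _ (fun m => hε.trans_le (a m).2.1) (fun m => hab m) ℓ) }
  refine ⟨fun ℓ => (f.lfp ℓ : ℝ), fun ℓ => hε.trans_le (f.lfp ℓ).2.1, fun ℓ => ?_⟩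
  have := congrFun f.map_lfp ℓ
  exact (congrArg Subtype.val this).symm

lemma qf_single [DecidableEq (Fin L)] (B : Matrix (Fin L) (Fin L) ℂ) (ℓ : Fin L) :
    qf B (Pi.single ℓ 1) = (B ℓ ℓ).re := by
  simp [qf]

/-- The scalar system is lifted to matrices by a map S that reads only the real parts of the
diagonal, so that the matrix uniqueness principle applies to it. -/
theorem solvesDiag_unique (hG : ∀ᵐ δ ∂(G : Measure (Fin L → ℝ)), ∀ m, 0 ≤ δ m) {c σ : ℝ}
    (hc : 0 < c) (hσ : 0 < σ) {a b : Fin L → ℝ} (ha : ∀ ℓ, 0 < a ℓ) (hb : ∀ ℓ, 0 < b ℓ)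
    (hA : SolvesDiag c σ G a) (hB : SolvesDiag c σ G b) : b = a := by
  set f : (Fin L → ℝ) → Fin L → ℝ := fun a ℓ =>
    c * ∫ δ, δ ℓ / (1 + ∑ m, a m * δ m) ∂(G : Measure (Fin L → ℝ)) with hf
  set S : Matrix (Fin L) (Fin L) ℂ → Matrix (Fin L) (Fin L) ℂ := fun X =>
    Matrix.diagonal fun ℓ => ((f (fun m => (X m m).re) ℓ : ℝ) : ℂ) with hS
  have hpos : ∀ B : Matrix (Fin L) (Fin L) ℂ, B.PosDef → ∀ ℓ, 0 < (B ℓ ℓ).re := by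
    intro B hB ℓ
    rw [← qf_single]
    exact qf_pos hB (by simp)
  have hSA : ScaledAntitone S := by
    intro B B' hB hB' t ht h y
    simp only [hS, qf_diagonal, Finset.mul_sum]
    refine Finset.sum_le_sum fun ℓ _ => ?_
    rw [← mul_assoc]
    refine mul_le_mul_of_nonneg_right ?_ (by positivity)
    have := integral_frac_le_mul hG (hpos B hB) (hpos B' hB') ht
      (fun m => by rw [← qf_single, ← qf_single]; exact h _) ℓ
    simp only [hf]
    nlinarith
  have hsol : ∀ a : Fin L → ℝ, (∀ ℓ, 0 < a ℓ) → SolvesDiag c σ G a →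
      (S (Matrix.diagonal fun i => (a i : ℂ)) + ((σ ^ 2 : ℝ) : ℂ) • 1) *
      Matrix.diagonal (fun i => (a i : ℂ)) = 1 := by
    intro a ha h
    rw [← Matrix.diagonal_one, ← Matrix.diagonal_smul, hS]
    simp only [Matrix.diagonal_apply_eq, Complex.ofReal_re]
    rw [Matrix.diagonal_add, Matrix.diagonal_mul_diagonal]
    congr 1
    funext ℓ
    have h1 := h ℓ
    have h2 := integral_frac_nonneg hG (fun m => (ha m).le) ℓ
    have h3 : 0 < f a ℓ + σ ^ 2 := by
      have := mul_nonneg hc.le h2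
      have : 0 < σ ^ 2 := by positivity
      simp only [hf]; linarith
    have h4 : (f a ℓ + σ ^ 2) * a ℓ = 1 := by
      rw [h1]
      exact mul_one_div_cancel h3.ne'
    simp only [Pi.smul_apply, smul_eq_mul, mul_one]
    exact_mod_cast h4
  have := eq_diagonal_of_solves hSA ha (posDef_diagonal_ofReal hb) (r := σ ^ 2) (by positivity)
    (hsol a ha hA) (hsol b hb hB)
  have h := Matrix.diagonal_injective this
  funext ℓ
  exact_mod_cast congrFun h ℓ

end FixedPoint

/-! ### The matrix fixed point equation. -/

section MatrixEquation

variable {L : ℕ}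

lemma norm_mul_le_nsq (α : Fin L → ℂ) (ℓ ℓ' : Fin L) : ‖α ℓ‖ * ‖α ℓ'‖ ≤ nsq α := by
  have h1 : ‖α ℓ‖ ^ 2 ≤ nsq α :=
    Finset.single_le_sum (f := fun i => ‖α i‖ ^ 2) (fun _ _ => by positivity) (Finset.mem_univ ℓ)
  have h2 : ‖α ℓ'‖ ^ 2 ≤ nsq α :=
    Finset.single_le_sum (f := fun i => ‖α i‖ ^ 2) (fun _ _ => by positivity) (Finset.mem_univ ℓ')
  nlinarith [sq_nonneg (‖α ℓ‖ - ‖α ℓ'‖)]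

lemma one_add_qf_pos {B : Matrix (Fin L) (Fin L) ℂ} (hB : B.PosDef) (α : Fin L → ℂ) :
    0 < 1 + qf B α := by linarith [qf_nonneg hB.posSemidef α]

lemma one_add_dotProduct_eq {B : Matrix (Fin L) (Fin L) ℂ} (hB : B.PosDef) (α : Fin L → ℂ) :
    1 + star α ⬝ᵥ B *ᵥ α = ((1 + qf B α : ℝ) : ℂ) := by
  rw [dotProduct_mulVec_eq_qf hB.isHermitian]
  push_cast
  rfl

/-- A positive definite B dominates a multiple of the identity, so |α|² ≤ t α* B α and the integrand
is bounded by t. -/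
lemma integrable_expectMatrix (H : ProbabilityMeasure (Fin L → ℂ)) {B : Matrix (Fin L) (Fin L) ℂ}
    (hB : B.PosDef) (ℓ ℓ' : Fin L) :
    Integrable (fun α => α ℓ * star (α ℓ') / (1 + star α ⬝ᵥ B *ᵥ α))
      (H : Measure (Fin L → ℂ)) := by
  have : Nonempty (Fin L) := ⟨ℓ⟩
  obtain ⟨t, v, hv, ht, -⟩ := exists_max_ratio (m := 1) Matrix.isHermitian_one hB
  have ht0 : 0 ≤ t := by
    have h1 := (nsq_pos hv).trans_le ((qf_one v).symm.trans_le (ht v))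
    exact (pos_of_mul_pos_left h1 (qf_pos hB hv).le).le
  refine Integrable.of_bound (C := t) ?_ (Eventually.of_forall fun α => ?_)
  · refine Measurable.aestronglyMeasurable ?_
    refine Measurable.div (by fun_prop) (Measurable.const_add ?_ _)
    unfold dotProduct Matrix.mulVec dotProduct
    fun_prop
  · rw [one_add_dotProduct_eq hB, norm_div, Complex.norm_real,
      Real.norm_of_nonneg (one_add_qf_pos hB α).le, div_le_iff₀ (one_add_qf_pos hB α), norm_mul,
      norm_star]
    have h1 := norm_mul_le_nsq α ℓ ℓ'
    have h2 := ht α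
    rw [qf_one] at h2
    nlinarith

lemma star_dotProduct_vecMulVec_mulVec {ι : Type*} [Fintype ι] (α y : ι → ℂ) :
    star y ⬝ᵥ Matrix.vecMulVec α (star α) *ᵥ y = ((‖star α ⬝ᵥ y‖ ^ 2 : ℝ) : ℂ) := by
  rw [Matrix.vecMulVec_mulVec, dotProduct_smul]
  have : star y ⬝ᵥ α = star (star α ⬝ᵥ y) := by rw [Matrix.star_dotProduct]
  rw [this]
  push_cast
  rw [← Complex.conj_mul']
  simp

/-- Reduces order relations between expectation matrices to pointwise inequalities under a scalar
integral. -/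
lemma qf_expectMatrix (H : ProbabilityMeasure (Fin L → ℂ)) {B : Matrix (Fin L) (Fin L) ℂ}
    (hB : B.PosDef) (y : Fin L → ℂ) :
    Integrable (fun α => ‖star α ⬝ᵥ y‖ ^ 2 / (1 + qf B α)) (H : Measure (Fin L → ℂ)) ∧
    qf (expectMatrix H B) y = ∫ α, ‖star α ⬝ᵥ y‖ ^ 2 / (1 + qf B α) ∂(H : Measure (Fin L → ℂ)) := by
  have hpt : ∀ α : Fin L → ℂ, ∑ ℓ, ∑ ℓ', star (y ℓ) *
      ((α ℓ * star (α ℓ') / (1 + star α ⬝ᵥ B *ᵥ α)) * y ℓ') =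
      ((‖star α ⬝ᵥ y‖ ^ 2 / (1 + qf B α) : ℝ) : ℂ) := by
    intro α
    rw [Complex.ofReal_div, ← star_dotProduct_vecMulVec_mulVec, one_add_dotProduct_eq hB]
    simp only [dotProduct, Matrix.mulVec, Matrix.vecMulVec_apply, Finset.mul_sum, Finset.sum_div,
      Pi.star_apply]
    refine Finset.sum_congr rfl fun _ _ => Finset.sum_congr rfl fun _ _ => ?_
    ring
  have hint : ∀ ℓ ℓ', Integrable (fun α : Fin L → ℂ => star (y ℓ) *
      ((α ℓ * star (α ℓ') / (1 + star α ⬝ᵥ B *ᵥ α)) * y ℓ')) (H : Measure (Fin L → ℂ)) :=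
    fun ℓ ℓ' => ((integrable_expectMatrix H hB ℓ ℓ').mul_const _).const_mul _
  have hint2 : Integrable (fun α => ((‖star α ⬝ᵥ y‖ ^ 2 / (1 + qf B α) : ℝ) : ℂ))
      (H : Measure (Fin L → ℂ)) := by
    simp_rw [← hpt]
    exact integrable_finsetSum _ fun ℓ _ => integrable_finsetSum _ fun ℓ' _ => hint ℓ ℓ'
  refine ⟨by simpa only [RCLike.re_eq_complex_re, Complex.ofReal_re] using hint2.re, ?_⟩
  have h1 : star y ⬝ᵥ expectMatrix H B *ᵥ y =
      ∫ α, ((‖star α ⬝ᵥ y‖ ^ 2 / (1 + qf B α) : ℝ) : ℂ) ∂(H : Measure (Fin L → ℂ)) := by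
    simp_rw [← hpt]
    rw [integral_finsetSum _ fun ℓ _ => integrable_finsetSum _ fun ℓ' _ => hint ℓ ℓ']
    have e : star y ⬝ᵥ expectMatrix H B *ᵥ y =
        ∑ ℓ, ∑ ℓ', star (y ℓ) * (expectMatrix H B ℓ ℓ' * y ℓ') := by
      simp only [dotProduct, Matrix.mulVec, Finset.mul_sum, Pi.star_apply]
    rw [e]
    refine Finset.sum_congr rfl fun ℓ _ => ?_
    rw [integral_finsetSum _ fun ℓ' _ => hint ℓ ℓ']
    refine Finset.sum_congr rfl fun ℓ' _ => ?_
    rw [integral_const_mul, integral_mul_const]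
    rfl
  rw [qf, h1, integral_complex_ofReal, Complex.ofReal_re]

lemma scaledAntitone_expectMatrix (H : ProbabilityMeasure (Fin L → ℂ)) {c : ℝ} (hc : 0 ≤ c) :
    ScaledAntitone fun B => (c : ℂ) • expectMatrix H B := by
  intro B B' hB hB' t ht h y
  obtain ⟨i1, e1⟩ := qf_expectMatrix H hB y
  obtain ⟨i2, e2⟩ := qf_expectMatrix H hB' y
  simp only [qf_smul]
  rw [e1, e2, mul_left_comm, ← integral_const_mul t]
  refine mul_le_mul_of_nonneg_left (integral_mono i1 (i2.const_mul t) fun α => ?_) hc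
  have p1 := one_add_qf_pos hB α
  have p2 := one_add_qf_pos hB' α
  simp only
  rw [← mul_div_assoc, div_le_div_iff₀ p1 p2]
  have : 1 + qf B' α ≤ t * (1 + qf B α) := by linarith [h α]
  nlinarith [mul_le_mul_of_nonneg_left this (sq_nonneg ‖star α ⬝ᵥ y‖)]

variable {G : ProbabilityMeasure (Fin L → ℝ)}

/-- At a diagonal argument the denominator depends only on the |α_m|². The off-diagonal entries are
then cross moments, and the diagonal ones are integrals against the image law G. -/
lemma expectMatrix_diagonal {H : ProbabilityMeasure (Fin L → ℂ)}
    (hH : (H : Measure (Fin L → ℂ)).map (fun α => fun ℓ : Fin L => ‖α ℓ‖ ^ 2) = G)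
    (hcross : CrossMomentsVanish H) {a : Fin L → ℝ} (ha : ∀ ℓ, 0 < a ℓ) :
    expectMatrix H (Matrix.diagonal fun i => (a i : ℂ)) = Matrix.diagonal fun ℓ =>
      ((∫ δ, δ ℓ / (1 + ∑ m, a m * δ m) ∂(G : Measure (Fin L → ℝ)) : ℝ) : ℂ) := by
  have hden : ∀ α : Fin L → ℂ, 1 + star α ⬝ᵥ (Matrix.diagonal fun i => (a i : ℂ)) *ᵥ α =
      ((1 + ∑ m, a m * ‖α m‖ ^ 2 : ℝ) : ℂ) := by
    intro α
    rw [one_add_dotProduct_eq (posDef_diagonal_ofReal ha), qf_diagonal]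
  ext ℓ ℓ'
  simp only [expectMatrix, Matrix.of_apply, hden]
  by_cases h : ℓ = ℓ'
  · subst h
    have hm : Measurable fun (α : Fin L → ℂ) (ℓ : Fin L) => ‖α ℓ‖ ^ 2 := by fun_prop
    rw [Matrix.diagonal_apply_eq, ← hH, integral_map hm.aemeasurable
      (measurable_frac a ℓ).aestronglyMeasurable, ← integral_complex_ofReal]
    congr 1
    funext α
    push_cast
    rw [← Complex.mul_conj']
    rfl
  · rw [Matrix.diagonal_apply_ne _ h]
    exact hcross ℓ ℓ' h a ha

theorem solvesMatrix_diagonal (hG : ∀ᵐ δ ∂(G : Measure (Fin L → ℝ)), ∀ m, 0 ≤ δ m) {c σ : ℝ}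
    (hc : 0 < c) (hσ : 0 < σ) {a : Fin L → ℝ} (ha : ∀ ℓ, 0 < a ℓ) (hA : SolvesDiag c σ G a)
    {H : ProbabilityMeasure (Fin L → ℂ)}
    (hH : (H : Measure (Fin L → ℂ)).map (fun α => fun ℓ : Fin L => ‖α ℓ‖ ^ 2) = G)
    (hcross : CrossMomentsVanish H) :
    ((c : ℂ) • expectMatrix H (Matrix.diagonal fun i => (a i : ℂ)) + ((σ : ℂ) ^ 2) • 1) *
      Matrix.diagonal (fun i => (a i : ℂ)) = 1 := by
  rw [expectMatrix_diagonal hH hcross ha, ← Matrix.diagonal_one, ← Matrix.diagonal_smul,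
    ← Matrix.diagonal_smul, Matrix.diagonal_add, Matrix.diagonal_mul_diagonal]
  congr 1
  funext ℓ
  have h2 := mul_nonneg hc.le (integral_frac_nonneg hG (fun m => (ha m).le) ℓ)
  have h3 : 0 < c * (∫ δ, δ ℓ / (1 + ∑ m, a m * δ m) ∂(G : Measure (Fin L → ℝ))) + σ ^ 2 := by
    positivity
  have h4 : (c * (∫ δ, δ ℓ / (1 + ∑ m, a m * δ m) ∂(G : Measure (Fin L → ℝ))) + σ ^ 2) * a ℓ
      = 1 := by
    rw [hA ℓ]
    have := hA ℓ
    simp only [← this]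
    rw [this]
    exact mul_one_div_cancel h3.ne'
  simp only [Pi.smul_apply, smul_eq_mul, mul_one]
  exact_mod_cast h4

theorem solvesMatrix_unique {c σ : ℝ} (hc : 0 < c) (hσ : 0 < σ) {a : Fin L → ℝ}
    (ha : ∀ ℓ, 0 < a ℓ) {H : ProbabilityMeasure (Fin L → ℂ)}
    (hA : ((c : ℂ) • expectMatrix H (Matrix.diagonal fun i => (a i : ℂ)) + ((σ : ℂ) ^ 2) • 1) *
      Matrix.diagonal (fun i => (a i : ℂ)) = 1)
    {B : Matrix (Fin L) (Fin L) ℂ} (hB : B.PosDef) (hBs : SolvesMatrix c σ H B) :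
    B = Matrix.diagonal fun i => (a i : ℂ) := by
  refine eq_diagonal_of_solves (scaledAntitone_expectMatrix H hc.le) ha hB (r := σ ^ 2)
    (by positivity) (by simpa using hA) ?_
  -- The inverse of a singular matrix is 0 by convention, so invertibility of the bracket in the
  -- equation has to be read off from that of B.
  have hu : IsUnit B.det := (Matrix.isUnit_iff_isUnit_det _).1 hB.isUnit
  have hu' := hu
  rw [hBs, Matrix.isUnit_nonsing_inv_det_iff] at hu'
  have := Matrix.mul_nonsing_inv _ hu'
  rw [← hBs] at this
  simpa using this

end MatrixEquation

/-! ### Euclidean norms and resolvents of positive semidefinite matrices. -/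

section EuclideanNorm

variable {ι : Type*} [Fintype ι]

/-- The Euclidean norm of a complex vector. -/
noncomputable def l2 (v : ι → ℂ) : ℝ := ‖(WithLp.toLp 2 v : EuclideanSpace ℂ ι)‖

lemma l2_nonneg (v : ι → ℂ) : 0 ≤ l2 v := norm_nonneg _

lemma l2_sq (v : ι → ℂ) : l2 v ^ 2 = nsq v := by
  rw [l2, EuclideanSpace.norm_sq_eq]
  rfl

lemma l2_sub_comm (u v : ι → ℂ) : l2 (u - v) = l2 (v - u) := by
  simp only [l2, WithLp.toLp_sub]
  exact norm_sub_rev _ _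

lemma sum_mul_norm_le (u v : ι → ℂ) : ∑ i, ‖u i‖ * ‖v i‖ ≤ l2 u * l2 v := by
  have h := Finset.sum_mul_sq_le_sq_mul_sq Finset.univ (fun i => ‖u i‖) (fun i => ‖v i‖)
  have h2 : (∑ i, ‖u i‖ ^ 2) * ∑ i, ‖v i‖ ^ 2 = (l2 u * l2 v) ^ 2 := by
    rw [mul_pow, l2_sq, l2_sq]
    rfl
  rw [h2] at h
  exact le_of_sq_le_sq h (mul_nonneg (l2_nonneg _) (l2_nonneg _))

lemma norm_star_dotProduct_le (u v : ι → ℂ) : ‖star u ⬝ᵥ v‖ ≤ l2 u * l2 v := by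
  refine le_trans ?_ (sum_mul_norm_le u v)
  refine (norm_sum_le _ _).trans (le_of_eq ?_)
  simp

variable [DecidableEq ι]

lemma posDef_add_smul_one {ι : Type*} [DecidableEq ι] {C : Matrix ι ι ℂ} (hC : C.PosSemidef)
    {r : ℝ} (hr : 0 < r) :
    (C + (r : ℂ) • 1).PosDef :=
  Matrix.PosDef.posSemidef_add hC (Matrix.PosDef.one.smul (by exact_mod_cast hr))

variable {C : Matrix ι ι ℂ} {r : ℝ}

lemma shift_mul_inv (hC : C.PosSemidef) (hr : 0 < r) :
    (C + (r : ℂ) • 1) * (C + (r : ℂ) • 1)⁻¹ = 1 :=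
  Matrix.mul_nonsing_inv _ ((Matrix.isUnit_iff_isUnit_det _).1 (posDef_add_smul_one hC hr).isUnit)

lemma inv_mul_shift (hC : C.PosSemidef) (hr : 0 < r) :
    (C + (r : ℂ) • 1)⁻¹ * (C + (r : ℂ) • 1) = 1 :=
  Matrix.nonsing_inv_mul _ ((Matrix.isUnit_iff_isUnit_det _).1 (posDef_add_smul_one hC hr).isUnit)

lemma posDef_resolvent (hC : C.PosSemidef) (hr : 0 < r) : (C + (r : ℂ) • 1)⁻¹.PosDef :=
  (posDef_add_smul_one hC hr).inv

/-- With u = R v one has v* R v = u* (C + r) u, and C contributes a nonnegative amount. -/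
lemma mul_nsq_resolvent_le (hC : C.PosSemidef) (hr : 0 < r) (v : ι → ℂ) :
    r * nsq ((C + (r : ℂ) • 1)⁻¹ *ᵥ v) ≤ qf (C + (r : ℂ) • 1)⁻¹ v := by
  set R := (C + (r : ℂ) • 1)⁻¹ with hR
  have h1 : qf R v = qf (C + (r : ℂ) • 1) (R *ᵥ v) := by
    unfold qf
    rw [Matrix.mulVec_mulVec, shift_mul_inv hC hr, Matrix.one_mulVec, Matrix.star_mulVec,
      (posDef_resolvent hC hr).isHermitian.eq, ← Matrix.dotProduct_mulVec]
  rw [h1, qf_add, qf_smul, qf_one]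
  linarith [qf_nonneg hC (R *ᵥ v)]

lemma l2_resolvent_le (hC : C.PosSemidef) (hr : 0 < r) (v : ι → ℂ) :
    l2 ((C + (r : ℂ) • 1)⁻¹ *ᵥ v) ≤ l2 v / r := by
  have h1 := mul_nsq_resolvent_le hC hr v
  set R := (C + (r : ℂ) • 1)⁻¹ with hR
  have h2 : qf R v ≤ l2 v * l2 (R *ᵥ v) :=
    (Complex.re_le_norm _).trans (norm_star_dotProduct_le _ _)
  rw [← l2_sq] at h1
  rw [le_div_iff₀ hr]
  by_cases h0 : l2 (R *ᵥ v) = 0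
  · rw [h0]; simpa using l2_nonneg v
  · have h3 : 0 < l2 (R *ᵥ v) := lt_of_le_of_ne (l2_nonneg _) (Ne.symm h0)
    have : (l2 (R *ᵥ v) * r) * l2 (R *ᵥ v) ≤ l2 v * l2 (R *ᵥ v) := by nlinarith
    exact le_of_mul_le_mul_right this h3

lemma norm_form_resolvent_le (hC : C.PosSemidef) (hr : 0 < r) (u v : ι → ℂ) :
    ‖star u ⬝ᵥ (C + (r : ℂ) • 1)⁻¹ *ᵥ v‖ ≤ l2 u * l2 v / r := by
  refine (norm_star_dotProduct_le _ _).trans ?_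
  rw [mul_div_assoc]
  exact mul_le_mul_of_nonneg_left (l2_resolvent_le hC hr v) (l2_nonneg u)

lemma l2_single (q : ι) (z : ℂ) : l2 (Pi.single q z) = ‖z‖ := by
  rw [l2]
  simp

/-- A column is the image of a basis vector under an operator of norm at most 1/r. -/
lemma sum_col_resolvent_le (hC : C.PosSemidef) (hr : 0 < r) (q : ι) :
    ∑ p, ‖(C + (r : ℂ) • 1)⁻¹ p q‖ ^ 2 ≤ (1 / r) ^ 2 := by
  have h := l2_resolvent_le hC hr (Pi.single q 1)
  rw [l2_single, norm_one] at h
  have h2 := pow_le_pow_left₀ (l2_nonneg _) h 2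
  rw [l2_sq] at h2
  simpa [nsq] using h2

lemma norm_resolvent_swap (hC : C.PosSemidef) (hr : 0 < r) (p q : ι) :
    ‖(C + (r : ℂ) • 1)⁻¹ p q‖ = ‖(C + (r : ℂ) • 1)⁻¹ q p‖ := by
  rw [← (posDef_resolvent hC hr).isHermitian.apply p q, norm_star]

lemma sum_row_resolvent_le (hC : C.PosSemidef) (hr : 0 < r) (p : ι) :
    ∑ q, ‖(C + (r : ℂ) • 1)⁻¹ p q‖ ^ 2 ≤ (1 / r) ^ 2 := by
  simp_rw [norm_resolvent_swap hC hr p]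
  exact sum_col_resolvent_le hC hr p

lemma norm_resolvent_apply_le (hC : C.PosSemidef) (hr : 0 < r) (p q : ι) :
    ‖(C + (r : ℂ) • 1)⁻¹ p q‖ ≤ 1 / r := by
  have h := Finset.single_le_sum (f := fun p => ‖(C + (r : ℂ) • 1)⁻¹ p q‖ ^ 2)
    (fun _ _ => by positivity) (Finset.mem_univ p)
  exact le_of_sq_le_sq (h.trans (sum_col_resolvent_le hC hr q)) (by positivity)

lemma resolvent_sub {C' : Matrix ι ι ℂ} (hC : C.PosSemidef) (hC' : C'.PosSemidef) (hr : 0 < r) :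
    (C + (r : ℂ) • 1)⁻¹ - (C' + (r : ℂ) • 1)⁻¹ =
      (C + (r : ℂ) • 1)⁻¹ * (C' - C) * (C' + (r : ℂ) • 1)⁻¹ := by
  have h : C' - C = (C' + (r : ℂ) • 1) - (C + (r : ℂ) • 1) := by abel
  rw [h, mul_sub, sub_mul, inv_mul_shift hC hr, mul_assoc, shift_mul_inv hC' hr, mul_one, one_mul]

lemma mul_vecMulVec_mul_resolvent {C' : Matrix ι ι ℂ} (hC' : C'.PosSemidef) (hr : 0 < r)
    (R : Matrix ι ι ℂ) (u v : ι → ℂ) :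
    R * Matrix.vecMulVec u (star v) * (C' + (r : ℂ) • 1)⁻¹ =
      Matrix.vecMulVec (R *ᵥ u) (star ((C' + (r : ℂ) • 1)⁻¹ *ᵥ v)) := by
  rw [Matrix.mul_vecMulVec, Matrix.vecMulVec_mul, Matrix.star_mulVec,
    (posDef_resolvent hC' hr).isHermitian.eq]

/-- The resolvent after a rank one update, applied to the direction of the update. -/
lemma resolvent_rankOne_mulVec (hC : C.PosSemidef) (hr : 0 < r) {s : ℝ} (hs : 0 ≤ s) (β : ι → ℂ) :
    (C + (s : ℂ) • Matrix.vecMulVec β (star β) + (r : ℂ) • 1)⁻¹ *ᵥ β =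
      ((1 + s * qf (C + (r : ℂ) • 1)⁻¹ β : ℝ) : ℂ)⁻¹ • ((C + (r : ℂ) • 1)⁻¹ *ᵥ β) := by
  have hs' : (0 : ℂ) ≤ (s : ℂ) := by exact_mod_cast hs
  have hC' : (C + (s : ℂ) • Matrix.vecMulVec β (star β)).PosSemidef :=
    hC.add ((Matrix.posSemidef_vecMulVec_self_star β).smul hs')
  set R := (C + (r : ℂ) • 1)⁻¹ with hR
  have hq : 0 ≤ qf R β := qf_nonneg (posDef_resolvent hC hr).posSemidef β
  have h0 : ((1 + s * qf R β : ℝ) : ℂ) ≠ 0 := by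
    have : (0 : ℝ) < 1 + s * qf R β := by positivity
    exact_mod_cast this.ne'
  -- The Sherman–Morrison formula is checked by applying the updated matrix to R β, which gives a
  -- multiple of β.
  have h1 : (C + (s : ℂ) • Matrix.vecMulVec β (star β) + (r : ℂ) • 1) *ᵥ (R *ᵥ β) =
      ((1 + s * qf R β : ℝ) : ℂ) • β := by
    have e : C + (s : ℂ) • Matrix.vecMulVec β (star β) + (r : ℂ) • 1 =
        (C + (r : ℂ) • 1) + (s : ℂ) • Matrix.vecMulVec β (star β) := by abel
    rw [e, Matrix.add_mulVec, Matrix.mulVec_mulVec, shift_mul_inv hC hr, Matrix.one_mulVec,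
      Matrix.smul_mulVec, Matrix.vecMulVec_mulVec,
      dotProduct_mulVec_eq_qf (posDef_resolvent hC hr).isHermitian]
    generalize qf R β = q
    ext i
    simp
    ring
  rw [eq_inv_smul_iff₀ h0, ← Matrix.mulVec_smul, ← h1, Matrix.mulVec_mulVec, inv_mul_shift hC' hr,
    Matrix.one_mulVec]

end EuclideanNorm

/-! ### Block traces and block forms. -/

section Blocks

variable {L N : ℕ}

/-- The vector `(w(1) vᵀ, …, w(L) vᵀ)ᵀ`. -/
def tens (w : Fin L → ℂ) (v : Fin N → ℂ) : Fin L × Fin N → ℂ := fun p => w p.1 * v p.2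

/-- The block `(ℓ, ℓ')` of a matrix. -/
def block (R : Matrix (Fin L × Fin N) (Fin L × Fin N) ℂ) (p q : Fin L) :
    Matrix (Fin N) (Fin N) ℂ := Matrix.of fun i j => R (p, i) (q, j)

/-- The matrix of the normalized traces of the blocks. -/
noncomputable def blockTrace (R : Matrix (Fin L × Fin N) (Fin L × Fin N) ℂ) :
    Matrix (Fin L) (Fin L) ℂ := Matrix.of fun p q => (1 / (N : ℂ)) * ∑ i, R (p, i) (q, i)

/-- The matrix of the normalized quadratic forms of the blocks at the vector `x`. -/
noncomputable def blockForm (R : Matrix (Fin L × Fin N) (Fin L × Fin N) ℂ) (x : Fin N → ℂ) :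
    Matrix (Fin L) (Fin L) ℂ :=
  Matrix.of fun ℓ ℓ' => (1 / (N : ℂ)) * (star x ⬝ᵥ block R ℓ ℓ' *ᵥ x)

lemma l2_tens (w : Fin L → ℂ) (v : Fin N → ℂ) : l2 (tens w v) = l2 w * l2 v := by
  rw [← sq_eq_sq₀ (l2_nonneg _) (mul_nonneg (l2_nonneg _) (l2_nonneg _)), mul_pow, l2_sq, l2_sq,
    l2_sq]
  simp only [nsq, tens, Fintype.sum_prod_type, Finset.sum_mul_sum, norm_mul, mul_pow]

lemma tens_sub (w : Fin L → ℂ) (u v : Fin N → ℂ) : tens w (u - v) = tens w u - tens w v := by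
  ext p; simp [tens, mul_sub]

lemma star_tens_dotProduct (R : Matrix (Fin L × Fin N) (Fin L × Fin N) ℂ) (w w' : Fin L → ℂ)
    (x x' : Fin N → ℂ) :
    star (tens w x) ⬝ᵥ R *ᵥ tens w' x' =
      ∑ ℓ, ∑ ℓ', star (w ℓ) * w' ℓ' * (star x ⬝ᵥ block R ℓ ℓ' *ᵥ x') := by
  simp only [dotProduct, Matrix.mulVec, Fintype.sum_prod_type, tens, block, Matrix.of_apply,
    Finset.mul_sum, Pi.star_apply, star_mul']
  refine Finset.sum_congr rfl fun ℓ _ => ?_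
  rw [Finset.sum_comm]
  refine Finset.sum_congr rfl fun ℓ' _ => Finset.sum_congr rfl fun i _ =>
    Finset.sum_congr rfl fun j _ => ?_
  ring

lemma dotProduct_blockForm (R : Matrix (Fin L × Fin N) (Fin L × Fin N) ℂ) (w : Fin L → ℂ)
    (x : Fin N → ℂ) :
    star w ⬝ᵥ blockForm R x *ᵥ w = (1 / (N : ℂ)) * (star (tens w x) ⬝ᵥ R *ᵥ tens w x) := by
  rw [star_tens_dotProduct]
  simp only [dotProduct, Matrix.mulVec, blockForm, Matrix.of_apply, Finset.mul_sum, Pi.star_apply,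
    Finset.sum_mul]
  refine Finset.sum_congr rfl fun ℓ _ => Finset.sum_congr rfl fun ℓ' _ =>
    Finset.sum_congr rfl fun i _ => Finset.sum_congr rfl fun j _ => ?_
  ring

lemma blockForm_apply_eq (R : Matrix (Fin L × Fin N) (Fin L × Fin N) ℂ) (x : Fin N → ℂ)
    (ℓ ℓ' : Fin L) : blockForm R x ℓ ℓ' = (1 / (N : ℂ)) *
      (star (tens (Pi.single ℓ 1) x) ⬝ᵥ R *ᵥ tens (Pi.single ℓ' 1) x) := by
  rw [star_tens_dotProduct]
  simp [blockForm, Pi.single_apply]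

lemma norm_sum_block_le (u v : Fin L × Fin N → ℂ) (ℓ ℓ' : Fin L) :
    ‖∑ i, u (ℓ, i) * star (v (ℓ', i))‖ ≤ l2 u * l2 v := by
  have h : ∀ (u : Fin L × Fin N → ℂ) ℓ, l2 (fun i => u (ℓ, i)) ≤ l2 u := by
    intro u ℓ
    refine le_of_sq_le_sq ?_ (l2_nonneg _)
    rw [l2_sq, l2_sq, nsq, nsq, Fintype.sum_prod_type]
    exact Finset.single_le_sum (f := fun ℓ => ∑ i, ‖u (ℓ, i)‖ ^ 2)
      (fun _ _ => Finset.sum_nonneg fun _ _ => by positivity) (Finset.mem_univ ℓ)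
  refine (norm_sum_le _ _).trans ?_
  simp only [norm_mul, norm_star]
  exact (sum_mul_norm_le _ _).trans (mul_le_mul (h u ℓ) (h v ℓ') (l2_nonneg _) (l2_nonneg _))

lemma blockTrace_sub (R R' : Matrix (Fin L × Fin N) (Fin L × Fin N) ℂ) :
    blockTrace (R - R') = blockTrace R - blockTrace R' := by
  ext ℓ ℓ'
  simp [blockTrace, mul_sub]

lemma blockTrace_add (R R' : Matrix (Fin L × Fin N) (Fin L × Fin N) ℂ) :
    blockTrace (R + R') = blockTrace R + blockTrace R' := by
  ext ℓ ℓ'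
  simp [blockTrace, mul_add, Finset.sum_add_distrib]

lemma blockTrace_smul (z : ℂ) (R : Matrix (Fin L × Fin N) (Fin L × Fin N) ℂ) :
    blockTrace (z • R) = z • blockTrace R := by
  ext ℓ ℓ'
  simp [blockTrace, ← Finset.mul_sum]
  ring

lemma blockTrace_sum {κ : Type*} (F : Finset κ)
    (R : κ → Matrix (Fin L × Fin N) (Fin L × Fin N) ℂ) :
    blockTrace (∑ k ∈ F, R k) = ∑ k ∈ F, blockTrace (R k) := by
  classical
  induction F using Finset.induction_on with
  | empty => ext; simp [blockTrace]
  | insert a s ha ih => rw [Finset.sum_insert ha, Finset.sum_insert ha, blockTrace_add, ih]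

lemma blockTrace_one (hN : N ≠ 0) :
    blockTrace (1 : Matrix (Fin L × Fin N) (Fin L × Fin N) ℂ) = 1 := by
  ext ℓ ℓ'
  simp [blockTrace, Matrix.one_apply, hN]

lemma norm_blockTrace_vecMulVec_le (u v : Fin L × Fin N → ℂ) (ℓ ℓ' : Fin L) :
    ‖blockTrace (Matrix.vecMulVec u (star v)) ℓ ℓ'‖ ≤ (1 / (N : ℝ)) * (l2 u * l2 v) := by
  simp only [blockTrace, Matrix.of_apply, Matrix.vecMulVec_apply, Pi.star_apply, norm_mul]
  have h : ‖1 / (N : ℂ)‖ = 1 / (N : ℝ) := by simp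
  rw [h]
  exact mul_le_mul_of_nonneg_left (norm_sum_block_le u v ℓ ℓ') (by positivity)

/-- The block trace is an average of values of the form R at the vectors y ⊗ e_i; positivity of R
therefore passes to it. -/
lemma star_single_tens_single (R : Matrix (Fin L × Fin N) (Fin L × Fin N) ℂ) (y : Fin L → ℂ) :
    star y ⬝ᵥ blockTrace R *ᵥ y =
      (1 / (N : ℂ)) * ∑ i, star (tens y (Pi.single i 1)) ⬝ᵥ R *ᵥ tens y (Pi.single i 1) := by
  simp only [star_tens_dotProduct]
  simp only [block, ← Pi.single_star, star_one, Matrix.mulVec_single_one, single_one_dotProduct,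
    Matrix.col_apply, Matrix.of_apply]
  rw [Finset.sum_comm]
  simp only [dotProduct, Matrix.mulVec, blockTrace, Matrix.of_apply, Finset.mul_sum, Pi.star_apply,
    Finset.sum_mul]
  refine Finset.sum_congr rfl fun ℓ _ => ?_
  rw [Finset.sum_comm]
  refine Finset.sum_congr rfl fun i _ => Finset.sum_congr rfl fun ℓ' _ => ?_
  ring

lemma qf_blockTrace (R : Matrix (Fin L × Fin N) (Fin L × Fin N) ℂ) (y : Fin L → ℂ) :
    qf (blockTrace R) y = (1 / (N : ℝ)) * ∑ i, qf R (tens y (Pi.single i 1)) := by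
  rw [qf, star_single_tens_single]
  have : (1 / (N : ℂ)) = ((1 / (N : ℝ) : ℝ) : ℂ) := by push_cast; rfl
  rw [this, Complex.re_ofReal_mul, Complex.re_sum]
  rfl

lemma posDef_blockTrace (hN : N ≠ 0) {R : Matrix (Fin L × Fin N) (Fin L × Fin N) ℂ}
    (hR : R.PosDef) : (blockTrace R).PosDef := by
  have hH : (blockTrace R).IsHermitian := by
    ext ℓ ℓ'
    simp only [blockTrace, Matrix.conjTranspose_apply, Matrix.of_apply, star_mul', star_sum]
    congr 1
    · simp
    · exact Finset.sum_congr rfl fun i _ => hR.isHermitian.apply _ _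
  refine Matrix.PosDef.of_dotProduct_mulVec_pos hH fun y hy => ?_
  rw [dotProduct_mulVec_eq_qf hH]
  have : 0 < qf (blockTrace R) y := by
    rw [qf_blockTrace]
    have hN' : 0 < (N : ℝ) := by positivity
    refine mul_pos (by positivity) (Finset.sum_pos (fun i _ => qf_pos hR ?_) ?_)
    · intro h
      apply hy
      funext ℓ
      simpa [tens] using congrFun h (ℓ, i)
    · have : Nonempty (Fin N) := ⟨⟨0, Nat.pos_of_ne_zero hN⟩⟩
      exact Finset.univ_nonempty
  exact_mod_cast this

lemma norm_blockTrace_le {R : Matrix (Fin L × Fin N) (Fin L × Fin N) ℂ} {b : ℝ} (hb : 0 ≤ b)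
    (hR : ∀ p q, ‖R p q‖ ≤ b) (ℓ ℓ' : Fin L) : ‖blockTrace R ℓ ℓ'‖ ≤ b := by
  simp only [blockTrace, Matrix.of_apply, norm_mul]
  have h1 : ‖1 / (N : ℂ)‖ = 1 / (N : ℝ) := by simp
  have h2 : ‖∑ i, R (ℓ, i) (ℓ', i)‖ ≤ N * b := by
    refine (norm_sum_le _ _).trans ((Finset.sum_le_sum fun i _ => hR _ _).trans (le_of_eq ?_))
    simp
  rw [h1]
  by_cases hN : N = 0
  · subst hN; simpa using hb
  · have hN' : 0 < (N : ℝ) := by positivity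
    calc 1 / (N : ℝ) * ‖∑ i, R (ℓ, i) (ℓ', i)‖ ≤ 1 / (N : ℝ) * (N * b) :=
          mul_le_mul_of_nonneg_left h2 (by positivity)
      _ = b := by field_simp

end Blocks

/-! ### Resolvents of sample covariance matrices and the approximate fixed point equation. -/

section Covariance

variable {L N : ℕ}

/-- The matrix `(1/N) ∑_{k ∈ F} β_k β_k^*` with `β_k = (w_k(1) x_kᵀ, …, w_k(L) x_kᵀ)ᵀ`. -/
noncomputable def cov (F : Finset ℕ) (w : ℕ → Fin L → ℂ) (x : ℕ → Fin N → ℂ) :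
    Matrix (Fin L × Fin N) (Fin L × Fin N) ℂ :=
  ((1 / (N : ℝ) : ℝ) : ℂ) •
    ∑ k ∈ F, Matrix.vecMulVec (tens (w k) (x k)) (star (tens (w k) (x k)))

/-- The resolvent of `cov F w x` at `-r`. -/
noncomputable def res (r : ℝ) (F : Finset ℕ) (w : ℕ → Fin L → ℂ) (x : ℕ → Fin N → ℂ) :
    Matrix (Fin L × Fin N) (Fin L × Fin N) ℂ := (cov F w x + (r : ℂ) • 1)⁻¹

variable {F : Finset ℕ} {w : ℕ → Fin L → ℂ} {x : ℕ → Fin N → ℂ} {r : ℝ}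

lemma posSemidef_cov (F : Finset ℕ) (w : ℕ → Fin L → ℂ) (x : ℕ → Fin N → ℂ) :
    (cov F w x).PosSemidef := by
  refine (Matrix.posSemidef_sum _ fun k _ => Matrix.posSemidef_vecMulVec_self_star _).smul ?_
  have : (0 : ℝ) ≤ 1 / N := by positivity
  exact_mod_cast this

lemma posDef_res (hr : 0 < r) (F : Finset ℕ) (w : ℕ → Fin L → ℂ) (x : ℕ → Fin N → ℂ) :
    (res r F w x).PosDef := posDef_resolvent (posSemidef_cov F w x) hr

lemma cov_erase {k : ℕ} (hk : k ∈ F) : cov F w x = cov (F.erase k) w x +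
    ((1 / (N : ℝ) : ℝ) : ℂ) •
      Matrix.vecMulVec (tens (w k) (x k)) (star (tens (w k) (x k))) := by
  rw [cov, cov, ← smul_add, add_comm, Finset.add_sum_erase F (fun k =>
    Matrix.vecMulVec (tens (w k) (x k)) (star (tens (w k) (x k)))) hk]

lemma res_mulVec_tens (hr : 0 < r) {k : ℕ} (hk : k ∈ F) :
    res r F w x *ᵥ tens (w k) (x k) =
      ((1 + (1 / (N : ℝ)) * qf (res r (F.erase k) w x) (tens (w k) (x k)) : ℝ) : ℂ)⁻¹ •
        (res r (F.erase k) w x *ᵥ tens (w k) (x k)) := by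
  rw [res, cov_erase hk]
  exact resolvent_rankOne_mulVec (posSemidef_cov _ w x) hr (by positivity) _

/-- The difference is the rank one matrix (1/N) (R'β)(R'β)* / (1 + q) up to sign, with q = β* R' β /
N, and |R'β|² / N ≤ q / r. The factor 1 + q absorbs q, so the bound depends neither on the weights
nor on the entries. -/
lemma norm_blockTrace_res_erase_le (hr : 0 < r) {k : ℕ} (hk : k ∈ F) (ℓ ℓ' : Fin L) :
    ‖(blockTrace (res r F w x) - blockTrace (res r (F.erase k) w x)) ℓ ℓ'‖ ≤ 1 / (N * r) := by
  set β := tens (w k) (x k) with hβ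
  set R' := res r (F.erase k) w x with hR'
  have hq : 0 ≤ qf R' β := qf_nonneg (posDef_res hr _ w x).posSemidef β
  set q : ℝ := (1 / (N : ℝ)) * qf R' β with hqdef
  have hq0 : 0 ≤ q := by positivity
  have h1 : res r F w x - R' = (-(((1 / (N : ℝ) : ℝ) : ℂ))) • Matrix.vecMulVec
      (res r F w x *ᵥ β) (star (R' *ᵥ β)) := by
    rw [hR', res, res, resolvent_sub (posSemidef_cov _ w x) (posSemidef_cov _ w x) hr]
    have h2 : cov (F.erase k) w x - cov F w x =
        (-(((1 / (N : ℝ) : ℝ) : ℂ))) • Matrix.vecMulVec β (star β) := by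
      rw [cov_erase hk, neg_smul]
      abel
    rw [h2, mul_smul_comm, smul_mul_assoc,
      mul_vecMulVec_mul_resolvent (posSemidef_cov _ w x) hr]
  rw [← blockTrace_sub, h1, res_mulVec_tens hr hk, ← hβ, ← hR', ← hqdef, Matrix.smul_vecMulVec,
    smul_smul, blockTrace_smul, Matrix.smul_apply, norm_smul, norm_mul, norm_neg, norm_inv,
    Complex.norm_real, Complex.norm_real, Real.norm_of_nonneg (by positivity),
    Real.norm_of_nonneg (by positivity)]
  have h3 := norm_blockTrace_vecMulVec_le (R' *ᵥ β) (R' *ᵥ β) ℓ ℓ'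
  have h4 : l2 (R' *ᵥ β) * l2 (R' *ᵥ β) ≤ qf R' β / r := by
    rw [← pow_two, l2_sq, le_div_iff₀ hr, mul_comm]
    exact mul_nsq_resolvent_le (posSemidef_cov _ w x) hr β
  have h5 : (1 / (N : ℝ)) * (l2 (R' *ᵥ β) * l2 (R' *ᵥ β)) ≤ q / r := by
    rw [hqdef, mul_div_assoc]
    exact mul_le_mul_of_nonneg_left h4 (by positivity)
  have h6 : (1 + q)⁻¹ * (q / r) ≤ 1 / r := by
    rw [← mul_div_assoc]
    refine div_le_div_of_nonneg_right ?_ hr.le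
    rw [inv_mul_le_iff₀ (by positivity)]
    linarith
  calc 1 / (N : ℝ) * (1 + q)⁻¹ * ‖blockTrace (Matrix.vecMulVec (R' *ᵥ β) (star (R' *ᵥ β))) ℓ ℓ'‖
      ≤ 1 / (N : ℝ) * (1 + q)⁻¹ * (q / r) :=
        mul_le_mul_of_nonneg_left (h3.trans h5) (by positivity)
    _ = 1 / (N : ℝ) * ((1 + q)⁻¹ * (q / r)) := by ring
    _ ≤ 1 / (N : ℝ) * (1 / r) := mul_le_mul_of_nonneg_left h6 (by positivity)
    _ = 1 / (N * r) := by rw [one_div_mul_one_div]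

/-- Users are removed one at a time. This serves to discard the users with large weights. -/
lemma norm_blockTrace_res_sub_le (hr : 0 < r) {F' : Finset ℕ} (h : F' ⊆ F) (ℓ ℓ' : Fin L) :
    ‖(blockTrace (res r F w x) - blockTrace (res r F' w x)) ℓ ℓ'‖ ≤
      (F \ F').card * (1 / (N * r)) := by
  suffices H : ∀ n (F : Finset ℕ), F' ⊆ F → (F \ F').card = n →
      ‖(blockTrace (res r F w x) - blockTrace (res r F' w x)) ℓ ℓ'‖ ≤ n * (1 / (N * r)) from
    H _ F h rfl
  intro n
  induction n with
  | zero =>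
    intro F hF hn
    have : F = F' := by
      rw [Finset.card_eq_zero, Finset.sdiff_eq_empty_iff_subset] at hn
      exact hn.antisymm hF
    simp [this]
  | succ n ih =>
    intro F hF hn
    obtain ⟨k, hk⟩ : (F \ F').Nonempty := by rw [← Finset.card_pos]; omega
    rw [Finset.mem_sdiff] at hk
    have h1 : F' ⊆ F.erase k := Finset.subset_erase.2 ⟨hF, hk.2⟩
    have h2 : (F.erase k \ F').card = n := by
      rw [Finset.erase_sdiff_comm, Finset.card_erase_of_mem (Finset.mem_sdiff.2 hk), hn]
      rfl
    have h3 := ih _ h1 h2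
    have h4 := norm_blockTrace_res_erase_le (w := w) (x := x) hr hk.1 ℓ ℓ'
    have h5 : (blockTrace (res r F w x) - blockTrace (res r F' w x)) ℓ ℓ' =
      (blockTrace (res r F w x) - blockTrace (res r (F.erase k) w x)) ℓ ℓ' +
      (blockTrace (res r (F.erase k) w x) - blockTrace (res r F' w x)) ℓ ℓ' := by
      simp
    rw [h5]
    refine (norm_add_le _ _).trans ?_
    push_cast
    linarith

lemma qf_blockForm (R : Matrix (Fin L × Fin N) (Fin L × Fin N) ℂ) (w : Fin L → ℂ)
    (x : Fin N → ℂ) : qf (blockForm R x) w = (1 / (N : ℝ)) * qf R (tens w x) := by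
  rw [qf, dotProduct_blockForm]
  have : (1 / (N : ℂ)) = ((1 / (N : ℝ) : ℝ) : ℂ) := by push_cast; rfl
  rw [this, Complex.re_ofReal_mul]
  rfl

/-- The exact equation satisfied by the normalized block traces of the resolvent. -/
lemma resolvent_equation (hN : N ≠ 0) (hr : 0 < r) :
    (r : ℂ) • blockTrace (res r F w x) + ((1 / (N : ℝ) : ℝ) : ℂ) • ∑ k ∈ F,
      ((1 + qf (blockForm (res r (F.erase k) w x) (x k)) (w k) : ℝ) : ℂ)⁻¹ •
        (Matrix.vecMulVec (w k) (star (w k)) * blockForm (res r (F.erase k) w x) (x k)) = 1 := by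
  -- The identity (C + r) R = 1 is expanded user by user, and block traces are taken at the end.
  have h1 : (r : ℂ) • res r F w x + cov F w x * res r F w x = 1 := by
    have := shift_mul_inv (posSemidef_cov F w x) hr
    rw [add_mul, smul_mul_assoc, one_mul] at this
    rw [add_comm]
    exact this
  have h2 : cov F w x * res r F w x = ((1 / (N : ℝ) : ℝ) : ℂ) • ∑ k ∈ F,
      Matrix.vecMulVec (tens (w k) (x k)) (star (res r F w x *ᵥ tens (w k) (x k))) := by
    conv_lhs => rw [cov]
    rw [smul_mul_assoc, Finset.sum_mul]
    congr 1
    refine Finset.sum_congr rfl fun k _ => ?_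
    rw [Matrix.vecMulVec_mul, Matrix.star_mulVec, (posDef_res hr F w x).isHermitian.eq]
  have h3 := congrArg blockTrace h1
  rw [blockTrace_one hN, blockTrace_add, blockTrace_smul, h2, blockTrace_smul, blockTrace_sum] at h3
  rw [← h3]
  congr 2
  refine Finset.sum_congr rfl fun k hk => ?_
  -- Sherman–Morrison replaces R by the resolvent without user k, which no longer involves x k.
  rw [res_mulVec_tens hr hk, qf_blockForm]
  generalize (1 + 1 / (N : ℝ) * qf (res r (F.erase k) w x) (tens (w k) (x k)) : ℝ) = z
  have hH := (posDef_res hr (F.erase k) w x).isHermitian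
  generalize res r (F.erase k) w x = R at hH
  have h4 : star (((z : ℝ) : ℂ)⁻¹ • (R *ᵥ tens (w k) (x k))) =
      ((z : ℝ) : ℂ)⁻¹ • star (R *ᵥ tens (w k) (x k)) := by
    rw [star_smul]
    simp
  rw [h4, Matrix.vecMulVec_smul, blockTrace_smul]
  congr 1
  ext ℓ ℓ'
  rw [Matrix.vecMulVec_mul, Matrix.vecMulVec_apply]
  simp only [blockTrace, blockForm, block, Matrix.of_apply, Matrix.vecMulVec_apply, Pi.star_apply,
    Matrix.vecMul, dotProduct, Matrix.mulVec, Fintype.sum_prod_type, tens, star_sum, star_mul',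
    Finset.mul_sum]
  simp only [hH.apply]
  conv_rhs => rw [Finset.sum_comm]
  refine Finset.sum_congr rfl fun ℓ'' _ => ?_
  conv_rhs => rw [Finset.sum_comm]
  refine Finset.sum_congr rfl fun i _ => Finset.sum_congr rfl fun j _ => ?_
  ring

lemma norm_blockForm_sub_le (hr : 0 < r) (F : Finset ℕ) (w : ℕ → Fin L → ℂ) (x : ℕ → Fin N → ℂ)
    (u v : Fin N → ℂ) (ℓ ℓ' : Fin L) :
    ‖(blockForm (res r F w x) u - blockForm (res r F w x) v) ℓ ℓ'‖ ≤
      1 / (N * r) * (l2 (u - v) * (l2 u + l2 v)) := by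
  rw [Matrix.sub_apply, blockForm_apply_eq, blockForm_apply_eq, ← mul_sub]
  have h1 : star (tens (Pi.single ℓ 1) u) ⬝ᵥ res r F w x *ᵥ tens (Pi.single ℓ' 1) u -
      star (tens (Pi.single ℓ 1) v) ⬝ᵥ res r F w x *ᵥ tens (Pi.single ℓ' 1) v =
      star (tens (Pi.single ℓ 1) (u - v)) ⬝ᵥ res r F w x *ᵥ tens (Pi.single ℓ' 1) u +
      star (tens (Pi.single ℓ 1) v) ⬝ᵥ res r F w x *ᵥ tens (Pi.single ℓ' 1) (u - v) := by
    simp only [tens_sub, star_sub, sub_dotProduct, Matrix.mulVec_sub, dotProduct_sub]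
    ring
  have h2 := norm_form_resolvent_le (posSemidef_cov F w x) hr (tens (Pi.single ℓ 1) (u - v))
    (tens (Pi.single ℓ' 1) u)
  have h3 := norm_form_resolvent_le (posSemidef_cov F w x) hr (tens (Pi.single ℓ 1) v)
    (tens (Pi.single ℓ' 1) (u - v))
  simp only [l2_tens, l2_single, norm_one, one_mul] at h2 h3
  have hn : ‖1 / (N : ℂ)‖ = 1 / (N : ℝ) := by simp
  rw [h1, norm_mul, hn, ← one_div_mul_one_div, mul_assoc]
  refine mul_le_mul_of_nonneg_left ((norm_add_le _ _).trans ((add_le_add h2 h3).trans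
    (le_of_eq ?_))) (by positivity)
  ring

/-- By the resolvent identity each user contributes two rank one terms, each with one factor x' k -
x k. The bound is proportional to b, which is why weights are cut before entries are truncated. -/
lemma norm_blockTrace_res_sub_res_le (hr : 0 < r) {b : ℝ} (hw : ∀ k ∈ F, nsq (w k) ≤ b)
    (x x' : ℕ → Fin N → ℂ) (ℓ ℓ' : Fin L) :
    ‖(blockTrace (res r F w x) - blockTrace (res r F w x')) ℓ ℓ'‖ ≤
      b / (N * r) ^ 2 * ∑ k ∈ F, l2 (x k - x' k) * (l2 (x k) + l2 (x' k)) := by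
  have h1 : res r F w x - res r F w x' = ((1 / (N : ℝ) : ℝ) : ℂ) • ∑ k ∈ F,
      (Matrix.vecMulVec (res r F w x *ᵥ tens (w k) (x' k))
        (star (res r F w x' *ᵥ tens (w k) (x' k - x k))) +
      Matrix.vecMulVec (res r F w x *ᵥ tens (w k) (x' k - x k))
        (star (res r F w x' *ᵥ tens (w k) (x k)))) := by
    rw [res, res, resolvent_sub (posSemidef_cov _ w x) (posSemidef_cov _ w x') hr]
    have h2 : cov F w x' - cov F w x = ((1 / (N : ℝ) : ℝ) : ℂ) • ∑ k ∈ F,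
        (Matrix.vecMulVec (tens (w k) (x' k)) (star (tens (w k) (x' k - x k))) +
        Matrix.vecMulVec (tens (w k) (x' k - x k)) (star (tens (w k) (x k)))) := by
      rw [cov, cov, ← smul_sub, ← Finset.sum_sub_distrib]
      congr 1
      refine Finset.sum_congr rfl fun k _ => ?_
      rw [tens_sub, star_sub, Matrix.vecMulVec_sub, Matrix.sub_vecMulVec]
      abel
    rw [h2, mul_smul_comm, smul_mul_assoc, Finset.mul_sum, Finset.sum_mul]
    congr 1
    refine Finset.sum_congr rfl fun k _ => ?_
    rw [mul_add, add_mul, mul_vecMulVec_mul_resolvent (posSemidef_cov _ w x') hr,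
      mul_vecMulVec_mul_resolvent (posSemidef_cov _ w x') hr]
  rw [← blockTrace_sub, h1, blockTrace_smul, Matrix.smul_apply, norm_smul, Complex.norm_real,
    Real.norm_of_nonneg (by positivity), blockTrace_sum, Matrix.sum_apply]
  have h3 : ∀ k ∈ F, ‖blockTrace (Matrix.vecMulVec (res r F w x *ᵥ tens (w k) (x' k))
        (star (res r F w x' *ᵥ tens (w k) (x' k - x k))) +
      Matrix.vecMulVec (res r F w x *ᵥ tens (w k) (x' k - x k))
        (star (res r F w x' *ᵥ tens (w k) (x k)))) ℓ ℓ'‖ ≤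
      b / (N * r ^ 2) * (l2 (x k - x' k) * (l2 (x k) + l2 (x' k))) := by
    intro k hk
    rw [blockTrace_add, Matrix.add_apply]
    have g : ∀ (y : ℕ → Fin N → ℂ) (v : Fin N → ℂ), l2 (res r F w y *ᵥ tens (w k) v) ≤
        l2 (w k) * l2 v / r := fun y v => by
      have := l2_resolvent_le (posSemidef_cov F w y) hr (tens (w k) v)
      rwa [l2_tens] at this
    have e1 := norm_blockTrace_vecMulVec_le (res r F w x *ᵥ tens (w k) (x' k))
      (res r F w x' *ᵥ tens (w k) (x' k - x k)) ℓ ℓ'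
    have e2 := norm_blockTrace_vecMulVec_le (res r F w x *ᵥ tens (w k) (x' k - x k))
      (res r F w x' *ᵥ tens (w k) (x k)) ℓ ℓ'
    have f1 := mul_le_mul (g x (x' k)) (g x' (x' k - x k)) (l2_nonneg _)
      ((l2_nonneg _).trans (g x (x' k)))
    have f2 := mul_le_mul (g x (x' k - x k)) (g x' (x k)) (l2_nonneg _)
      ((l2_nonneg _).trans (g x (x' k - x k)))
    have f3 := mul_le_mul_of_nonneg_left (add_le_add f1 f2) (show 0 ≤ 1 / (N : ℝ) by positivity)
    refine (norm_add_le _ _).trans ((add_le_add e1 e2).trans ?_)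
    rw [← mul_add]
    refine f3.trans ?_
    rw [l2_sub_comm (x' k) (x k)]
    have hwk := hw k hk
    rw [← l2_sq] at hwk
    have e3 : 1 / (N : ℝ) * (l2 (w k) * l2 (x' k) / r * (l2 (w k) * l2 (x k - x' k) / r) +
        l2 (w k) * l2 (x k - x' k) / r * (l2 (w k) * l2 (x k) / r)) =
        l2 (w k) ^ 2 * (1 / (N * r ^ 2) * (l2 (x k - x' k) * (l2 (x k) + l2 (x' k)))) := by
      field_simp
      ring
    have e4 : b / (N * r ^ 2) * (l2 (x k - x' k) * (l2 (x k) + l2 (x' k))) =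
        b * (1 / (N * r ^ 2) * (l2 (x k - x' k) * (l2 (x k) + l2 (x' k)))) := by ring
    rw [e3, e4]
    refine mul_le_mul_of_nonneg_right hwk ?_
    have := l2_nonneg (x k - x' k)
    have := l2_nonneg (x k)
    have := l2_nonneg (x' k)
    positivity
  refine (mul_le_mul_of_nonneg_left ((norm_sum_le _ _).trans (Finset.sum_le_sum h3))
    (by positivity)).trans (le_of_eq ?_)
  rw [← Finset.mul_sum, ← mul_assoc]
  congr 1
  ring

/-- The normalized sum `(1/N) ∑ τ w_k w_k^* / (1 + τ w_k^* X w_k)`. -/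
noncomputable def weightSum (N : ℕ) (τ : ℝ) (F : Finset ℕ) (w : ℕ → Fin L → ℂ)
    (X : Matrix (Fin L) (Fin L) ℂ) : Matrix (Fin L) (Fin L) ℂ :=
  ((1 / (N : ℝ) : ℝ) : ℂ) • ∑ k ∈ F, ((τ / (1 + τ * qf X (w k)) : ℝ) : ℂ) •
    Matrix.vecMulVec (w k) (star (w k))

lemma qf_weightSum (N : ℕ) (τ : ℝ) (F : Finset ℕ) (w : ℕ → Fin L → ℂ)
    (X : Matrix (Fin L) (Fin L) ℂ) (y : Fin L → ℂ) : qf (weightSum N τ F w X) y =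
      (1 / (N : ℝ)) * ∑ k ∈ F, τ / (1 + τ * qf X (w k)) * ‖star (w k) ⬝ᵥ y‖ ^ 2 := by
  rw [weightSum, qf_smul]
  congr 1
  rw [qf, Matrix.sum_mulVec, dotProduct_sum, Complex.re_sum]
  refine Finset.sum_congr rfl fun k _ => ?_
  rw [Matrix.smul_mulVec, dotProduct_smul, star_dotProduct_vecMulVec_mulVec, smul_eq_mul,
    ← Complex.ofReal_mul, Complex.ofReal_re]

lemma scaledAntitone_weightSum (N : ℕ) {τ : ℝ} (hτ : 0 ≤ τ) (F : Finset ℕ)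
    (w : ℕ → Fin L → ℂ) : ScaledAntitone (weightSum N τ F w) := by
  intro B B' hB hB' t ht h y
  rw [qf_weightSum, qf_weightSum, mul_left_comm, Finset.mul_sum _ _ t]
  refine mul_le_mul_of_nonneg_left (Finset.sum_le_sum fun k _ => ?_)
    (show (0 : ℝ) ≤ 1 / N by positivity)
  rw [← mul_assoc]
  refine mul_le_mul_of_nonneg_right ?_ (by positivity)
  have p1 := mul_nonneg hτ (qf_nonneg hB.posSemidef (w k))
  have p2 := mul_nonneg hτ (qf_nonneg hB'.posSemidef (w k))
  rw [← mul_div_assoc, div_le_div_iff₀ (by linarith) (by linarith)]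
  have : τ * qf B' (w k) ≤ t * (τ * qf B (w k)) := by
    nlinarith [mul_le_mul_of_nonneg_left (h (w k)) hτ]
  have h3 : 1 + τ * qf B' (w k) ≤ t * (1 + τ * qf B (w k)) := by linarith
  nlinarith [mul_le_mul_of_nonneg_left h3 hτ]

/-- On q ≥ 0 the function 1/(1 + q) is bounded by 1 and 1-Lipschitz. -/
lemma norm_div_sub_div_le {y y' : ℂ} {q q' : ℝ} (hq : 0 ≤ q) (hq' : 0 ≤ q') :
    ‖((1 + q : ℝ) : ℂ)⁻¹ * y - ((1 + q' : ℝ) : ℂ)⁻¹ * y'‖ ≤ ‖y - y'‖ + ‖y'‖ * |q - q'| := by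
  have p1 : (0 : ℝ) < 1 + q := by linarith
  have p2 : (0 : ℝ) < 1 + q' := by linarith
  have e : ((1 + q : ℝ) : ℂ)⁻¹ * y - ((1 + q' : ℝ) : ℂ)⁻¹ * y' =
      (((1 + q)⁻¹ : ℝ) : ℂ) * (y - y') + (((1 + q)⁻¹ - (1 + q')⁻¹ : ℝ) : ℂ) * y' := by
    push_cast; ring
  rw [e]
  refine (norm_add_le _ _).trans (add_le_add ?_ ?_)
  · rw [norm_mul, Complex.norm_real, Real.norm_of_nonneg (inv_nonneg.2 p1.le)]
    exact mul_le_of_le_one_left (norm_nonneg _) (inv_le_one_of_one_le₀ (by linarith))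
  · rw [norm_mul, Complex.norm_real, mul_comm, Real.norm_eq_abs]
    refine mul_le_mul_of_nonneg_left ?_ (norm_nonneg _)
    have : (1 + q)⁻¹ - (1 + q')⁻¹ = ((1 + q)⁻¹ * (1 + q')⁻¹) * (q' - q) := by
      field_simp
      ring
    rw [this, abs_mul, abs_sub_comm q' q, abs_of_nonneg (by positivity)]
    refine mul_le_of_le_one_left (abs_nonneg _) ?_
    have a1 : (1 + q)⁻¹ ≤ 1 := inv_le_one_of_one_le₀ (by linarith)
    have a2 : (1 + q')⁻¹ ≤ 1 := inv_le_one_of_one_le₀ (by linarith)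
    exact mul_le_one₀ a1 (inv_nonneg.2 p2.le) a2

/-- The sum of the moduli of the entries of a matrix. -/
noncomputable def entrySum (M : Matrix (Fin L) (Fin L) ℂ) : ℝ := ∑ ℓ, ∑ ℓ', ‖M ℓ ℓ'‖

lemma norm_le_entrySum (M : Matrix (Fin L) (Fin L) ℂ) (ℓ ℓ' : Fin L) : ‖M ℓ ℓ'‖ ≤ entrySum M :=
  (Finset.single_le_sum (f := fun ℓ' => ‖M ℓ ℓ'‖) (fun _ _ => norm_nonneg _)
    (Finset.mem_univ ℓ')).trans (Finset.single_le_sum (f := fun ℓ => ∑ ℓ', ‖M ℓ ℓ'‖)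
    (fun _ _ => Finset.sum_nonneg fun _ _ => norm_nonneg _) (Finset.mem_univ ℓ))

lemma entrySum_nonneg (M : Matrix (Fin L) (Fin L) ℂ) : 0 ≤ entrySum M :=
  Finset.sum_nonneg fun _ _ => Finset.sum_nonneg fun _ _ => norm_nonneg _

lemma entrySum_add_le (M M' : Matrix (Fin L) (Fin L) ℂ) :
    entrySum (M + M') ≤ entrySum M + entrySum M' := by
  simp only [entrySum, ← Finset.sum_add_distrib]
  exact Finset.sum_le_sum fun _ _ => Finset.sum_le_sum fun _ _ => norm_add_le _ _

lemma norm_sum_star_mul_le {b : ℝ} (hb : 0 ≤ b) {w : Fin L → ℂ} (hw : ∀ i, ‖w i‖ ≤ b)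
    (M : Matrix (Fin L) (Fin L) ℂ) (ℓ' : Fin L) : ‖(star w ᵥ* M) ℓ'‖ ≤ b * entrySum M := by
  simp only [Matrix.vecMul, dotProduct]
  refine (norm_sum_le _ _).trans ?_
  rw [entrySum, Finset.mul_sum]
  refine Finset.sum_le_sum fun i _ => ?_
  rw [norm_mul, Pi.star_apply, norm_star]
  exact mul_le_mul (hw i) (Finset.single_le_sum (f := fun ℓ' => ‖M i ℓ'‖)
    (fun _ _ => norm_nonneg _) (Finset.mem_univ ℓ')) (norm_nonneg _) hb

lemma abs_qf_le {b : ℝ} (hb : 0 ≤ b) {w : Fin L → ℂ} (hw : ∀ i, ‖w i‖ ≤ b)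
    (M : Matrix (Fin L) (Fin L) ℂ) : |qf M w| ≤ b ^ 2 * entrySum M := by
  refine (Complex.abs_re_le_norm _).trans ?_
  simp only [Matrix.mulVec, dotProduct, Finset.mul_sum, entrySum]
  refine (norm_sum_le _ _).trans (Finset.sum_le_sum fun i _ => (norm_sum_le _ _).trans
    (Finset.sum_le_sum fun j _ => ?_))
  rw [norm_mul, norm_mul, Pi.star_apply, norm_star]
  have := mul_le_mul (hw i) (hw j) (norm_nonneg _) hb
  nlinarith [norm_nonneg (M i j)]

/-- The block traces of the resolvent approximately solve the fixed point equation. -/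
lemma norm_weightSum_equation_le (hN : N ≠ 0) (hr : 0 < r) {τ b : ℝ} (hτ : 0 ≤ τ) (hb : 0 ≤ b)
    (hw : ∀ k ∈ F, ∀ i, ‖w k i‖ ≤ b) (ℓ ℓ' : Fin L) :
    ‖((weightSum N τ F w (blockTrace (res r F w x)) + (r : ℂ) • 1) *
      blockTrace (res r F w x) - 1) ℓ ℓ'‖ ≤
    (b ^ 2 + b ^ 4 * (τ * entrySum (blockTrace (res r F w x)))) * ((1 / (N : ℝ)) *
      ∑ k ∈ F, entrySum (blockForm (res r (F.erase k) w x) (x k) -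
        (τ : ℂ) • blockTrace (res r F w x))) := by
  set m := blockTrace (res r F w x) with hm
  have hmP : m.PosDef := posDef_blockTrace hN (posDef_res hr F w x)
  have heq := resolvent_equation (F := F) (w := w) (x := x) hN hr
  rw [← hm] at heq
  -- The matrix 1 is replaced by the exact resolvent equation. The terms r m cancel, and what
  -- remains compares, for each user, the leave-one-out form with τ m.
  rw [add_mul, smul_mul_assoc, one_mul, ← heq, weightSum, smul_mul_assoc, Finset.sum_mul,
    add_comm, add_sub_add_left_eq_sub, ← smul_sub, ← Finset.sum_sub_distrib, Matrix.smul_apply,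
    norm_smul, Complex.norm_real, Real.norm_of_nonneg (by positivity), Matrix.sum_apply,
    mul_left_comm, Finset.mul_sum]
  refine mul_le_mul_of_nonneg_left ((norm_sum_le _ _).trans (Finset.sum_le_sum fun k hk => ?_))
    (by positivity)
  set M := blockForm (res r (F.erase k) w x) (x k) with hM
  have hq : 0 ≤ qf M (w k) := by
    rw [hM, qf_blockForm]
    have := qf_nonneg (posDef_res hr (F.erase k) w x).posSemidef (tens (w k) (x k))
    positivity
  have hq' : 0 ≤ τ * qf m (w k) := mul_nonneg hτ (qf_nonneg hmP.posSemidef _)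
  have hwk := hw k hk
  have e : ((((τ / (1 + τ * qf m (w k)) : ℝ) : ℂ) • Matrix.vecMulVec (w k) (star (w k))) * m -
      ((1 + qf M (w k) : ℝ) : ℂ)⁻¹ • (Matrix.vecMulVec (w k) (star (w k)) * M)) ℓ ℓ' =
      -(w k ℓ * (((1 + qf M (w k) : ℝ) : ℂ)⁻¹ * (star (w k) ᵥ* M) ℓ' -
        ((1 + τ * qf m (w k) : ℝ) : ℂ)⁻¹ * (star (w k) ᵥ* ((τ : ℂ) • m)) ℓ')) := by
    rw [smul_mul_assoc, Matrix.vecMulVec_mul, Matrix.vecMulVec_mul, Matrix.vecMul_smul]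
    simp only [Matrix.sub_apply, Matrix.smul_apply, Matrix.vecMulVec_apply, smul_eq_mul,
      Pi.smul_apply]
    push_cast
    ring
  rw [e, norm_neg, norm_mul]
  have h1 := norm_div_sub_div_le (y := (star (w k) ᵥ* M) ℓ')
    (y' := (star (w k) ᵥ* ((τ : ℂ) • m)) ℓ')
    hq hq'
  have h2 : ‖(star (w k) ᵥ* M) ℓ' - (star (w k) ᵥ* ((τ : ℂ) • m)) ℓ'‖ ≤
      b * entrySum (M - (τ : ℂ) • m) := by
    have := norm_sum_star_mul_le hb hwk (M - (τ : ℂ) • m) ℓ'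
    rwa [Matrix.vecMul_sub] at this
  have h3 : ‖(star (w k) ᵥ* ((τ : ℂ) • m)) ℓ'‖ ≤ b * (τ * entrySum m) := by
    rw [Matrix.vecMul_smul, Pi.smul_apply, norm_smul, Complex.norm_real, Real.norm_of_nonneg hτ]
    have := mul_le_mul_of_nonneg_left (norm_sum_star_mul_le hb hwk m ℓ') hτ
    linarith
  have h4 : |qf M (w k) - τ * qf m (w k)| ≤ b ^ 2 * entrySum (M - (τ : ℂ) • m) := by
    have := abs_qf_le hb hwk (M - (τ : ℂ) • m)
    rwa [qf_sub, qf_smul] at this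
  have h5 : ‖((1 + qf M (w k) : ℝ) : ℂ)⁻¹ * (star (w k) ᵥ* M) ℓ' -
        ((1 + τ * qf m (w k) : ℝ) : ℂ)⁻¹ * (star (w k) ᵥ* ((τ : ℂ) • m)) ℓ'‖ ≤
      b * entrySum (M - (τ : ℂ) • m) +
        b * (τ * entrySum m) * (b ^ 2 * entrySum (M - (τ : ℂ) • m)) :=
    h1.trans (add_le_add h2 (mul_le_mul h3 h4 (abs_nonneg _) ((norm_nonneg _).trans h3)))
  refine (mul_le_mul (hwk ℓ) h5 (norm_nonneg _) hb).trans (le_of_eq ?_)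
  ring

end Covariance

/-! ### Fourth moments of quadratic forms in bounded independent variables. -/

section FourthMoment

variable {Ω : Type*} [MeasurableSpace Ω]

/-- Bounded measurable complex functions. -/
def BddMeas (f : Ω → ℂ) : Prop := Measurable f ∧ ∃ C : ℝ, ∀ ω, ‖f ω‖ ≤ C

namespace BddMeas

variable {f g : Ω → ℂ}

lemma add (hf : BddMeas f) (hg : BddMeas g) : BddMeas fun ω => f ω + g ω := by
  obtain ⟨C, hC⟩ := hf.2
  obtain ⟨D, hD⟩ := hg.2
  exact ⟨hf.1.add hg.1, C + D, fun ω => (norm_add_le _ _).trans (add_le_add (hC ω) (hD ω))⟩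

lemma mul (hf : BddMeas f) (hg : BddMeas g) : BddMeas fun ω => f ω * g ω := by
  obtain ⟨C, hC⟩ := hf.2
  obtain ⟨D, hD⟩ := hg.2
  refine ⟨hf.1.mul hg.1, C * D, fun ω => ?_⟩
  rw [norm_mul]
  exact mul_le_mul (hC ω) (hD ω) (norm_nonneg _) ((norm_nonneg _).trans (hC ω))

lemma const (z : ℂ) : BddMeas fun _ : Ω => z := ⟨measurable_const, ‖z‖, fun _ => le_rfl⟩

lemma sub (hf : BddMeas f) (hg : BddMeas g) : BddMeas fun ω => f ω - g ω := by
  simpa [sub_eq_add_neg] using hf.add ((const (-1)).mul hg)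

lemma star (hf : BddMeas f) : BddMeas fun ω => star (f ω) :=
  ⟨continuous_star.measurable.comp hf.1, by simpa using hf.2⟩

lemma sum {κ : Type*} (s : Finset κ) {f : κ → Ω → ℂ} (hf : ∀ k ∈ s, BddMeas (f k)) :
    BddMeas fun ω => ∑ k ∈ s, f k ω := by
  classical
  induction s using Finset.induction_on with
  | empty => simpa using const 0
  | insert a s ha ih =>
    simp only [Finset.sum_insert ha]
    exact (hf a (Finset.mem_insert_self _ _)).add
      (ih fun k hk => hf k (Finset.mem_insert_of_mem hk))

lemma norm_sq (hf : BddMeas f) : BddMeas fun ω => ((‖f ω‖ ^ 2 : ℝ) : ℂ) := by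
  have : (fun ω => ((‖f ω‖ ^ 2 : ℝ) : ℂ)) = fun ω => Star.star (f ω) * f ω := by
    funext ω
    push_cast
    rw [← Complex.conj_mul']
    rfl
  rw [this]
  exact hf.star.mul hf

lemma integrable {P : Measure Ω} [IsFiniteMeasure P] (hf : BddMeas f) : Integrable f P := by
  obtain ⟨C, hC⟩ := hf.2
  exact Integrable.of_bound hf.1.aestronglyMeasurable C (Eventually.of_forall hC)

lemma integrable_norm_pow {P : Measure Ω} [IsFiniteMeasure P] (hf : BddMeas f) (p : ℕ) :
    Integrable (fun ω => ‖f ω‖ ^ p) P := by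
  obtain ⟨C, hC⟩ := hf.2
  refine Integrable.of_bound (hf.1.norm.pow_const p).aestronglyMeasurable (C ^ p)
    (Eventually.of_forall fun ω => ?_)
  rw [norm_pow, norm_norm]
  exact pow_le_pow_left₀ (norm_nonneg _) (hC ω) p

end BddMeas

/-- The term of first order in d is kept exactly, because it integrates to zero for martingale
differences. In the remainder, 4‖u‖‖d‖³ is split by the arithmetic-geometric inequality. -/
lemma norm_add_pow_four_le (u d : ℂ) : ‖u + d‖ ^ 4 ≤ ‖u‖ ^ 4 +
    4 * (((‖u‖ ^ 2 : ℝ) : ℂ) * star u * d).re + 8 * (‖u‖ ^ 2 * ‖d‖ ^ 2) + 3 * ‖d‖ ^ 4 := by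
  set t : ℝ := (star u * d).re with ht
  have h1 : ‖u + d‖ ^ 2 = ‖u‖ ^ 2 + 2 * t + ‖d‖ ^ 2 := by
    rw [ht, Complex.sq_norm, Complex.sq_norm, Complex.sq_norm, Complex.normSq_add]
    simp [Complex.mul_re]
    ring
  have h2 : |t| ≤ ‖u‖ * ‖d‖ := by
    have := Complex.abs_re_le_norm (star u * d)
    rwa [norm_mul, norm_star] at this
  have h3 : (((‖u‖ ^ 2 : ℝ) : ℂ) * star u * d).re = ‖u‖ ^ 2 * t := by
    rw [mul_assoc, Complex.re_ofReal_mul]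
  rw [h3]
  have h4 : ‖u + d‖ ^ 4 = (‖u‖ ^ 2 + 2 * t + ‖d‖ ^ 2) ^ 2 := by rw [← h1]; ring
  rw [h4]
  have h5 : t ^ 2 ≤ ‖u‖ ^ 2 * ‖d‖ ^ 2 := by
    have := pow_le_pow_left₀ (abs_nonneg t) h2 2
    rwa [sq_abs, mul_pow] at this
  have h6 : t ≤ ‖u‖ * ‖d‖ := (le_abs_self t).trans h2
  have h7 : t * ‖d‖ ^ 2 ≤ ‖u‖ * ‖d‖ * ‖d‖ ^ 2 := mul_le_mul_of_nonneg_right h6 (by positivity)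
  nlinarith [mul_nonneg (sq_nonneg ‖d‖) (sq_nonneg (‖u‖ - ‖d‖))]

/-- A function of `x 0, …, x (n-1)` is uncorrelated with functions of `x n`. -/
lemma integral_prefix_mul {P : Measure Ω} {x : ℕ → Ω → ℂ} (hx : iIndepFun x P)
    (hm : ∀ i, Measurable (x i)) (n : ℕ)
    {Φ : (ℕ → ℂ) → ℂ} (hΦ : Measurable Φ)
    (hdep : ∀ y y' : ℕ → ℂ, (∀ i < n, y i = y' i) → Φ y = Φ y') {g : ℂ → ℂ} (hg : Measurable g) :
    ∫ ω, Φ (fun i => x i ω) * g (x n ω) ∂P =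
      (∫ ω, Φ (fun i => x i ω) ∂P) * ∫ ω, g (x n ω) ∂P := by
  have hind := hx.indepFun_finset (Finset.range n) {n} (by simp) hm
  -- Independence is used between finite subfamilies, so Φ is fed zeros beyond n; by `hdep` this
  -- does not change its value.
  have hφ : Measurable fun (y : Finset.range n → ℂ) =>
      Φ (fun i => if h : i ∈ Finset.range n then y ⟨i, h⟩ else 0) := by
    refine hΦ.comp (measurable_pi_iff.2 fun i => ?_)
    by_cases h : i ∈ Finset.range n
    · simp only [h, dif_pos]; exact measurable_pi_apply _
    · simp only [h, dif_neg, not_false_eq_true]; exact measurable_const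
  have hψ : Measurable fun (y : ({n} : Finset ℕ) → ℂ) => g (y ⟨n, Finset.mem_singleton_self n⟩) :=
    hg.comp (measurable_pi_apply _)
  have h2 := hind.comp hφ hψ
  have h3 : (fun (y : Finset.range n → ℂ) =>
      Φ (fun i => if h : i ∈ Finset.range n then y ⟨i, h⟩ else 0)) ∘
      (fun a (i : Finset.range n) => x i a) = fun ω => Φ (fun i => x i ω) := by
    funext ω
    refine hdep _ _ fun i hi => ?_
    simp [hi]
  rw [h3] at h2
  have h4 := h2.integral_mul_eq_mul_integral
    (hΦ.comp (measurable_pi_iff.2 hm)).aestronglyMeasurable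
    (hg.comp (hm n)).aestronglyMeasurable
  exact h4

variable {P : Measure Ω} [IsProbabilityMeasure P]

lemma integral_norm_add_pow_four_le {u d : Ω → ℂ} (hu : BddMeas u) (hd : BddMeas d)
    (h0 : ∫ ω, ((‖u ω‖ ^ 2 : ℝ) : ℂ) * star (u ω) * d ω ∂P = 0) :
    ∫ ω, ‖u ω + d ω‖ ^ 4 ∂P ≤ ∫ ω, ‖u ω‖ ^ 4 ∂P + 8 * ∫ ω, ‖u ω‖ ^ 2 * ‖d ω‖ ^ 2 ∂P +
      3 * ∫ ω, ‖d ω‖ ^ 4 ∂P := by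
  have i1 : Integrable (fun ω => ((‖u ω‖ ^ 2 : ℝ) : ℂ) * star (u ω) * d ω) P :=
    ((hu.norm_sq.mul hu.star).mul hd).integrable
  have i2 : Integrable (fun ω => (((‖u ω‖ ^ 2 : ℝ) : ℂ) * star (u ω) * d ω).re) P := i1.re
  have h0' : ∫ ω, (((‖u ω‖ ^ 2 : ℝ) : ℂ) * star (u ω) * d ω).re ∂P = 0 := by
    have := integral_re i1
    simp only [RCLike.re_eq_complex_re] at this
    rw [this, h0, Complex.zero_re]
  have i3 : Integrable (fun ω => ‖u ω‖ ^ 2 * ‖d ω‖ ^ 2) P := by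
    simpa [mul_pow] using (hu.mul hd).integrable_norm_pow (P := P) 2
  have i4 := hu.integrable_norm_pow (P := P) 4
  have i5 := hd.integrable_norm_pow (P := P) 4
  have := integral_mono ((hu.add hd).integrable_norm_pow (P := P) 4)
    (((i4.add (i2.const_mul 4)).add (i3.const_mul 8)).add (i5.const_mul 3))
    (fun ω => norm_add_pow_four_le (u ω) (d ω))
  refine this.trans (le_of_eq ?_)
  simp only [Pi.add_apply]
  rw [integral_add, integral_add, integral_add, integral_const_mul, integral_const_mul,
    integral_const_mul, h0', mul_zero, add_zero]
  · exact i4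
  · exact i2.const_mul 4
  · exact i4.add (i2.const_mul 4)
  · exact i3.const_mul 8
  · exact (i4.add (i2.const_mul 4)).add (i3.const_mul 8)
  · exact i5.const_mul 3

/-- A fourth moment bound for sums of martingale differences. -/
lemma integral_martingale_pow_four_le {S d : ℕ → Ω → ℂ} (hS : ∀ n, BddMeas (S n))
    (hd : ∀ n, BddMeas (d n)) (hS0 : ∀ ω, S 0 ω = 0) (hstep : ∀ n ω, S (n + 1) ω = S n ω + d n ω)
    (h0 : ∀ n, ∫ ω, ((‖S n ω‖ ^ 2 : ℝ) : ℂ) * star (S n ω) * d n ω ∂P = 0) {D : ℝ}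
    (hD : ∀ n, ∫ ω, ‖d n ω‖ ^ 4 ∂P ≤ D) (n : ℕ) :
    ∫ ω, ‖S n ω‖ ^ 4 ∂P ≤ 19 * D * (n : ℝ) ^ 2 := by
  have hD0 : 0 ≤ D := (integral_nonneg fun ω => by positivity).trans (hD 0)
  induction n with
  | zero => simp [hS0]
  | succ n ih =>
    have h1 := integral_norm_add_pow_four_le (hS n) (hd n) (h0 n)
    have i3 : Integrable (fun ω => ‖S n ω‖ ^ 2 * ‖d n ω‖ ^ 2) P := by
      simpa [mul_pow] using ((hS n).mul (hd n)).integrable_norm_pow (P := P) 2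
    have i4 := (hS n).integrable_norm_pow (P := P) 4
    have i5 := (hd n).integrable_norm_pow (P := P) 4
    have hn : (0 : ℝ) < n + 1 := by positivity
    -- The weight n + 1 is tuned so that the part put on the fourth moment of S n costs at most 19 D
    -- n, preserving quadratic growth. The constant 19 = 16 + 3 is what the first step costs.
    have h2 : 8 * ∫ ω, ‖S n ω‖ ^ 2 * ‖d n ω‖ ^ 2 ∂P ≤
        (1 / ((n : ℝ) + 1)) * ∫ ω, ‖S n ω‖ ^ 4 ∂P + 16 * (n + 1) * ∫ ω, ‖d n ω‖ ^ 4 ∂P := by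
      rw [← integral_const_mul, ← integral_const_mul, ← integral_const_mul,
        ← integral_add (i4.const_mul _) (i5.const_mul _)]
      refine integral_mono (i3.const_mul 8) ((i4.const_mul _).add (i5.const_mul _)) fun ω => ?_
      have e : 1 / ((n : ℝ) + 1) * ‖S n ω‖ ^ 4 + 16 * (n + 1) * ‖d n ω‖ ^ 4 -
          8 * (‖S n ω‖ ^ 2 * ‖d n ω‖ ^ 2) =
          (1 / ((n : ℝ) + 1)) * (‖S n ω‖ ^ 2 - 4 * (n + 1) * ‖d n ω‖ ^ 2) ^ 2 := by
        field_simp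
        ring
      have : 0 ≤ (1 / ((n : ℝ) + 1)) * (‖S n ω‖ ^ 2 - 4 * (n + 1) * ‖d n ω‖ ^ 2) ^ 2 := by
        positivity
      linarith
    have h3 : (1 / ((n : ℝ) + 1)) * ∫ ω, ‖S n ω‖ ^ 4 ∂P ≤ 19 * D * n := by
      rw [one_div_mul_eq_div, div_le_iff₀ hn]
      have : 0 ≤ D * n := by positivity
      nlinarith
    have h4 := hD n
    simp only [hstep]
    push_cast
    have h5 : 16 * ((n : ℝ) + 1) * ∫ ω, ‖d n ω‖ ^ 4 ∂P ≤ 16 * ((n : ℝ) + 1) * D :=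
      mul_le_mul_of_nonneg_left h4 (by positivity)
    nlinarith [mul_nonneg hD0 (Nat.cast_nonneg (α := ℝ) n)]

/-- The linear form `∑_{j < n} a_j y_j`. -/
def linForm (a : ℕ → ℂ) (n : ℕ) (y : ℕ → ℂ) : ℂ := ∑ j ∈ Finset.range n, a j * y j

/-- The centered quadratic form `∑_{i, j < n} conj(y_i) M_ij y_j - τ ∑_{i < n} M_ii`. -/
noncomputable def quadForm (M : ℕ → ℕ → ℂ) (τ : ℝ) (n : ℕ) (y : ℕ → ℂ) : ℂ :=
  ∑ i ∈ Finset.range n, ∑ j ∈ Finset.range n, star (y i) * M i j * y j -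
    τ * ∑ i ∈ Finset.range n, M i i

lemma measurable_linForm (a : ℕ → ℂ) (n : ℕ) : Measurable (linForm a n) := by
  unfold linForm
  fun_prop

lemma measurable_star_apply (i : ℕ) : Measurable fun y : ℕ → ℂ => star (y i) :=
  continuous_star.measurable.comp (measurable_pi_apply i)

lemma measurable_quadForm (M : ℕ → ℕ → ℂ) (τ : ℝ) (n : ℕ) : Measurable (quadForm M τ n) := by
  refine Measurable.sub (Finset.measurable_sum _ fun i _ => Finset.measurable_sum _ fun j _ => ?_)
    measurable_const
  exact ((measurable_star_apply i).mul_const _).mul (measurable_pi_apply j)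

lemma linForm_congr (a : ℕ → ℂ) (n : ℕ) {y y' : ℕ → ℂ} (h : ∀ i < n, y i = y' i) :
    linForm a n y = linForm a n y' :=
  Finset.sum_congr rfl fun j hj => by rw [h j (Finset.mem_range.1 hj)]

lemma quadForm_congr (M : ℕ → ℕ → ℂ) (τ : ℝ) (n : ℕ) {y y' : ℕ → ℂ} (h : ∀ i < n, y i = y' i) :
    quadForm M τ n y = quadForm M τ n y' := by
  unfold quadForm
  congr 1
  exact Finset.sum_congr rfl fun i hi => Finset.sum_congr rfl fun j hj => by
    rw [h j (Finset.mem_range.1 hj), h i (Finset.mem_range.1 hi)]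

lemma linForm_succ (a : ℕ → ℂ) (n : ℕ) (y : ℕ → ℂ) :
    linForm a (n + 1) y = linForm a n y + a n * y n := Finset.sum_range_succ _ _

/-- The increment consists of a new row, a new column and a recentred diagonal term. For independent
variables of mean 0 and second moment τ, each part has conditional mean zero given the earlier ones.
-/
lemma quadForm_succ (M : ℕ → ℕ → ℂ) (τ : ℝ) (n : ℕ) (y : ℕ → ℂ) :
    quadForm M τ (n + 1) y = quadForm M τ n y + (linForm (M n) n y * star (y n) +
      star (linForm (fun i => star (M i n)) n y) * y n + M n n * ((‖y n‖ ^ 2 - τ : ℝ) : ℂ)) := by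
  have h : ((‖y n‖ ^ 2 : ℝ) : ℂ) = star (y n) * y n := by
    push_cast
    rw [← Complex.conj_mul']
    rfl
  simp only [quadForm, linForm, Finset.sum_range_succ, Finset.sum_add_distrib, star_sum, star_mul',
    star_star, Finset.sum_mul]
  rw [Complex.ofReal_sub, h]
  have e : ∀ i, star (y n) * M n i * y i = M n i * y i * star (y n) := fun i => by ring
  have e' : ∀ i, star (y i) * M i n * y n = M i n * star (y i) * y n := fun i => by ring
  simp only [e, e']
  ring

variable {x : ℕ → Ω → ℂ} {b : ℝ}

lemma bddMeas_linForm
    (hm : ∀ i, Measurable (x i)) (hb : ∀ i ω, ‖x i ω‖ ≤ b)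
    (a : ℕ → ℂ) (n : ℕ) : BddMeas fun ω => linForm a n fun i => x i ω :=
  BddMeas.sum _ fun j _ => (BddMeas.const (a j)).mul ⟨hm j, b, hb j⟩

lemma bddMeas_quadForm
    (hm : ∀ i, Measurable (x i)) (hb : ∀ i ω, ‖x i ω‖ ≤ b)
    (M : ℕ → ℕ → ℂ) (τ : ℝ) (n : ℕ) :
    BddMeas fun ω => quadForm M τ n fun i => x i ω :=
  (BddMeas.sum _ fun i _ => BddMeas.sum _ fun j _ =>
    ((BddMeas.star ⟨hm i, b, hb i⟩).mul (BddMeas.const (M i j))).mul ⟨hm j, b, hb j⟩).sub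
    (BddMeas.const _)

lemma integral_linForm_sq_le
    (hx : iIndepFun x P) (hm : ∀ i, Measurable (x i)) (hb : ∀ i ω, ‖x i ω‖ ≤ b)
    (hmean : ∀ i, ∫ ω, x i ω ∂P = 0)
    (a : ℕ → ℂ) (n : ℕ) :
    ∫ ω, ‖linForm a n fun i => x i ω‖ ^ 2 ∂P ≤ b ^ 2 * ∑ j ∈ Finset.range n, ‖a j‖ ^ 2 := by
  induction n with
  | zero => simp [linForm]
  | succ n ih =>
    have hu := bddMeas_linForm hm hb a n
    have hd : BddMeas fun ω => a n * x n ω := (BddMeas.const (a n)).mul ⟨hm n, b, hb n⟩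
    have h0 : ∫ ω, star (linForm a n fun i => x i ω) * a n * x n ω ∂P = 0 := by
      have := integral_prefix_mul hx hm n (Φ := fun y => star (linForm a n y) * a n)
        ((continuous_star.measurable.comp (measurable_linForm a n)).mul_const _)
        (fun y y' h => by simp only [linForm_congr a n h]) (g := id) measurable_id
      simp only [id] at this
      rw [this, hmean, mul_zero]
    have i1 : Integrable (fun ω => star (linForm a n fun i => x i ω) * a n * x n ω) P :=
      ((hu.star.mul (BddMeas.const (a n))).mul ⟨hm n, b, hb n⟩).integrable
    have h0' : ∫ ω, (star (linForm a n fun i => x i ω) * a n * x n ω).re ∂P = 0 := by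
      have := integral_re i1
      simp only [RCLike.re_eq_complex_re] at this
      rw [this, h0, Complex.zero_re]
    have hpt : ∀ ω, ‖linForm a (n + 1) fun i => x i ω‖ ^ 2 ≤ ‖linForm a n fun i => x i ω‖ ^ 2 +
        2 * (star (linForm a n fun i => x i ω) * a n * x n ω).re + b ^ 2 * ‖a n‖ ^ 2 := by
      intro ω
      rw [linForm_succ, Complex.sq_norm, Complex.normSq_add, ← Complex.sq_norm, ← Complex.sq_norm]
      have e1 : (star (linForm a n fun i => x i ω) * a n * x n ω).re =
          ((linForm a n fun i => x i ω) * starRingEnd ℂ (a n * x n ω)).re := by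
        rw [← Complex.conj_re]
        simp
        ring
      have e2 : ‖a n * x n ω‖ ^ 2 ≤ b ^ 2 * ‖a n‖ ^ 2 := by
        rw [norm_mul, mul_pow, mul_comm]
        exact mul_le_mul_of_nonneg_right (pow_le_pow_left₀ (norm_nonneg _) (hb n ω) 2)
          (by positivity)
      linarith
    have i2 := hu.integrable_norm_pow (P := P) 2
    have i3 : Integrable (fun ω => (star (linForm a n fun i => x i ω) * a n * x n ω).re) P := i1.re
    have h1 := integral_mono ((bddMeas_linForm hm hb a (n + 1)).integrable_norm_pow (P := P) 2)
      ((i2.add (i3.const_mul 2)).add (integrable_const (b ^ 2 * ‖a n‖ ^ 2))) hpt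
    refine h1.trans ?_
    rw [integral_add' (i2.add (i3.const_mul 2)) (integrable_const _),
      integral_add' i2 (i3.const_mul 2), integral_const_mul, h0', Finset.sum_range_succ]
    simp only [integral_const, probReal_univ, one_smul, mul_zero, add_zero]
    linarith

/-- With Q the partial sum of the ‖a_j‖² and q the next term, a step adds at most b⁴ (8 Q q + 3 q²),
which is below 11 b⁴ ((Q + q)² - Q²). -/
lemma integral_linForm_pow_four_le
    (hx : iIndepFun x P) (hm : ∀ i, Measurable (x i)) (hb : ∀ i ω, ‖x i ω‖ ≤ b)
    (hmean : ∀ i, ∫ ω, x i ω ∂P = 0)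
    (a : ℕ → ℂ) (n : ℕ) :
    ∫ ω, ‖linForm a n fun i => x i ω‖ ^ 4 ∂P ≤
      11 * b ^ 4 * (∑ j ∈ Finset.range n, ‖a j‖ ^ 2) ^ 2 := by
  induction n with
  | zero => simp [linForm]
  | succ n ih =>
    have hu := bddMeas_linForm hm hb a n
    have hd : BddMeas fun ω => a n * x n ω := (BddMeas.const (a n)).mul ⟨hm n, b, hb n⟩
    have h0 : ∫ ω, ((‖linForm a n fun i => x i ω‖ ^ 2 : ℝ) : ℂ) *
        star (linForm a n fun i => x i ω) * (a n * x n ω) ∂P = 0 := by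
      have hmeas := measurable_linForm a n
      have := integral_prefix_mul hx hm n
        (Φ := fun y => ((‖linForm a n y‖ ^ 2 : ℝ) : ℂ) * star (linForm a n y) * a n)
        (((Complex.measurable_ofReal.comp (hmeas.norm.pow_const 2)).mul
          (continuous_star.measurable.comp hmeas)).mul_const _)
        (fun y y' h => by simp only [linForm_congr a n h]) (g := id) measurable_id
      simp only [id] at this
      rw [hmean, mul_zero] at this
      rw [← this]
      simp only [mul_assoc]
    have h1 := integral_norm_add_pow_four_le hu hd h0
    simp only [linForm_succ]
    have hQ : 0 ≤ ∑ j ∈ Finset.range n, ‖a j‖ ^ 2 := Finset.sum_nonneg fun _ _ => by positivity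
    have hxn : ∀ ω, ‖a n * x n ω‖ ^ 2 ≤ b ^ 2 * ‖a n‖ ^ 2 := fun ω => by
      rw [norm_mul, mul_pow, mul_comm]
      exact mul_le_mul_of_nonneg_right (pow_le_pow_left₀ (norm_nonneg _) (hb n ω) 2)
        (by positivity)
    have h2 : ∫ ω, ‖linForm a n fun i => x i ω‖ ^ 2 * ‖a n * x n ω‖ ^ 2 ∂P ≤
        b ^ 2 * ‖a n‖ ^ 2 * (b ^ 2 * ∑ j ∈ Finset.range n, ‖a j‖ ^ 2) := by
      have i3 : Integrable (fun ω => ‖linForm a n fun i => x i ω‖ ^ 2 * ‖a n * x n ω‖ ^ 2) P := by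
        simpa only [mul_pow, norm_mul] using (hu.mul hd).integrable_norm_pow (P := P) 2
      have h3 := integral_mono i3 ((hu.integrable_norm_pow (P := P) 2).const_mul
        (b ^ 2 * ‖a n‖ ^ 2))
        (fun ω => by
          rw [mul_comm (b ^ 2 * ‖a n‖ ^ 2)]
          exact mul_le_mul_of_nonneg_left (hxn ω) (by positivity))
      refine h3.trans ?_
      rw [integral_const_mul]
      exact mul_le_mul_of_nonneg_left (integral_linForm_sq_le hx hm hb hmean a n) (by positivity)
    have h4 : ∫ ω, ‖a n * x n ω‖ ^ 4 ∂P ≤ (b ^ 2 * ‖a n‖ ^ 2) ^ 2 := by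
      have := integral_mono (hd.integrable_norm_pow (P := P) 4)
        (integrable_const ((b ^ 2 * ‖a n‖ ^ 2) ^ 2)) (fun ω => by
          have := pow_le_pow_left₀ (by positivity) (hxn ω) 2
          rwa [← pow_mul] at this)
      simpa using this
    rw [Finset.sum_range_succ]
    have e : 0 ≤ b ^ 4 * ((∑ j ∈ Finset.range n, ‖a j‖ ^ 2) * ‖a n‖ ^ 2) := by positivity
    have e2 : 0 ≤ b ^ 4 * (‖a n‖ ^ 2) ^ 2 := by positivity
    nlinarith

/-- A fourth moment bound for centered quadratic forms in independent bounded variables. -/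
lemma integral_quadForm_pow_four_le
    {τ : ℝ} (hx : iIndepFun x P) (hm : ∀ i, Measurable (x i)) (hb : ∀ i ω, ‖x i ω‖ ≤ b)
    (hmean : ∀ i, ∫ ω, x i ω ∂P = 0) (hvar : ∀ i, ∫ ω, ‖x i ω‖ ^ 2 ∂P = τ)
    (M : ℕ → ℕ → ℂ) {κ : ℝ} (hκ : 0 ≤ κ)
    (hrow : ∀ i n, ∑ j ∈ Finset.range n, ‖M i j‖ ^ 2 ≤ κ ^ 2)
    (hcol : ∀ j n, ∑ i ∈ Finset.range n, ‖M i j‖ ^ 2 ≤ κ ^ 2) (n : ℕ) :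
    ∫ ω, ‖quadForm M τ n fun i => x i ω‖ ^ 4 ∂P ≤ 19 * (64 * 38 * κ ^ 4 * b ^ 8) * (n : ℝ) ^ 2 := by
  set d : ℕ → Ω → ℂ := fun n ω => linForm (M n) n (fun i => x i ω) * star (x n ω) +
      star (linForm (fun i => star (M i n)) n fun i => x i ω) * x n ω +
      M n n * ((‖x n ω‖ ^ 2 - τ : ℝ) : ℂ) with hd
  have hb0 : ∀ ω : Ω, 0 ≤ b := fun ω => (norm_nonneg _).trans (hb 0 ω)
  have hbx : ∀ i, BddMeas (x i) := fun i => ⟨hm i, b, hb i⟩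
  have hB1 : ∀ n, BddMeas fun ω => linForm (M n) n (fun i => x i ω) * star (x n ω) :=
    fun n => (bddMeas_linForm hm hb _ n).mul (hbx n).star
  have hB2 : ∀ n, BddMeas fun ω =>
      star (linForm (fun i => star (M i n)) n fun i => x i ω) * x n ω :=
    fun n => (bddMeas_linForm hm hb _ n).star.mul (hbx n)
  have hB3 : ∀ n, BddMeas fun ω => M n n * ((‖x n ω‖ ^ 2 - τ : ℝ) : ℂ) := by
    intro n
    have := (hbx n).norm_sq.sub (BddMeas.const (τ : ℂ))
    simp only [← Complex.ofReal_sub] at this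
    exact (BddMeas.const (M n n)).mul this
  have hdB : ∀ n, BddMeas (d n) := fun n => ((hB1 n).add (hB2 n)).add (hB3 n)
  have hτ : |τ| ≤ b ^ 2 ∧ 0 ≤ τ := by
    have h1 : 0 ≤ τ := by rw [← hvar 0]; exact integral_nonneg fun ω => by positivity
    refine ⟨?_, h1⟩
    rw [abs_of_nonneg h1, ← hvar 0]
    have := integral_mono ((hbx 0).integrable_norm_pow (P := P) 2) (integrable_const (b ^ 2))
      (fun ω => pow_le_pow_left₀ (norm_nonneg _) (hb 0 ω) 2)
    simpa using this
  refine integral_martingale_pow_four_le (S := fun n ω => quadForm M τ n fun i => x i ω) (d := d)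
    (fun n => bddMeas_quadForm hm hb M τ n) hdB (fun ω => by simp [quadForm])
    (fun n ω => quadForm_succ M τ n _) (fun n => ?_) (fun n => ?_) n
  -- Orthogonality: Ψ depends on the first n variables only, so its product with each of the three
  -- parts of the increment factors through a mean that vanishes.
  · set Ψ : (ℕ → ℂ) → ℂ := fun y => ((‖quadForm M τ n y‖ ^ 2 : ℝ) : ℂ) * star (quadForm M τ n y)
      with hΨ
    have hΨm : Measurable Ψ := by
      have hmeas := measurable_quadForm M τ n
      exact (Complex.measurable_ofReal.comp (hmeas.norm.pow_const 2)).mul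
        (continuous_star.measurable.comp hmeas)
    have hΨc : ∀ y y' : ℕ → ℂ, (∀ i < n, y i = y' i) → Ψ y = Ψ y' := fun y y' h => by
      simp only [hΨ, quadForm_congr M τ n h]
    have hΨB : BddMeas fun ω => Ψ fun i => x i ω :=
      (bddMeas_quadForm hm hb M τ n).norm_sq.mul (bddMeas_quadForm hm hb M τ n).star
    have z1 : ∫ ω, Ψ (fun i => x i ω) * (linForm (M n) n (fun i => x i ω) * star (x n ω)) ∂P
        = 0 := by
      have := integral_prefix_mul hx hm n (Φ := fun y => Ψ y * linForm (M n) n y)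
        (hΨm.mul (measurable_linForm _ n))
        (fun y y' h => by simp only [hΨc y y' h, linForm_congr _ n h])
        (g := fun z => star z) continuous_star.measurable
      have h2 : ∫ ω, star (x n ω) ∂P = 0 := by
        have := integral_conj (f := x n) (μ := P)
        rw [hmean n, map_zero] at this
        exact this
      rw [h2, mul_zero] at this
      rw [← this]
      simp only [mul_assoc]
    have z2 : ∫ ω, Ψ (fun i => x i ω) *
        (star (linForm (fun i => star (M i n)) n fun i => x i ω) * x n ω) ∂P = 0 := by
      have := integral_prefix_mul hx hm n
        (Φ := fun y => Ψ y * star (linForm (fun i => star (M i n)) n y))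
        (hΨm.mul (continuous_star.measurable.comp (measurable_linForm _ n)))
        (fun y y' h => by simp only [hΨc y y' h, linForm_congr _ n h]) (g := id) measurable_id
      simp only [id] at this
      rw [hmean, mul_zero] at this
      rw [← this]
      simp only [mul_assoc]
    have z3 : ∫ ω, Ψ (fun i => x i ω) * (M n n * ((‖x n ω‖ ^ 2 - τ : ℝ) : ℂ)) ∂P = 0 := by
      have := integral_prefix_mul hx hm n (Φ := fun y => Ψ y * M n n)
        (hΨm.mul_const _) (fun y y' h => by simp only [hΨc y y' h])
        (g := fun z => ((‖z‖ ^ 2 - τ : ℝ) : ℂ))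
        (Complex.measurable_ofReal.comp ((measurable_norm.pow_const 2).sub_const τ))
      have h2 : ∫ ω, ((‖x n ω‖ ^ 2 - τ : ℝ) : ℂ) ∂P = 0 := by
        rw [integral_complex_ofReal, integral_sub ((hbx n).integrable_norm_pow 2)
          (integrable_const _), hvar]
        simp
      rw [h2, mul_zero] at this
      rw [← this]
      simp only [mul_assoc]
    have e : ∀ ω, ((‖quadForm M τ n fun i => x i ω‖ ^ 2 : ℝ) : ℂ) *
        star (quadForm M τ n fun i => x i ω) * d n ω =
        Ψ (fun i => x i ω) * (linForm (M n) n (fun i => x i ω) * star (x n ω)) +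
        Ψ (fun i => x i ω) * (star (linForm (fun i => star (M i n)) n fun i => x i ω) * x n ω) +
        Ψ (fun i => x i ω) * (M n n * ((‖x n ω‖ ^ 2 - τ : ℝ) : ℂ)) := by
      intro ω
      simp only [hd, hΨ]
      ring
    simp only [e]
    rw [integral_add, integral_add, z1, z2, z3]
    · simp
    · exact (hΨB.mul (hB1 n)).integrable
    · exact (hΨB.mul (hB2 n)).integrable
    · exact ((hΨB.mul (hB1 n)).add (hΨB.mul (hB2 n))).integrable
    · exact (hΨB.mul (hB3 n)).integrable
  · have hMnn : ‖M n n‖ ≤ κ := by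
      refine le_of_sq_le_sq ?_ hκ
      exact (Finset.single_le_sum (f := fun j => ‖M n j‖ ^ 2) (fun _ _ => by positivity)
        (Finset.self_mem_range_succ n)).trans (hrow n (n + 1))
    -- Two uses of (p + q)⁴ ≤ 8 (p⁴ + q⁴) give 64, and |‖x‖² - τ| ≤ 2b² gives 16. With the constant
    -- 11 for each of the two linear forms, the total is 38 = 11 + 11 + 16.
    have hpt : ∀ ω, ‖d n ω‖ ^ 4 ≤ 64 * (b ^ 4 * ‖linForm (M n) n fun i => x i ω‖ ^ 4 +
        b ^ 4 * ‖linForm (fun i => star (M i n)) n fun i => x i ω‖ ^ 4 +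
        16 * κ ^ 4 * b ^ 8) := by
      intro ω
      have hb' := hb0 ω
      have n1 : ‖linForm (M n) n (fun i => x i ω) * star (x n ω)‖ ^ 4 ≤
          b ^ 4 * ‖linForm (M n) n fun i => x i ω‖ ^ 4 := by
        rw [norm_mul, norm_star, mul_pow, mul_comm]
        exact mul_le_mul_of_nonneg_right (pow_le_pow_left₀ (norm_nonneg _) (hb n ω) 4)
          (by positivity)
      have n2 : ‖star (linForm (fun i => star (M i n)) n fun i => x i ω) * x n ω‖ ^ 4 ≤
          b ^ 4 * ‖linForm (fun i => star (M i n)) n fun i => x i ω‖ ^ 4 := by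
        rw [norm_mul, norm_star, mul_pow, mul_comm]
        exact mul_le_mul_of_nonneg_right (pow_le_pow_left₀ (norm_nonneg _) (hb n ω) 4)
          (by positivity)
      have n3 : ‖M n n * ((‖x n ω‖ ^ 2 - τ : ℝ) : ℂ)‖ ^ 4 ≤ 16 * κ ^ 4 * b ^ 8 := by
        have h1 : ‖((‖x n ω‖ ^ 2 - τ : ℝ) : ℂ)‖ ≤ 2 * b ^ 2 := by
          rw [Complex.norm_real, Real.norm_eq_abs]
          have h3 := pow_le_pow_left₀ (norm_nonneg _) (hb n ω) 2
          refine (abs_sub _ _).trans ?_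
          rw [abs_of_nonneg (by positivity)]
          linarith [hτ.1]
        have h2 : ‖M n n * ((‖x n ω‖ ^ 2 - τ : ℝ) : ℂ)‖ ≤ κ * (2 * b ^ 2) := by
          rw [norm_mul]
          exact mul_le_mul hMnn h1 (norm_nonneg _) hκ
        refine (pow_le_pow_left₀ (norm_nonneg _) h2 4).trans (le_of_eq ?_)
        ring
      have t1 := norm_add_le (linForm (M n) n (fun i => x i ω) * star (x n ω) +
        star (linForm (fun i => star (M i n)) n fun i => x i ω) * x n ω)
        (M n n * ((‖x n ω‖ ^ 2 - τ : ℝ) : ℂ))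
      have t2 := norm_add_le (linForm (M n) n (fun i => x i ω) * star (x n ω))
        (star (linForm (fun i => star (M i n)) n fun i => x i ω) * x n ω)
      have t3 := pow_le_pow_left₀ (norm_nonneg _) (t1.trans (add_le_add_left t2 _)) 4
      refine t3.trans ?_
      have p1 := norm_nonneg (linForm (M n) n (fun i => x i ω) * star (x n ω))
      have p2 := norm_nonneg (star (linForm (fun i => star (M i n)) n fun i => x i ω) * x n ω)
      have p3 := norm_nonneg (M n n * ((‖x n ω‖ ^ 2 - τ : ℝ) : ℂ))
      have q1 := add_pow_le (add_nonneg p1 p2) p3 4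
      have q2 := add_pow_le p1 p2 4
      rw [show (2 : ℝ) ^ (4 - 1) = 8 by norm_num] at q1 q2
      have p4 := pow_nonneg p3 4
      linarith
    have j1 := (bddMeas_linForm hm hb (M n) n).integrable_norm_pow (P := P) 4
    have j2 := (bddMeas_linForm hm hb (fun i => star (M i n)) n).integrable_norm_pow (P := P) 4
    have h1 := integral_mono ((hdB n).integrable_norm_pow (P := P) 4)
      ((((j1.const_mul (b ^ 4)).add (j2.const_mul (b ^ 4))).add
        (integrable_const (16 * κ ^ 4 * b ^ 8))).const_mul 64) hpt
    refine h1.trans ?_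
    rw [integral_const_mul]
    rw [integral_add' ((j1.const_mul (b ^ 4)).add (j2.const_mul (b ^ 4))) (integrable_const _),
      integral_add' (j1.const_mul (b ^ 4)) (j2.const_mul (b ^ 4)), integral_const_mul,
      integral_const_mul]
    have k1 := integral_linForm_pow_four_le hx hm hb hmean (M n) n
    have k2 := integral_linForm_pow_four_le hx hm hb hmean (fun i => star (M i n)) n
    simp only [norm_star] at k2
    have s1 := pow_le_pow_left₀ (Finset.sum_nonneg fun _ _ => by positivity) (hrow n n) 2
    have s2 := pow_le_pow_left₀ (Finset.sum_nonneg fun _ _ => by positivity) (hcol n n) 2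
    have b4 : 0 ≤ b ^ 4 := by positivity
    have k1' := k1.trans (mul_le_mul_of_nonneg_left s1 (by positivity : 0 ≤ 11 * b ^ 4))
    have k2' := k2.trans (mul_le_mul_of_nonneg_left s2 (by positivity : 0 ≤ 11 * b ^ 4))
    have m1 := mul_le_mul_of_nonneg_left k1' b4
    have m2 := mul_le_mul_of_nonneg_left k2' b4
    have e1 : b ^ 4 * (11 * b ^ 4 * (κ ^ 2) ^ 2) = 11 * (κ ^ 4 * b ^ 8) := by ring
    rw [e1] at m1 m2
    simp only [integral_const, probReal_univ, one_smul]
    linarith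

/-- A fourth moment bound for quadratic forms in independent bounded variables, for a matrix with
square summable rows and columns. -/
lemma integral_matrix_pow_four_le
    {τ : ℝ} (hx : iIndepFun x P) (hm : ∀ i, Measurable (x i)) (hb : ∀ i ω, ‖x i ω‖ ≤ b)
    (hmean : ∀ i, ∫ ω, x i ω ∂P = 0) (hvar : ∀ i, ∫ ω, ‖x i ω‖ ^ 2 ∂P = τ)
    {N : ℕ} (R : Matrix (Fin N) (Fin N) ℂ) {κ : ℝ} (hκ : 0 ≤ κ)
    (hrow : ∀ i, ∑ j, ‖R i j‖ ^ 2 ≤ κ ^ 2) (hcol : ∀ j, ∑ i, ‖R i j‖ ^ 2 ≤ κ ^ 2) :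
    ∫ ω, ‖star (fun i : Fin N => x i ω) ⬝ᵥ R *ᵥ (fun i : Fin N => x i ω) -
      τ * ∑ i, R i i‖ ^ 4 ∂P ≤ 19 * (64 * 38 * κ ^ 4 * b ^ 8) * (N : ℝ) ^ 2 := by
  -- Extension by zero keeps the row and column sums of squares below κ², so the bound for infinite
  -- arrays applies.
  set M : ℕ → ℕ → ℂ := fun i j => if h : i < N ∧ j < N then R ⟨i, h.1⟩ ⟨j, h.2⟩ else 0 with hM
  have hMv : ∀ i j : Fin N, M i j = R i j := fun i j => by simp [hM]
  have hM0 : ∀ i j, ¬ (i < N ∧ j < N) → M i j = 0 := fun i j h => by simp [hM, h]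
  have hsub : ∀ (f : ℕ → ℝ) (n : ℕ), (∀ i, 0 ≤ f i) → (∀ i, N ≤ i → f i = 0) →
      ∑ i ∈ Finset.range n, f i ≤ ∑ i : Fin N, f i := by
    intro f n hf h0
    rw [Fin.sum_univ_eq_sum_range f N, ← Finset.sum_subset (s₁ := Finset.range (min n N))
      (s₂ := Finset.range n) (by simp) fun i hi hi' => h0 i (by simp at hi hi'; omega)]
    exact Finset.sum_le_sum_of_subset_of_nonneg (by simp) fun i _ _ => hf i
  have key := integral_quadForm_pow_four_le hx hm hb hmean hvar M hκ (fun i n => ?_)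
    (fun j n => ?_) N
  · refine le_trans (le_of_eq ?_) key
    congr 1
    funext ω
    congr 3
    · simp only [dotProduct, Matrix.mulVec, Pi.star_apply, Finset.mul_sum]
      rw [← Fin.sum_univ_eq_sum_range (fun i => ∑ j ∈ Finset.range N,
        star (x i ω) * M i j * x j ω) N]
      refine Finset.sum_congr rfl fun i _ => ?_
      rw [← Fin.sum_univ_eq_sum_range (fun j => star (x i ω) * M i j * x j ω) N]
      refine Finset.sum_congr rfl fun j _ => ?_
      rw [hMv, mul_assoc]
    · rw [← Fin.sum_univ_eq_sum_range (fun i => M i i) N]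
      simp only [hMv]
  · by_cases hi : i < N
    · refine (hsub (fun j => ‖M i j‖ ^ 2) n (fun _ => by positivity) fun j hj => ?_).trans ?_
      · rw [hM0 i j (by omega)]; simp
      · exact le_trans (le_of_eq (Finset.sum_congr rfl fun j _ => by rw [← hMv ⟨i, hi⟩ j]))
          (hrow ⟨i, hi⟩)
    · rw [Finset.sum_eq_zero fun j _ => by rw [hM0 i j (by omega)]; simp]
      positivity
  · by_cases hj : j < N
    · refine (hsub (fun i => ‖M i j‖ ^ 2) n (fun _ => by positivity) fun i hi => ?_).trans ?_
      · rw [hM0 i j (by omega)]; simp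
      · exact le_trans (le_of_eq (Finset.sum_congr rfl fun i _ => by rw [← hMv i ⟨j, hj⟩]))
          (hcol ⟨j, hj⟩)
    · rw [Finset.sum_eq_zero fun i _ => by rw [hM0 i j (by omega)]; simp]
      positivity

end FourthMoment

/-! ### Measurability of resolvents and of the form errors. -/

section Measurability

variable {α ι : Type*} [MeasurableSpace α] [Fintype ι] [DecidableEq ι]

lemma measurable_matrix_det {A : α → Matrix ι ι ℂ} (hA : ∀ i j, Measurable fun a => A a i j) :
    Measurable fun a => (A a).det := by
  simp only [Matrix.det_apply]
  exact Finset.measurable_sum _ fun σ _ =>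
    (Finset.measurable_prod _ fun i _ => hA _ _).const_smul _

lemma measurable_matrix_inv {A : α → Matrix ι ι ℂ} (hA : ∀ i j, Measurable fun a => A a i j)
    (i j : ι) : Measurable fun a => (A a)⁻¹ i j := by
  simp only [Matrix.inv_def, Ring.inverse_eq_inv', Matrix.smul_apply, Matrix.adjugate_apply,
    smul_eq_mul]
  refine (measurable_matrix_det hA).inv.mul (measurable_matrix_det fun p q => ?_)
  simp only [Matrix.updateRow_apply]
  split_ifs
  · exact measurable_const
  · exact hA p q

lemma measurable_res {L N : ℕ} (r : ℝ) (F : Finset ℕ) {w : α → ℕ → Fin L → ℂ}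
    {x : α → ℕ → Fin N → ℂ} (hw : ∀ k ∈ F, ∀ ℓ, Measurable fun a => w a k ℓ)
    (hx : ∀ k ∈ F, ∀ i, Measurable fun a => x a k i) (p q : Fin L × Fin N) :
    Measurable fun a => res r F (w a) (x a) p q := by
  refine measurable_matrix_inv (fun p q => ?_) p q
  simp only [cov, Matrix.add_apply, Matrix.smul_apply, Matrix.sum_apply, Matrix.vecMulVec_apply,
    tens, smul_eq_mul, Pi.star_apply]
  have h : ∀ k ∈ F, ∀ p : Fin L × Fin N, Measurable fun a => w a k p.1 * x a k p.2 :=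
    fun k hk p => (hw k hk _).mul (hx k hk _)
  exact ((Finset.measurable_sum _ fun k hk =>
    (h k hk p).mul (continuous_star.measurable.comp (h k hk q))).const_mul _).add_const _

end Measurability

/-- The error of the approximation of the quadratic forms of the blocks of the resolvent by their
traces. -/
noncomputable def formError {L N : ℕ} (r τ : ℝ) (F : Finset ℕ) (w : ℕ → Fin L → ℂ)
    (x : ℕ → Fin N → ℂ) (v : Fin N → ℂ) : Matrix (Fin L) (Fin L) ℂ :=
  blockForm (res r F w x) v - (τ : ℂ) • blockTrace (res r F w x)

lemma measurable_formError {α : Type*} [MeasurableSpace α] {L N : ℕ} (r τ : ℝ) (F : Finset ℕ)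
    {w : α → ℕ → Fin L → ℂ} {x : α → ℕ → Fin N → ℂ} {v : α → Fin N → ℂ}
    (hw : ∀ k ∈ F, ∀ ℓ, Measurable fun a => w a k ℓ)
    (hx : ∀ k ∈ F, ∀ i, Measurable fun a => x a k i) (hv : ∀ i, Measurable fun a => v a i)
    (ℓ ℓ' : Fin L) : Measurable fun a => formError r τ F (w a) (x a) (v a) ℓ ℓ' := by
  simp only [formError, blockForm, blockTrace, block, Matrix.sub_apply, Matrix.smul_apply,
    Matrix.of_apply, smul_eq_mul, dotProduct, Matrix.mulVec, Pi.star_apply]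
  refine Measurable.sub (Measurable.const_mul ?_ _)
    (Measurable.const_mul (Measurable.const_mul ?_ _) _)
  · exact Finset.measurable_sum _ fun i _ => (continuous_star.measurable.comp (hv i)).mul
      (Finset.measurable_sum _ fun j _ => (measurable_res r F hw hx _ _).mul (hv j))
  · exact Finset.measurable_sum _ fun i _ => measurable_res r F hw hx _ _

lemma res_congr {L N : ℕ} (r : ℝ) {F : Finset ℕ} {w w' : ℕ → Fin L → ℂ} {x x' : ℕ → Fin N → ℂ}
    (hw : ∀ k ∈ F, w k = w' k) (hx : ∀ k ∈ F, x k = x' k) : res r F w x = res r F w' x' := by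
  rw [res, res, cov, cov, Finset.sum_congr rfl fun k hk => by rw [hw k hk, hx k hk]]

lemma formError_congr {L N : ℕ} (r τ : ℝ) {F : Finset ℕ} {w w' : ℕ → Fin L → ℂ}
    {x x' : ℕ → Fin N → ℂ} (hw : ∀ k ∈ F, w k = w' k) (hx : ∀ k ∈ F, x k = x' k)
    (v : Fin N → ℂ) : formError r τ F w x v = formError r τ F w' x' v := by
  rw [formError, formError, res_congr r hw hx]

/-! ### Concentration with random resolvents and random weights. -/

section Conditioning

variable {Ω : Type*} [MeasurableSpace Ω] {P : Measure Ω} [IsProbabilityMeasure P]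

/-- Conditioning by Tonelli: a bound that is uniform over the frozen value of X survives averaging
over X. -/
lemma lintegral_le_of_indepFun {α β : Type*} [MeasurableSpace α] [MeasurableSpace β] {X : Ω → α}
    {Y : Ω → β} (hXY : IndepFun X Y P) (hX : Measurable X) (hY : Measurable Y)
    {f : α × β → ENNReal} (hf : Measurable f) {c : ENNReal}
    (h : ∀ x, ∫⁻ ω, f (x, Y ω) ∂P ≤ c) : ∫⁻ ω, f (X ω, Y ω) ∂P ≤ c := by
  have hP : IsProbabilityMeasure (P.map X) := Measure.isProbabilityMeasure_map hX.aemeasurable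
  have h1 := hXY.map_prod_eq_prod_map_map hX.aemeasurable hY.aemeasurable
  rw [← lintegral_map hf (hX.prodMk hY), h1, lintegral_prod _ hf.aemeasurable]
  calc ∫⁻ x, ∫⁻ y, f (x, y) ∂(P.map Y) ∂(P.map X) ≤ ∫⁻ _, c ∂(P.map X) := by
        refine lintegral_mono fun x => ?_
        rw [lintegral_map (f := fun y => f (x, y)) (hf.comp measurable_prodMk_left) hY]
        exact h x
    _ = c := by simp

/-- The columns of the array `s` after application of a function to the entries. -/
def cols (h : ℂ → ℂ) (s : ℕ → ℕ → ℂ) (N : ℕ) : ℕ → Fin N → ℂ := fun k i => h (s i k)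

/-- The constant in the fourth moment bounds for `formError`. -/
noncomputable def momentConst (r b : ℝ) : ℝ := 19 * (64 * 38 * (1 / r) ^ 4 * b ^ 8)

lemma momentConst_nonneg (r b : ℝ) : 0 ≤ momentConst r b := by
  have : 0 ≤ (1 / r) ^ 4 * b ^ 8 := by positivity
  unfold momentConst
  linarith

variable {s : ℕ → ℕ → Ω → ℂ}

lemma sum_row_block_res_le {L N : ℕ} {r : ℝ} (hr : 0 < r) (F : Finset ℕ) (w : ℕ → Fin L → ℂ)
    (y : ℕ → Fin N → ℂ) (ℓ ℓ' : Fin L) (i : Fin N) :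
    ∑ j, ‖block (res r F w y) ℓ ℓ' i j‖ ^ 2 ≤ (1 / r) ^ 2 := by
  have h := sum_row_resolvent_le (posSemidef_cov F w y) hr (ℓ, i)
  rw [Fintype.sum_prod_type] at h
  exact (Finset.single_le_sum (f := fun ℓ' => ∑ j, ‖res r F w y (ℓ, i) (ℓ', j)‖ ^ 2)
    (fun _ _ => Finset.sum_nonneg fun _ _ => by positivity) (Finset.mem_univ ℓ')).trans h

lemma sum_col_block_res_le {L N : ℕ} {r : ℝ} (hr : 0 < r) (F : Finset ℕ) (w : ℕ → Fin L → ℂ)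
    (y : ℕ → Fin N → ℂ) (ℓ ℓ' : Fin L) (j : Fin N) :
    ∑ i, ‖block (res r F w y) ℓ ℓ' i j‖ ^ 2 ≤ (1 / r) ^ 2 := by
  have h := sum_col_resolvent_le (posSemidef_cov F w y) hr (ℓ', j)
  rw [Fintype.sum_prod_type] at h
  exact (Finset.single_le_sum (f := fun ℓ => ∑ i, ‖res r F w y (ℓ, i) (ℓ', j)‖ ^ 2)
    (fun _ _ => Finset.sum_nonneg fun _ _ => by positivity) (Finset.mem_univ ℓ)).trans h

lemma formError_apply {L N : ℕ} (r τ : ℝ) (F : Finset ℕ) (w : ℕ → Fin L → ℂ)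
    (y : ℕ → Fin N → ℂ) (v : Fin N → ℂ) (ℓ ℓ' : Fin L) :
    formError r τ F w y v ℓ ℓ' = (1 / (N : ℂ)) * (star v ⬝ᵥ block (res r F w y) ℓ ℓ' *ᵥ v -
      τ * ∑ i, block (res r F w y) ℓ ℓ' i i) := by
  simp only [formError, blockForm, blockTrace, Matrix.sub_apply, Matrix.smul_apply,
    Matrix.of_apply, smul_eq_mul, block]
  ring

lemma bddMeas_form {N : ℕ} {v : Ω → Fin N → ℂ} (hv : ∀ i, BddMeas fun ω => v ω i)
    (R : Matrix (Fin N) (Fin N) ℂ) (z : ℂ) :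
    BddMeas fun ω => star (v ω) ⬝ᵥ R *ᵥ v ω - z := by
  simp only [dotProduct, Matrix.mulVec, Pi.star_apply]
  exact (BddMeas.sum _ fun i _ => (hv i).star.mul
        (BddMeas.sum _ fun j _ => (BddMeas.const _).mul (hv j))).sub (BddMeas.const _)

/-- Rows and columns of the blocks have norm at most 1/r whatever the weights and columns inside the
resolvent, so only the tested vector has to be bounded. -/
lemma lintegral_formError_fixed_le {L N : ℕ} (hN : N ≠ 0) {x : ℕ → Ω → ℂ} {b τ r : ℝ} (hr : 0 < r)
    (hx : iIndepFun x P) (hm : ∀ i, Measurable (x i)) (hb : ∀ i ω, ‖x i ω‖ ≤ b)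
    (hmean : ∀ i, ∫ ω, x i ω ∂P = 0) (hvar : ∀ i, ∫ ω, ‖x i ω‖ ^ 2 ∂P = τ) (F : Finset ℕ)
    (w : ℕ → Fin L → ℂ) (y : ℕ → Fin N → ℂ) (ℓ ℓ' : Fin L) :
    ∫⁻ ω, ENNReal.ofReal (‖formError r τ F w y (fun i : Fin N => x i ω) ℓ ℓ'‖ ^ 4) ∂P ≤
      ENNReal.ofReal (momentConst r b / (N : ℝ) ^ 2) := by
  have h1 := integral_matrix_pow_four_le hx hm hb hmean hvar (block (res r F w y) ℓ ℓ')
    (κ := 1 / r) (by positivity) (sum_row_block_res_le hr F w y ℓ ℓ')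
    (sum_col_block_res_le hr F w y ℓ ℓ')
  simp only [formError_apply, norm_mul, mul_pow]
  generalize block (res r F w y) ℓ ℓ' = R at h1
  have hN' : (0 : ℝ) < N := by positivity
  have hB : BddMeas fun ω => star (fun i : Fin N => x i ω) ⬝ᵥ R *ᵥ (fun i : Fin N => x i ω) -
      τ * ∑ i, R i i := bddMeas_form (v := fun ω (i : Fin N) => x i ω)
        (fun i => ⟨hm i, b, hb i⟩) R _
  have hint := hB.integrable_norm_pow (P := P) 4
  rw [← ofReal_integral_eq_lintegral_ofReal (hint.const_mul _)
    (Eventually.of_forall fun ω => by positivity)]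
  refine ENNReal.ofReal_le_ofReal ?_
  rw [integral_const_mul]
  refine (mul_le_mul_of_nonneg_left h1 (by positivity)).trans (le_of_eq ?_)
  rw [momentConst]
  simp only [norm_div, norm_one, Complex.norm_natCast]
  field_simp

/-- Column k is independent of the columns indexed by F, which may therefore be frozen. The tested
column passes through g and the others through h: h is the identity when user 0 is tested, and the
truncation for the interferers. -/
lemma lintegral_formError_le {L N : ℕ} (hN : N ≠ 0) {b τ r : ℝ} (hr : 0 < r)
    (hs_meas : ∀ i j, Measurable (s i j)) (hs_indep : iIndepFun (fun p : ℕ × ℕ => s p.1 p.2) P)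
    {g h : ℂ → ℂ} (hg : Measurable g) (hh : Measurable h) (hb : ∀ z, ‖g z‖ ≤ b)
    (hmean : ∀ i j, ∫ ω, g (s i j ω) ∂P = 0) (hvar : ∀ i j, ∫ ω, ‖g (s i j ω)‖ ^ 2 ∂P = τ)
    {F : Finset ℕ} {k : ℕ} (hk : k ∉ F) (w : ℕ → Fin L → ℂ) (ℓ ℓ' : Fin L) :
    ∫⁻ ω, ENNReal.ofReal (‖formError r τ F w (cols h (fun i j => s i j ω) N)
      (cols g (fun i j => s i j ω) N k) ℓ ℓ'‖ ^ 4) ∂P ≤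
      ENNReal.ofReal (momentConst r b / (N : ℝ) ^ 2) := by
  have hind := hs_indep.indepFun_finset (Finset.range N ×ˢ F) (Finset.range N ×ˢ {k}) (by
    rw [Finset.disjoint_left]
    rintro ⟨i, j⟩ h1 h2
    simp only [Finset.mem_product, Finset.mem_singleton] at h1 h2
    exact hk (h2.2 ▸ h1.2)) (fun p => hs_meas p.1 p.2)
  -- The columns are rebuilt from the two disjoint finite families of entries; the value 0 outside F
  -- is never read by `formError`.
  set X : (↥(Finset.range N ×ˢ F) → ℂ) → ℕ → Fin N → ℂ := fun u j i =>
    if hp : ((i : ℕ), j) ∈ Finset.range N ×ˢ F then u ⟨(i, j), hp⟩ else 0 with hX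
  set Y : (↥(Finset.range N ×ˢ ({k} : Finset ℕ)) → ℂ) → Fin N → ℂ := fun u i =>
    u ⟨((i : ℕ), k), by simp⟩ with hY
  have hXm : Measurable X := by
    refine measurable_pi_iff.2 fun j => measurable_pi_iff.2 fun i => ?_
    by_cases hp : ((i : ℕ), j) ∈ Finset.range N ×ˢ F
    · simp only [hX, hp, dif_pos]; exact measurable_pi_apply _
    · simp only [hX, hp, dif_neg, not_false_eq_true]; exact measurable_const
  have hYm : Measurable Y := measurable_pi_iff.2 fun i => measurable_pi_apply _
  have hind2 := hind.comp hXm hYm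
  set f : (ℕ → Fin N → ℂ) × (Fin N → ℂ) → ENNReal := fun p =>
    ENNReal.ofReal (‖formError r τ F w (fun j i => h (p.1 j i)) (fun i => g (p.2 i)) ℓ ℓ'‖ ^ 4)
    with hf
  have hfm : Measurable f := by
    refine ENNReal.measurable_ofReal.comp (Measurable.pow_const (Measurable.norm ?_) 4)
    refine measurable_formError r τ F (w := fun _ => w)
      (x := fun (p : (ℕ → Fin N → ℂ) × (Fin N → ℂ)) j i => h (p.1 j i))
      (v := fun p i => g (p.2 i)) (fun _ _ _ => measurable_const) (fun j _ i => ?_)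
      (fun i => ?_) ℓ ℓ'
    · exact hh.comp ((measurable_pi_apply i).comp ((measurable_pi_apply j).comp measurable_fst))
    · exact hg.comp ((measurable_pi_apply i).comp measurable_snd)
  have hSm : ∀ T : Finset (ℕ × ℕ), Measurable fun ω => fun p : T => s p.1.1 p.1.2 ω :=
    fun T => measurable_pi_iff.2 fun p => hs_meas _ _
  have key := lintegral_le_of_indepFun hind2 (hXm.comp (hSm _)) (hYm.comp (hSm _)) hfm
    (c := ENNReal.ofReal (momentConst r b / (N : ℝ) ^ 2)) (fun x => by
      have hind3 : iIndepFun (fun i : ℕ => s i k) P :=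
        hs_indep.precomp (g := fun i : ℕ => (i, k)) fun i j hij => (Prod.mk.inj hij).1
      exact lintegral_formError_fixed_le (x := fun i ω => g (s i k ω)) hN hr
        (hind3.comp (fun _ => g) fun _ => hg)
        (fun i => hg.comp (hs_meas i k)) (fun i ω => hb _) (fun i => hmean i k)
        (fun i => hvar i k) F w (fun j i => h (x j i)) ℓ ℓ')
  refine le_trans (le_of_eq ?_) key
  refine lintegral_congr fun ω => ?_
  have h2 := formError_congr (N := N) r τ (F := F) (w := w) (x := cols h (fun i j => s i j ω) N)
    (x' := fun j i => h (X (fun p => s p.1.1 p.1.2 ω) j i)) (fun _ _ => rfl)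
    (fun j hj => by funext i; simp [hX, hj, cols]) (cols g (fun i j => s i j ω) N k)
  rw [h2]
  rfl

/-- The fourth moment bound for random weights that are independent of the array. -/
lemma lintegral_formError_random_le {L N K : ℕ} (hN : N ≠ 0) {b τ r : ℝ} (hr : 0 < r)
    (hs_meas : ∀ i j, Measurable (s i j)) (hs_indep : iIndepFun (fun p : ℕ × ℕ => s p.1 p.2) P)
    {g h : ℂ → ℂ} (hg : Measurable g) (hh : Measurable h) (hb : ∀ z, ‖g z‖ ≤ b)
    (hmean : ∀ i j, ∫ ω, g (s i j ω) ∂P = 0) (hvar : ∀ i j, ∫ ω, ‖g (s i j ω)‖ ^ 2 ∂P = τ)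
    {T : ℕ → Ω → ℝ} {γ : ℕ → Ω → Fin L → ℂ}
    (hT : ∀ k < K, Measurable (T k)) (hγ : ∀ k < K, Measurable (γ k))
    (hind : IndepFun (fun ω => fun k : Fin K => (T k ω, γ k ω))
      (fun ω => fun (i : Fin N) (k : Fin K) => s i k ω) P)
    {φ : ℝ × (Fin L → ℂ) → Fin L → ℂ} (hφ : Measurable φ)
    {F : Finset ℕ} (hF : ∀ j ∈ F, j < K) {k : ℕ} (hkK : k < K) (hk : k ∉ F) (ℓ ℓ' : Fin L) :
    (Measurable fun ω => ENNReal.ofReal (‖formError r τ F (fun j => φ (T j ω, γ j ω))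
      (cols h (fun i j => s i j ω) N) (cols g (fun i j => s i j ω) N k) ℓ ℓ'‖ ^ 4)) ∧
    ∫⁻ ω, ENNReal.ofReal (‖formError r τ F (fun j => φ (T j ω, γ j ω))
      (cols h (fun i j => s i j ω) N) (cols g (fun i j => s i j ω) N k) ℓ ℓ'‖ ^ 4) ∂P ≤
      ENNReal.ofReal (momentConst r b / (N : ℝ) ^ 2) := by
  -- Only users below K are read, since measurability and independence are available for these
  -- alone; the rest is filled with zeros.
  set f : (Fin K → ℝ × (Fin L → ℂ)) × (Fin N → Fin K → ℂ) → ENNReal := fun p =>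
    ENNReal.ofReal (‖formError r τ F (fun j => if hj : j < K then φ (p.1 ⟨j, hj⟩) else 0)
      (fun j i => if hj : j < K then h (p.2 i ⟨j, hj⟩) else 0)
        (fun i => g (p.2 i ⟨k, hkK⟩)) ℓ ℓ'‖ ^ 4)
    with hf
  have hfm : Measurable f := by
    refine ENNReal.measurable_ofReal.comp (Measurable.pow_const (Measurable.norm ?_) 4)
    refine measurable_formError r τ F (fun j hj ℓ => ?_) (fun j hj i => ?_) (fun i => ?_) ℓ ℓ'
    · simp only [hF j hj, dif_pos]
      exact (measurable_pi_apply ℓ).comp (hφ.comp ((measurable_pi_apply _).comp measurable_fst))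
    · simp only [hF j hj, dif_pos]
      exact hh.comp ((measurable_pi_apply _).comp ((measurable_pi_apply i).comp measurable_snd))
    · exact hg.comp ((measurable_pi_apply _).comp ((measurable_pi_apply i).comp measurable_snd))
  have hXm : Measurable fun ω => fun k : Fin K => (T k ω, γ k ω) :=
    measurable_pi_iff.2 fun k => (hT k k.2).prodMk (hγ k k.2)
  have hYm : Measurable fun ω => fun (i : Fin N) (k : Fin K) => s i k ω :=
    measurable_pi_iff.2 fun i => measurable_pi_iff.2 fun k => hs_meas i k
  have e : ∀ (x : Fin K → ℝ × (Fin L → ℂ)) ω, f (x, fun (i : Fin N) (k : Fin K) => s i k ω) =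
      ENNReal.ofReal (‖formError r τ F (fun j => if hj : j < K then φ (x ⟨j, hj⟩) else 0)
      (cols h (fun i j => s i j ω) N) (cols g (fun i j => s i j ω) N k) ℓ ℓ'‖ ^ 4) := by
    intro x ω
    have h1 : (fun i : Fin N => g (s i k ω)) = cols g (fun i j => s i j ω) N k := rfl
    have h2 := formError_congr (N := N) r τ (F := F)
      (w := fun j => if hj : j < K then φ (x ⟨j, hj⟩) else 0)
      (x := fun j i => if hj : j < K then h (s i j ω) else 0) (x' := cols h (fun i j => s i j ω) N)
      (fun _ _ => rfl) (fun j hj => by funext i; simp [hF j hj, cols])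
      (cols g (fun i j => s i j ω) N k)
    simp only [hf]
    rw [h1, h2]
  have e2 : ∀ ω, ENNReal.ofReal (‖formError r τ F (fun j => φ (T j ω, γ j ω))
      (cols h (fun i j => s i j ω) N) (cols g (fun i j => s i j ω) N k) ℓ ℓ'‖ ^ 4) =
      f (fun k : Fin K => (T k ω, γ k ω), fun (i : Fin N) (k : Fin K) => s i k ω) := by
    intro ω
    have h2 := formError_congr (N := N) r τ (F := F) (w := fun j => φ (T j ω, γ j ω))
      (w' := fun j => if hj : j < K then φ (T j ω, γ j ω) else 0)
      (x := cols h (fun i j => s i j ω) N) (fun j hj => by simp [hF j hj]) (fun _ _ => rfl)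
      (cols g (fun i j => s i j ω) N k)
    rw [e, h2]
  simp only [e2]
  refine ⟨hfm.comp (hXm.prodMk hYm), lintegral_le_of_indepFun hind hXm hYm hfm fun x => ?_⟩
  simp only [e]
  exact lintegral_formError_le hN hr hs_meas hs_indep hg hh hb hmean hvar hk _ _ _

/-- A sequence of nonnegative random variables with expectations `O(1/N²)` tends to `0`. -/
lemma ae_tendsto_zero_of_lintegral_le {P : Measure Ω} {V : ℕ → Ω → ENNReal} (C : ℝ)
    (hV : ∀ᶠ N in atTop, Measurable (V N) ∧ ∫⁻ ω, V N ω ∂P ≤ ENNReal.ofReal (C / (N : ℝ) ^ 2)) :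
    ∀ᵐ ω ∂P, Tendsto (fun N => V N ω) atTop (𝓝 0) := by
  obtain ⟨N₀, hN₀⟩ := eventually_atTop.1 hV
  -- Since 1/N² is summable, the sum of the V N has finite expectation, hence is almost surely
  -- finite, and its terms tend to 0. This is the reason for working with fourth moments.
  have hsum : ∑' N, ∫⁻ ω, V (N + N₀) ω ∂P ≠ ⊤ := by
    have h1 : Summable fun N : ℕ => max (C / ((N + N₀ : ℕ) : ℝ) ^ 2) 0 := by
      have h2 : Summable fun N : ℕ => |C| * (1 / ((N + N₀ : ℕ) : ℝ) ^ 2) :=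
        ((summable_nat_add_iff N₀).2 (Real.summable_one_div_nat_pow.2 one_lt_two)).mul_left _
      refine Summable.of_nonneg_of_le (fun _ => le_max_right _ _) (fun N => ?_) h2
      refine max_le ?_ (by positivity)
      rw [mul_one_div]
      exact div_le_div_of_nonneg_right (le_abs_self C) (by positivity)
    refine ne_top_of_le_ne_top (h1.tsum_ofReal_ne_top) (ENNReal.tsum_le_tsum fun N => ?_)
    refine (hN₀ (N + N₀) (by omega)).2.trans (ENNReal.ofReal_le_ofReal (le_max_left _ _))
  rw [← lintegral_tsum fun N => (hN₀ (N + N₀) (by omega)).1.aemeasurable] at hsum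
  have hae := ae_lt_top (Measurable.tsum fun N => (hN₀ (N + N₀) (by omega)).1) hsum
  filter_upwards [hae] with ω hω
  have := ENNReal.tendsto_atTop_zero_of_tsum_ne_top hω.ne
  exact (tendsto_add_atTop_iff_nat N₀).1 this

end Conditioning

/-! ### Truncation and centring of the entries. -/

section Truncation

variable {Ω : Type*} [MeasurableSpace Ω] {P : Measure Ω} [IsProbabilityMeasure P]

/-- Truncation of a complex number at level `n`. -/
noncomputable def clip (n : ℕ) (z : ℂ) : ℂ := if ‖z‖ ≤ n then z else 0

lemma measurable_clip (n : ℕ) : Measurable (clip n) :=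
  Measurable.ite (measurableSet_le measurable_norm measurable_const) measurable_id measurable_const

lemma norm_clip_le (n : ℕ) (z : ℂ) : ‖clip n z‖ ≤ n := by
  unfold clip
  split_ifs with h
  · exact h
  · simp

lemma norm_clip_le_norm (n : ℕ) (z : ℂ) : ‖clip n z‖ ≤ ‖z‖ := by
  unfold clip
  split_ifs <;> simp

lemma tendsto_clip (z : ℂ) : Tendsto (fun n => clip n z) atTop (𝓝 z) := by
  refine tendsto_const_nhds.congr' ?_
  filter_upwards [eventually_ge_atTop ⌈‖z‖⌉₊] with n hn
  rw [clip, if_pos (Nat.ceil_le.1 hn)]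

/-- Truncation followed by centering with respect to the law of `S`. -/
noncomputable def trunc (P : Measure Ω) (S : Ω → ℂ) (n : ℕ) (z : ℂ) : ℂ :=
  clip n z - ∫ ω, clip n (S ω) ∂P

lemma measurable_trunc {P : Measure Ω} (S : Ω → ℂ) (n : ℕ) : Measurable (trunc P S n) :=
  (measurable_clip n).sub_const _

lemma norm_trunc_le (S : Ω → ℂ) (n : ℕ) (z : ℂ) : ‖trunc P S n z‖ ≤ 2 * n := by
  have h : ‖∫ ω, clip n (S ω) ∂P‖ ≤ n := by
    have := norm_integral_le_of_norm_le_const (μ := P) (f := fun ω => clip n (S ω)) (C := n)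
      (Eventually.of_forall fun ω => norm_clip_le n _)
    simpa using this
  refine (norm_sub_le _ _).trans ?_
  linarith [norm_clip_le n z]

lemma integral_trunc {S S' : Ω → ℂ} (hS : Measurable S) (h : IdentDistrib S' S P P) (n : ℕ) :
    ∫ ω, trunc P S n (S' ω) ∂P = 0 := by
  have h1 := (h.comp (measurable_trunc (P := P) S n)).integral_eq
  simp only [Function.comp] at h1
  rw [h1]
  have hi : Integrable (fun ω => clip n (S ω)) P :=
    Integrable.of_bound ((measurable_clip n).comp hS).aestronglyMeasurable n
      (Eventually.of_forall fun ω => norm_clip_le n _)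
  simp only [trunc]
  rw [integral_sub hi (integrable_const _)]
  simp

/-- The variance of the truncated variable. -/
noncomputable def truncVar (P : Measure Ω) (S : Ω → ℂ) (n : ℕ) : ℝ :=
  ∫ ω, ‖trunc P S n (S ω)‖ ^ 2 ∂P

/-- The mean square of the truncation error. -/
noncomputable def truncErr (P : Measure Ω) (S : Ω → ℂ) (n : ℕ) : ℝ :=
  ∫ ω, ‖S ω - trunc P S n (S ω)‖ ^ 2 ∂P

lemma integral_trunc_sq {P : Measure Ω} {S S' : Ω → ℂ} (h : IdentDistrib S' S P P) (n : ℕ) :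
    ∫ ω, ‖trunc P S n (S' ω)‖ ^ 2 ∂P = truncVar P S n :=
  (h.comp ((measurable_trunc (P := P) S n).norm.pow_const 2)).integral_eq

lemma truncVar_nonneg {P : Measure Ω} (S : Ω → ℂ) (n : ℕ) : 0 ≤ truncVar P S n :=
  integral_nonneg fun _ => by positivity

variable {S : Ω → ℂ}

lemma integrable_of_sq (hS : Measurable S) (h2 : Integrable (fun ω => ‖S ω‖ ^ 2) P) :
    Integrable S P := by
  refine Integrable.mono' (h2.add (integrable_const 1)) hS.aestronglyMeasurable
    (Eventually.of_forall fun ω => ?_)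
  simp only [Pi.add_apply]
  nlinarith [sq_nonneg (‖S ω‖ - 1), norm_nonneg (S ω)]

lemma norm_integral_clip_le (hS : Measurable S) (h2 : Integrable (fun ω => ‖S ω‖ ^ 2) P) (n : ℕ) :
    ‖∫ ω, clip n (S ω) ∂P‖ ≤ ∫ ω, ‖S ω‖ ∂P := by
  refine (norm_integral_le_integral_norm _).trans ?_
  have h1 := integrable_of_sq hS h2
  refine integral_mono_of_nonneg (Eventually.of_forall fun _ => norm_nonneg _) h1.norm
    (Eventually.of_forall fun ω => norm_clip_le_norm n _)

lemma norm_trunc_le_add (hS : Measurable S) (h2 : Integrable (fun ω => ‖S ω‖ ^ 2) P) (n : ℕ)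
    (z : ℂ) : ‖trunc P S n z‖ ≤ ‖z‖ + ∫ ω, ‖S ω‖ ∂P :=
  (norm_sub_le _ _).trans (add_le_add (norm_clip_le_norm n z) (norm_integral_clip_le hS h2 n))

lemma tendsto_trunc (hS : Measurable S) (h2 : Integrable (fun ω => ‖S ω‖ ^ 2) P)
    (hmean : ∫ ω, S ω ∂P = 0) (z : ℂ) : Tendsto (fun n => trunc P S n z) atTop (𝓝 z) := by
  have h := tendsto_integral_of_dominated_convergence (F := fun n ω => clip n (S ω)) (f := S)
    (μ := P) (fun ω => ‖S ω‖) (fun n => ((measurable_clip n).comp hS).aestronglyMeasurable)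
    (integrable_of_sq hS h2).norm (fun n => Eventually.of_forall fun ω => norm_clip_le_norm n _)
    (Eventually.of_forall fun ω => tendsto_clip _)
  rw [hmean] at h
  simpa [trunc] using (tendsto_clip z).sub h

lemma tendsto_truncVar (hS : Measurable S) (h2 : Integrable (fun ω => ‖S ω‖ ^ 2) P)
    (hmean : ∫ ω, S ω ∂P = 0) (hvar : ∫ ω, ‖S ω‖ ^ 2 ∂P = 1) :
    Tendsto (truncVar P S) atTop (𝓝 1) := by
  set m := ∫ ω, ‖S ω‖ ∂P
  have h := tendsto_integral_of_dominated_convergence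
    (F := fun n ω => ‖trunc P S n (S ω)‖ ^ 2) (f := fun ω => ‖S ω‖ ^ 2)
    (μ := P) (fun ω => 2 * ‖S ω‖ ^ 2 + 2 * m ^ 2)
    (fun n => (((measurable_trunc (P := P) S n).comp hS).norm.pow_const 2).aestronglyMeasurable)
    ((h2.const_mul 2).add (integrable_const _)) (fun n => Eventually.of_forall fun ω => ?_)
    (Eventually.of_forall fun ω => (tendsto_trunc hS h2 hmean (S ω)).norm.pow 2)
  · rwa [hvar] at h
  · rw [Real.norm_of_nonneg (by positivity)]
    have := pow_le_pow_left₀ (norm_nonneg _) (norm_trunc_le_add hS h2 n (S ω)) 2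
    nlinarith [sq_nonneg (‖S ω‖ - m)]

/-- An integrable majorant that does not depend on n, for dominated convergence. -/
lemma truncErr_bound (hS : Measurable S) (h2 : Integrable (fun ω => ‖S ω‖ ^ 2) P) (n : ℕ)
    (ω : Ω) : ‖S ω - trunc P S n (S ω)‖ ^ 2 ≤ 8 * ‖S ω‖ ^ 2 + 2 * (∫ ω, ‖S ω‖ ∂P) ^ 2 := by
  set m := ∫ ω, ‖S ω‖ ∂P
  have h1 : ‖S ω - trunc P S n (S ω)‖ ≤ 2 * ‖S ω‖ + m := by
    refine (norm_sub_le _ _).trans ?_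
    linarith [norm_trunc_le_add hS h2 n (S ω)]
  have := pow_le_pow_left₀ (norm_nonneg _) h1 2
  nlinarith [sq_nonneg (2 * ‖S ω‖ - m)]

lemma integrable_truncErr (hS : Measurable S) (h2 : Integrable (fun ω => ‖S ω‖ ^ 2) P) (n : ℕ) :
    Integrable (fun ω => ‖S ω - trunc P S n (S ω)‖ ^ 2) P := by
  refine Integrable.mono' ((h2.const_mul 8).add
    (integrable_const (2 * (∫ ω, ‖S ω‖ ∂P) ^ 2)))
    ((hS.sub ((measurable_trunc (P := P) S n).comp hS)).norm.pow_const 2).aestronglyMeasurable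
    (Eventually.of_forall fun ω => ?_)
  rw [Real.norm_of_nonneg (by positivity)]
  exact truncErr_bound hS h2 n ω

lemma tendsto_truncErr (hS : Measurable S) (h2 : Integrable (fun ω => ‖S ω‖ ^ 2) P)
    (hmean : ∫ ω, S ω ∂P = 0) : Tendsto (truncErr P S) atTop (𝓝 0) := by
  have h := tendsto_integral_of_dominated_convergence
    (F := fun n ω => ‖S ω - trunc P S n (S ω)‖ ^ 2) (f := fun _ => (0 : ℝ))
    (μ := P) _
    (fun n => ((hS.sub ((measurable_trunc (P := P) S n).comp hS)).norm.pow_const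
      2).aestronglyMeasurable)
    ((h2.const_mul 8).add (integrable_const (2 * (∫ ω, ‖S ω‖ ∂P) ^ 2)))
    (fun n => Eventually.of_forall fun ω => ?_)
    (Eventually.of_forall fun ω => ?_)
  · simp only [integral_zero] at h
    exact h
  · rw [Real.norm_of_nonneg (by positivity)]
    exact truncErr_bound hS h2 n ω
  · have := (tendsto_const_nhds (x := S ω)).sub (tendsto_trunc hS h2 hmean (S ω))
    simpa using this.norm.pow 2

end Truncation

/-! ### Strong laws for one column and for square corners of the array. -/

section LawOfLargeNumbers

variable {Ω : Type*} [MeasurableSpace Ω] {P : Measure Ω} {s : ℕ → ℕ → Ω → ℂ}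

lemma ae_tendsto_average_column (hs_indep : iIndepFun (fun p : ℕ × ℕ => s p.1 p.2) P)
    (hs_ident : ∀ i j, IdentDistrib (s i j) (s 0 0) P P) {f : ℂ → ℝ} (hf : Measurable f)
    (hint : Integrable (fun ω => f (s 0 0 ω)) P) :
    ∀ᵐ ω ∂P, Tendsto (fun n : ℕ => (∑ i ∈ Finset.range n, f (s i 0 ω)) / n) atTop
      (𝓝 (∫ ω, f (s 0 0 ω) ∂P)) :=
  strong_law_ae_real (fun i ω => f (s i 0 ω)) hint
    (fun i j hij => (hs_indep.indepFun (i := (i, 0)) (j := (j, 0))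
      (fun h => hij (Prod.mk.inj h).1)).comp hf hf)
    (fun i => (hs_ident i 0).comp hf)

/-- `Nat.pair` fills the quadrant by growing squares: the codes below n² are exactly the pairs with
both coordinates below n. -/
lemma sum_range_sq_unpair (f : ℕ → ℕ → ℝ) (n : ℕ) :
    ∑ m ∈ Finset.range (n ^ 2), f (Nat.unpair m).1 (Nat.unpair m).2 =
      ∑ i ∈ Finset.range n, ∑ j ∈ Finset.range n, f i j := by
  rw [← Finset.sum_product']
  refine Finset.sum_nbij' (fun m => Nat.unpair m) (fun p => Nat.pair p.1 p.2) ?_ ?_ ?_ ?_ ?_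
  · intro m hm
    rw [Finset.mem_range] at hm
    have h := Nat.max_sq_add_min_le_pair (Nat.unpair m).1 (Nat.unpair m).2
    rw [Nat.pair_unpair] at h
    have h2 : max (Nat.unpair m).1 (Nat.unpair m).2 < n := by
      refine lt_of_pow_lt_pow_left₀ 2 (Nat.zero_le n) ?_
      omega
    rw [Finset.mem_product, Finset.mem_range, Finset.mem_range]
    exact max_lt_iff.1 h2
  · rintro ⟨i, j⟩ hp
    rw [Finset.mem_product, Finset.mem_range, Finset.mem_range] at hp
    rw [Finset.mem_range]
    refine (Nat.pair_lt_max_add_one_sq i j).trans_le (Nat.pow_le_pow_left ?_ 2)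
    exact max_lt hp.1 hp.2
  · intro m _; exact Nat.pair_unpair m
  · intro p _; exact Nat.unpair_pair p.1 p.2
  · intro m _; rfl

/-- The array is enumerated as a single i.i.d. sequence, and the strong law is read along the
subsequence n². -/
lemma ae_tendsto_average_square (hs_indep : iIndepFun (fun p : ℕ × ℕ => s p.1 p.2) P)
    (hs_ident : ∀ i j, IdentDistrib (s i j) (s 0 0) P P) {f : ℂ → ℝ} (hf : Measurable f)
    (hint : Integrable (fun ω => f (s 0 0 ω)) P) :
    ∀ᵐ ω ∂P, Tendsto (fun n : ℕ => (∑ i ∈ Finset.range n, ∑ j ∈ Finset.range n, f (s i j ω)) /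
      (n : ℝ) ^ 2) atTop (𝓝 (∫ ω, f (s 0 0 ω) ∂P)) := by
  have h := strong_law_ae_real (fun m ω => f (s (Nat.unpair m).1 (Nat.unpair m).2 ω))
    (by simpa using hint)
    (fun i j hij => (hs_indep.indepFun (i := Nat.unpair i) (j := Nat.unpair j)
      (fun h => hij (Nat.pairEquiv.symm.injective h))).comp hf hf)
    (fun i => by
      simpa [Function.comp_def] using
        (hs_ident (Nat.unpair i).1 (Nat.unpair i).2).comp hf)
  filter_upwards [h] with ω hω
  have h2 := hω.comp (tendsto_pow_atTop (α := ℕ) two_ne_zero)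
  simp only [Nat.unpair_zero] at h2
  refine h2.congr fun n => ?_
  simp only [Function.comp]
  rw [sum_range_sq_unpair (fun i j => f (s i j ω)) n]
  push_cast
  rfl

end LawOfLargeNumbers

/-! ### Averages against the empirical distribution of the weights. -/

section Empirical

lemma integral_empirical {E : Type*} [TopologicalSpace E] [MeasurableSpace E]
    [OpensMeasurableSpace E] (K : ℕ) (x : ℕ → E) (f : BoundedContinuousFunction E ℝ) :
    ∫ e, f e ∂(empirical K x : Measure E) =
      ((K - 1 : ℕ) : ℝ)⁻¹ * ∑ k ∈ Finset.Ico 1 K, f (x k) := by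
  rw [empirical, FiniteMeasure.toMeasure_smul, FiniteMeasure.toMeasure_sum,
    integral_smul_nnreal_measure, integral_finsetSum_measure fun k _ => f.integrable _]
  have : ∀ k, ∫ e, f e ∂((diracProba (x k)).toFiniteMeasure : Measure E) = f (x k) := fun k =>
    integral_dirac' _ _ f.continuous.measurable.stronglyMeasurable
  simp only [this]
  rw [NNReal.smul_def, NNReal.coe_inv, NNReal.coe_natCast, smul_eq_mul]

lemma tendsto_users_div {K : ℕ → ℕ} {c : ℝ} (hK : Tendsto (fun N : ℕ => (K N : ℝ) / N) atTop (𝓝 c))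
    (hc : 0 < c) : (∀ᶠ N in atTop, 1 ≤ K N) ∧
      Tendsto (fun N : ℕ => ((K N - 1 : ℕ) : ℝ) / N) atTop (𝓝 c) := by
  have h1 : ∀ᶠ N in atTop, 1 ≤ K N := by
    filter_upwards [hK.eventually_const_lt hc] with N hN
    by_contra h
    have : K N = 0 := by omega
    simp [this] at hN
  refine ⟨h1, ?_⟩
  have h2 := hK.sub (tendsto_const_div_atTop_nhds_zero_nat (1 : ℝ))
  rw [sub_zero] at h2
  refine h2.congr' ?_
  filter_upwards [h1] with N hN
  rw [Nat.cast_sub hN]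
  push_cast
  ring

lemma tendsto_average_of_empirical {E : Type*} [TopologicalSpace E] [MeasurableSpace E]
    [OpensMeasurableSpace E] {K : ℕ → ℕ} {c : ℝ} (hc : 0 < c)
    (hK : Tendsto (fun N : ℕ => (K N : ℝ) / N) atTop (𝓝 c)) {x : ℕ → ℕ → E}
    {G : ProbabilityMeasure E}
    (h : Tendsto (fun N => empirical (K N) (x N)) atTop (𝓝 G.toFiniteMeasure))
    (f : BoundedContinuousFunction E ℝ) :
    Tendsto (fun N : ℕ => (1 / (N : ℝ)) * ∑ k ∈ Finset.Ico 1 (K N), f (x N k)) atTop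
      (𝓝 (c * ∫ e, f e ∂(G : Measure E))) := by
  have h1 := FiniteMeasure.tendsto_iff_forall_integral_tendsto.1 h f
  simp only [integral_empirical] at h1
  refine ((tendsto_users_div hK hc).2.mul h1).congr fun N => ?_
  -- Without interferers the normalizing factor is 0⁻¹ = 0 and the sum is empty, so both sides
  -- vanish.
  by_cases h0 : K N - 1 = 0
  · have : Finset.Ico 1 (K N) = ∅ := Finset.Ico_eq_empty (by omega)
    simp [this]
  · have : ((K N - 1 : ℕ) : ℝ) ≠ 0 := by exact_mod_cast h0
    field_simp

variable {L : ℕ}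

/-- A bounded continuous function on `ℝ^L`. -/
noncomputable def bcf (f : (Fin L → ℝ) → ℝ) (hf : Continuous f) (C : ℝ) (hC : ∀ δ, |f δ| ≤ C) :
    BoundedContinuousFunction (Fin L → ℝ) ℝ :=
  BoundedContinuousFunction.ofNormedAddCommGroup f hf C hC

/-- The law of vectors that are limits of nonnegative vectors is carried by nonnegative vectors. -/
lemma ae_nonneg_of_empirical {K : ℕ → ℕ} {c : ℝ} (hc : 0 < c)
    (hK : Tendsto (fun N : ℕ => (K N : ℝ) / N) atTop (𝓝 c)) {x : ℕ → ℕ → Fin L → ℝ}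
    (hx : ∀ N, ∀ k < K N, ∀ ℓ, 0 ≤ x N k ℓ) {G : ProbabilityMeasure (Fin L → ℝ)}
    (h : Tendsto (fun N => empirical (K N) (x N)) atTop (𝓝 G.toFiniteMeasure)) :
    ∀ᵐ δ ∂(G : Measure (Fin L → ℝ)), ∀ m, 0 ≤ δ m := by
  -- A bounded continuous function that vanishes exactly on the nonnegative orthant; its integral
  -- against G is a limit of zeros.
  set f : (Fin L → ℝ) → ℝ := fun δ => min 1 (∑ m, max (-δ m) 0) with hf
  have hf0 : ∀ δ, 0 ≤ f δ := fun δ =>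
    le_min zero_le_one (Finset.sum_nonneg fun m _ => le_max_right _ _)
  have hfc : Continuous f := by
    simp only [hf]
    fun_prop
  have hf1 : ∀ δ, |f δ| ≤ 1 := fun δ => by rw [abs_of_nonneg (hf0 δ)]; exact min_le_left _ _
  have h1 := tendsto_average_of_empirical hc hK h (bcf f hfc 1 hf1)
  have h2 : ∀ N, ∑ k ∈ Finset.Ico 1 (K N), bcf f hfc 1 hf1 (x N k) = 0 := fun N => by
    refine Finset.sum_eq_zero fun k hk => ?_
    change f (x N k) = 0
    have : ∀ m, max (-x N k m) 0 = 0 := fun m =>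
      max_eq_right (neg_nonpos.2 (hx N k (Finset.mem_Ico.1 hk).2 m))
    simp [hf, this]
  simp only [h2, mul_zero] at h1
  have h3 := tendsto_nhds_unique h1 tendsto_const_nhds
  have h4 : ∫ δ, f δ ∂(G : Measure (Fin L → ℝ)) = 0 := by
    rcases mul_eq_zero.1 h3 with h | h
    · exact absurd h hc.ne'
    · exact h
  rw [integral_eq_zero_iff_of_nonneg hf0
    ((bcf f hfc 1 hf1).integrable (G : Measure (Fin L → ℝ)))] at h4
  filter_upwards [h4] with δ hδ m
  by_contra! hm
  have h5 : 0 < ∑ m, max (-δ m) 0 :=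
    Finset.sum_pos' (fun _ _ => le_max_right _ _)
      ⟨m, Finset.mem_univ m, lt_max_of_lt_left (by linarith)⟩
  have h6 : 0 < f δ := lt_min zero_lt_one h5
  exact h6.ne hδ.symm

/-- A continuous majorant of the indicator of the vectors `δ` with `∑ |δ_m| > n`. -/
noncomputable def tailFun (n : ℕ) : BoundedContinuousFunction (Fin L → ℝ) ℝ :=
  bcf (fun δ => min 1 ((∑ m, |δ m|) / n)) (by fun_prop) 1 (fun δ => by
    have : 0 ≤ (∑ m, |δ m|) / (n : ℝ) :=
      div_nonneg (Finset.sum_nonneg fun m _ => abs_nonneg _) (Nat.cast_nonneg n)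
    rw [abs_of_nonneg (le_min zero_le_one this)]
    exact min_le_left _ _)

lemma tailFun_apply (n : ℕ) (δ : Fin L → ℝ) : tailFun n δ = min 1 ((∑ m, |δ m|) / n) := rfl

lemma tailFun_nonneg (n : ℕ) (δ : Fin L → ℝ) : 0 ≤ tailFun n δ := by
  rw [tailFun_apply]
  exact le_min zero_le_one
    (div_nonneg (Finset.sum_nonneg fun m _ => abs_nonneg _) (Nat.cast_nonneg n))

lemma tendsto_integral_tailFun (G : ProbabilityMeasure (Fin L → ℝ)) :
    Tendsto (fun n => ∫ δ, tailFun n δ ∂(G : Measure (Fin L → ℝ))) atTop (𝓝 0) := by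
  have h := tendsto_integral_of_dominated_convergence
    (F := fun n (δ : Fin L → ℝ) => tailFun n δ) (f := fun _ => (0 : ℝ))
    (μ := (G : Measure (Fin L → ℝ))) (fun _ => 1)
    (fun n => (tailFun n).continuous.measurable.aestronglyMeasurable)
    (integrable_const _) (fun n => Eventually.of_forall fun δ => ?_)
    (Eventually.of_forall fun δ => ?_)
  · simpa only [integral_zero] using h
  · rw [Real.norm_of_nonneg (tailFun_nonneg n δ), tailFun_apply]
    exact min_le_left _ _
  · simp only [tailFun_apply]
    have h1 := tendsto_const_div_atTop_nhds_zero_nat (∑ m, |δ m|)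
    have h2 := (tendsto_const_nhds (x := (1 : ℝ))).min h1
    simpa using h2

/-- The truncated fractions `δ_ℓ / (1 + ∑ a_m δ_m)` as a bounded continuous function. -/
noncomputable def fracFun {a : Fin L → ℝ} (ha : ∀ m, 0 < a m) (ℓ : Fin L) :
    BoundedContinuousFunction (Fin L → ℝ) ℝ :=
  -- The positive parts make the fraction continuous and bounded on all of ℝ^L, and change nothing
  -- on the orthant that carries G.
  bcf (fun δ => max (δ ℓ) 0 / (1 + ∑ m, a m * max (δ m) 0))
    (by
      refine Continuous.div (by fun_prop) (by fun_prop) fun δ => ?_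
      have := sum_mul_nonneg (a := a) (δ := fun m => max (δ m) 0) (fun m => (ha m).le)
        (fun m => le_max_right _ _)
      linarith) (a ℓ)⁻¹ (fun δ => by
      have h0 := frac_nonneg (a := a) (δ := fun m => max (δ m) 0) (fun m => (ha m).le)
        (fun m => le_max_right _ _) ℓ
      have h1 := frac_le_inv (a := a) (δ := fun m => max (δ m) 0) ha
        (fun m => le_max_right _ _) ℓ
      rw [abs_of_nonneg h0]
      exact h1)

lemma fracFun_apply {a : Fin L → ℝ} (ha : ∀ m, 0 < a m) (ℓ : Fin L) {δ : Fin L → ℝ}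
    (hδ : ∀ m, 0 ≤ δ m) : fracFun ha ℓ δ = δ ℓ / (1 + ∑ m, a m * δ m) := by
  change max (δ ℓ) 0 / (1 + ∑ m, a m * max (δ m) 0) = _
  simp only [max_eq_left (hδ _)]

end Empirical

/-! ### Deterministic cost of cutting weights and truncating entries. -/

section Deterministic

variable {L N : ℕ}

/-- The vector `v` if its squared length is at most `B`, and `0` otherwise. -/
noncomputable def cut (B : ℕ) (v : Fin L → ℂ) : Fin L → ℂ := if nsq v ≤ B then v else 0

/-- The squared absolute values of the coordinates. -/
noncomputable def sqAbs (v : Fin L → ℂ) : Fin L → ℝ := fun m => ‖v m‖ ^ 2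

lemma nsq_cut_le (B : ℕ) (v : Fin L → ℂ) : nsq (cut B v) ≤ B := by
  unfold cut
  split_ifs with h
  · exact h
  · simp [nsq]

lemma norm_sq_le_nsq (v : Fin L → ℂ) (i : Fin L) : ‖v i‖ ^ 2 ≤ nsq v :=
  Finset.single_le_sum (f := fun i => ‖v i‖ ^ 2) (fun _ _ => by positivity) (Finset.mem_univ i)

lemma norm_cut_le (B : ℕ) (v : Fin L → ℂ) (i : Fin L) : ‖cut B v i‖ ≤ √(B : ℝ) :=
  Real.le_sqrt_of_sq_le ((norm_sq_le_nsq _ i).trans (nsq_cut_le B v))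

lemma tailFun_eq_one {B : ℕ} (hB : 1 ≤ B) {v : Fin L → ℂ} (hv : ¬nsq v ≤ B) :
    tailFun B (sqAbs v) = 1 := by
  have h1 : ∑ m, |sqAbs v m| = nsq v :=
    Finset.sum_congr rfl fun m _ => abs_of_nonneg (by unfold sqAbs; positivity)
  have hB' : (0 : ℝ) < B := by exact_mod_cast hB
  rw [tailFun_apply, h1]
  exact min_eq_left ((one_le_div hB').2 (not_le.1 hv).le)

/-- A user with zero weight contributes nothing, so cutting weights amounts to removing users, and
stability of the block traces under removal applies. -/
lemma res_cut (r : ℝ) (F : Finset ℕ) (w : ℕ → Fin L → ℂ) (x : ℕ → Fin N → ℂ) (B : ℕ) :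
    res r F (fun k => cut B (w k)) x = res r {k ∈ F | nsq (w k) ≤ B} w x := by
  have h : cov F (fun k => cut B (w k)) x = cov {k ∈ F | nsq (w k) ≤ B} w x := by
    rw [cov, cov, Finset.sum_filter]
    congr 1
    refine Finset.sum_congr rfl fun k _ => ?_
    split_ifs with h
    · simp only [cut, if_pos h]
    · simp only [cut, if_neg h]
      have : tens (0 : Fin L → ℂ) (x k) = 0 := by ext; simp [tens]
      rw [this]
      ext; simp [Matrix.vecMulVec_apply]
  rw [res, res, h]

/-- Each removed user costs at most 1/(N r), and `tailFun` equals 1 there. The continuous function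
replaces the count of removed users so that weak convergence can be used. -/
lemma norm_blockTrace_res_cut_le {r : ℝ} (hr : 0 < r) (F : Finset ℕ) (w : ℕ → Fin L → ℂ)
    (x : ℕ → Fin N → ℂ) {B : ℕ} (hB : 1 ≤ B) (ℓ ℓ' : Fin L) :
    ‖(blockTrace (res r F w x) - blockTrace (res r F (fun k => cut B (w k)) x)) ℓ ℓ'‖ ≤
      1 / r * ((1 / (N : ℝ)) * ∑ k ∈ F, tailFun B (sqAbs (w k))) := by
  rw [res_cut]
  refine (norm_blockTrace_res_sub_le hr (Finset.filter_subset _ F) ℓ ℓ').trans ?_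
  have h1 : (((F \ {k ∈ F | nsq (w k) ≤ B}).card : ℕ) : ℝ) ≤
      ∑ k ∈ F, tailFun B (sqAbs (w k)) := by
    rw [← Finset.filter_not, Finset.card_filter, Nat.cast_sum]
    refine Finset.sum_le_sum fun k _ => ?_
    split_ifs with h
    · rw [Nat.cast_zero]
      exact tailFun_nonneg _ _
    · rw [tailFun_eq_one hB h, Nat.cast_one]
  calc (((F \ {k ∈ F | nsq (w k) ≤ B}).card : ℕ) : ℝ) * (1 / (N * r)) ≤
        (∑ k ∈ F, tailFun B (sqAbs (w k))) * (1 / (N * r)) :=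
        mul_le_mul_of_nonneg_right h1 (by positivity)
    _ = _ := by
      rw [one_div, one_div, one_div, mul_inv]
      ring

/-- The triangle inequality eliminates the length of x', and Cauchy–Schwarz over the users does the
rest. -/
lemma sum_l2_mul_le (F : Finset ℕ) (x x' : ℕ → Fin N → ℂ) :
    ∑ k ∈ F, l2 (x k - x' k) * (l2 (x k) + l2 (x' k)) ≤
      2 * (√(∑ k ∈ F, nsq (x k - x' k)) * √(∑ k ∈ F, nsq (x k))) +
        ∑ k ∈ F, nsq (x k - x' k) := by
  have h1 : ∀ k, l2 (x' k) ≤ l2 (x k) + l2 (x k - x' k) := fun k => by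
    rw [l2_sub_comm]
    simp only [l2, WithLp.toLp_sub]
    have := norm_add_le (WithLp.toLp 2 (x k) : EuclideanSpace ℂ (Fin N))
      (WithLp.toLp 2 (x' k) - WithLp.toLp 2 (x k))
    rwa [add_sub_cancel] at this
  have h2 : ∑ k ∈ F, l2 (x k - x' k) * l2 (x k) ≤
      √(∑ k ∈ F, nsq (x k - x' k)) * √(∑ k ∈ F, nsq (x k)) := by
    have := Real.sum_mul_le_sqrt_mul_sqrt F (fun k => l2 (x k - x' k)) (fun k => l2 (x k))
    simpa only [l2_sq] using this
  calc ∑ k ∈ F, l2 (x k - x' k) * (l2 (x k) + l2 (x' k)) ≤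
        ∑ k ∈ F, (2 * (l2 (x k - x' k) * l2 (x k)) + nsq (x k - x' k)) := by
        refine Finset.sum_le_sum fun k _ => ?_
        rw [← l2_sq]
        nlinarith [mul_le_mul_of_nonneg_left (h1 k) (l2_nonneg (x k - x' k))]
    _ = 2 * ∑ k ∈ F, l2 (x k - x' k) * l2 (x k) + ∑ k ∈ F, nsq (x k - x' k) := by
        rw [Finset.sum_add_distrib, ← Finset.mul_sum]
    _ ≤ _ := by linarith

lemma norm_blockTrace_res_cut_sub_le {r : ℝ} (hr : 0 < r) (F : Finset ℕ) (w : ℕ → Fin L → ℂ)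
    (x x' : ℕ → Fin N → ℂ) (B : ℕ) {d e : ℝ} (hd : ∑ k ∈ F, nsq (x k - x' k) ≤ d * (N : ℝ) ^ 2)
    (he : ∑ k ∈ F, nsq (x k) ≤ e * (N : ℝ) ^ 2) (hN : N ≠ 0) (ℓ ℓ' : Fin L) :
    ‖(blockTrace (res r F (fun k => cut B (w k)) x) -
      blockTrace (res r F (fun k => cut B (w k)) x')) ℓ ℓ'‖ ≤
      B / r ^ 2 * (2 * (√d * √e) + d) := by
  refine (norm_blockTrace_res_sub_res_le hr (fun k _ => nsq_cut_le B (w k)) x x' ℓ ℓ').trans ?_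
  have hN' : (0 : ℝ) < N := by positivity
  have h1 : √(∑ k ∈ F, nsq (x k - x' k)) ≤ √d * N := by
    refine (Real.sqrt_le_sqrt hd).trans (le_of_eq ?_)
    rw [Real.sqrt_mul' _ (by positivity), Real.sqrt_sq hN'.le]
  have h2 : √(∑ k ∈ F, nsq (x k)) ≤ √e * N := by
    refine (Real.sqrt_le_sqrt he).trans (le_of_eq ?_)
    rw [Real.sqrt_mul' _ (by positivity), Real.sqrt_sq hN'.le]
  have h3 := mul_le_mul h1 h2 (Real.sqrt_nonneg _) (by positivity)
  have h4 : ∑ k ∈ F, l2 (x k - x' k) * (l2 (x k) + l2 (x' k)) ≤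
      (2 * (√d * √e) + d) * (N : ℝ) ^ 2 := by
    refine (sum_l2_mul_le F x x').trans ?_
    nlinarith
  refine (mul_le_mul_of_nonneg_left h4 (by positivity)).trans (le_of_eq ?_)
  field_simp

/-- The average of `w_i conj(w_j) / (1 + ∑ a_m |w_m|²)`. -/
noncomputable def fracSum (N : ℕ) (F : Finset ℕ) (w : ℕ → Fin L → ℂ) (a : Fin L → ℝ) :
    Matrix (Fin L) (Fin L) ℂ :=
  Matrix.of fun i j => ((1 / (N : ℝ) : ℝ) : ℂ) * ∑ k ∈ F,
    w k i * star (w k j) / ((1 + ∑ m, a m * ‖w k m‖ ^ 2 : ℝ) : ℂ)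

lemma nsq_div_le {a : Fin L → ℝ} (ha : ∀ m, 0 < a m) (v : Fin L → ℂ) :
    nsq v ≤ (∑ m, (a m)⁻¹) * ∑ m, a m * ‖v m‖ ^ 2 := by
  rw [nsq, Finset.mul_sum]
  refine Finset.sum_le_sum fun m _ => ?_
  have h1 : (a m)⁻¹ ≤ ∑ m, (a m)⁻¹ := Finset.single_le_sum (f := fun m => (a m)⁻¹)
    (fun m _ => (inv_pos.2 (ha m)).le) (Finset.mem_univ m)
  calc ‖v m‖ ^ 2 = (a m)⁻¹ * (a m * ‖v m‖ ^ 2) := by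
        rw [inv_mul_cancel_left₀ (ha m).ne']
    _ ≤ _ := mul_le_mul_of_nonneg_right h1 (mul_nonneg (ha m).le (by positivity))

/-- Let q = ∑ a_m |w_m|² and b = ∑ a_m⁻¹, so that |w_i w_j| ≤ b q. A kept user contributes (τ - 1) w
w* / ((1 + τq)(1 + q)), at most |τ - 1| b; a cut user contributes at most b. -/
lemma norm_weightSum_sub_fracSum_le {a : Fin L → ℝ} (ha : ∀ m, 0 < a m) {τ : ℝ} (hτ : 0 ≤ τ)
    (F : Finset ℕ) (w : ℕ → Fin L → ℂ) {B : ℕ} (hB : 1 ≤ B) (i j : Fin L) :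
    ‖(weightSum N τ F (fun k => cut B (w k)) (Matrix.diagonal fun i => (a i : ℂ)) -
      fracSum N F w a) i j‖ ≤ (∑ m, (a m)⁻¹) *
        (|τ - 1| * (F.card / N) + (1 / (N : ℝ)) * ∑ k ∈ F, tailFun B (sqAbs (w k))) := by
  set b := ∑ m, (a m)⁻¹ with hb
  have hb0 : 0 ≤ b := Finset.sum_nonneg fun m _ => (inv_pos.2 (ha m)).le
  have key : ∀ k, ‖((τ / (1 + τ * qf (Matrix.diagonal fun i => (a i : ℂ)) (cut B (w k))) : ℝ) : ℂ) *
      (cut B (w k) i * star (cut B (w k) j)) -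
      w k i * star (w k j) / ((1 + ∑ m, a m * ‖w k m‖ ^ 2 : ℝ) : ℂ)‖ ≤
      b * (|τ - 1| + tailFun B (sqAbs (w k))) := by
    intro k
    rw [qf_diagonal]
    set q := ∑ m, a m * ‖w k m‖ ^ 2 with hq
    have hq0 : 0 ≤ q := Finset.sum_nonneg fun m _ => mul_nonneg (ha m).le (by positivity)
    have hn : ‖w k i * star (w k j)‖ ≤ b * q := by
      rw [norm_mul, norm_star]
      exact (norm_mul_le_nsq _ _ _).trans (nsq_div_le ha _)
    have ht := tailFun_nonneg B (sqAbs (w k))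
    by_cases h : nsq (w k) ≤ B
    · simp only [cut, if_pos h]
      rw [← hq]
      have p1 : 0 < 1 + τ * q := by positivity
      have p2 : 0 < 1 + q := by positivity
      have e : ((τ / (1 + τ * q) : ℝ) : ℂ) * (w k i * star (w k j)) -
          w k i * star (w k j) / ((1 + q : ℝ) : ℂ) =
          (((τ - 1) / ((1 + τ * q) * (1 + q)) : ℝ) : ℂ) * (w k i * star (w k j)) := by
        have e1 : (τ - 1) / ((1 + τ * q) * (1 + q)) = τ / (1 + τ * q) - (1 + q)⁻¹ := by
          field_simp
          ring
        rw [e1]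
        push_cast
        ring
      rw [e, norm_mul, Complex.norm_real, Real.norm_eq_abs, abs_div, abs_of_pos (mul_pos p1 p2)]
      calc |τ - 1| / ((1 + τ * q) * (1 + q)) * ‖w k i * star (w k j)‖ ≤
            |τ - 1| / ((1 + τ * q) * (1 + q)) * (b * q) :=
            mul_le_mul_of_nonneg_left hn (by positivity)
        _ = |τ - 1| * b * (q / ((1 + τ * q) * (1 + q))) := by ring
        _ ≤ |τ - 1| * b * 1 := by
            refine mul_le_mul_of_nonneg_left ((div_le_one (mul_pos p1 p2)).2 ?_) (by positivity)
            nlinarith [mul_nonneg (mul_nonneg hτ hq0) p2.le]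
        _ ≤ b * (|τ - 1| + tailFun B (sqAbs (w k))) := by nlinarith [mul_nonneg hb0 ht]
    · simp only [cut, if_neg h, Pi.zero_apply, zero_mul, mul_zero, zero_sub, norm_neg]
      rw [tailFun_eq_one hB h, norm_div, Complex.norm_real, Real.norm_of_nonneg (by positivity),
        div_le_iff₀ (by positivity)]
      nlinarith [mul_nonneg hb0 (abs_nonneg (τ - 1)),
        mul_nonneg (mul_nonneg hb0 (abs_nonneg (τ - 1))) hq0]
  simp only [weightSum, fracSum, Matrix.sub_apply, Matrix.smul_apply, Matrix.sum_apply,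
    Matrix.of_apply, smul_eq_mul, Matrix.vecMulVec_apply, Pi.star_apply]
  rw [← mul_sub, ← Finset.sum_sub_distrib, norm_mul, Complex.norm_real,
    Real.norm_of_nonneg (by positivity)]
  calc 1 / (N : ℝ) * _ ≤ 1 / (N : ℝ) * ∑ k ∈ F, b * (|τ - 1| + tailFun B (sqAbs (w k))) :=
        mul_le_mul_of_nonneg_left ((norm_sum_le _ _).trans (Finset.sum_le_sum fun k _ => key k))
          (by positivity)
    _ = _ := by
        rw [← Finset.mul_sum, Finset.sum_add_distrib, Finset.sum_const, nsmul_eq_mul]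
        ring

lemma entrySum_le_of_forall {M : Matrix (Fin L) (Fin L) ℂ} {e : ℝ} (h : ∀ i j, ‖M i j‖ ≤ e) :
    entrySum M ≤ (L : ℝ) ^ 2 * e := by
  refine (Finset.sum_le_sum fun i _ => Finset.sum_le_sum fun j _ => h i j).trans (le_of_eq ?_)
  simp
  ring

lemma norm_blockTrace_res_le {r : ℝ} (hr : 0 < r) (F : Finset ℕ) (w : ℕ → Fin L → ℂ)
    (x : ℕ → Fin N → ℂ) (ℓ ℓ' : Fin L) : ‖blockTrace (res r F w x) ℓ ℓ'‖ ≤ 1 / r :=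
  norm_blockTrace_le (by positivity)
    (fun p q => norm_resolvent_apply_le (posSemidef_cov F w x) hr p q) ℓ ℓ'

/-- Cut weights have coordinates bounded by √B. Passing from the full trace to the leave-one-out
trace costs 1/(N r) per entry and user, which is the last summand. -/
lemma norm_weightSum_equation_cut_le (hN : N ≠ 0) {r : ℝ} (hr : 0 < r) {τ : ℝ} (hτ : 0 ≤ τ)
    (F : Finset ℕ) (w : ℕ → Fin L → ℂ) (x : ℕ → Fin N → ℂ) (B : ℕ) (ℓ ℓ' : Fin L) :
    ‖((weightSum N τ F (fun k => cut B (w k)) (blockTrace (res r F (fun k => cut B (w k)) x)) +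
      (r : ℂ) • 1) * blockTrace (res r F (fun k => cut B (w k)) x) - 1) ℓ ℓ'‖ ≤
    (B + (B : ℝ) ^ 2 * (τ * (L ^ 2 * (1 / r)))) * ((1 / (N : ℝ)) *
      ∑ k ∈ F, entrySum (formError r τ (F.erase k) (fun k => cut B (w k)) x (x k)) +
        τ * (F.card / N) * (L ^ 2 * (1 / (N * r)))) := by
  have h := norm_weightSum_equation_le (F := F) (w := fun k => cut B (w k)) (x := x) hN hr hτ
    (Real.sqrt_nonneg (B : ℝ)) (fun k _ i => norm_cut_le B (w k) i) ℓ ℓ'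
  refine h.trans ?_
  have h2 : √(B : ℝ) ^ 2 = B := Real.sq_sqrt (Nat.cast_nonneg B)
  have h4 : √(B : ℝ) ^ 4 = (B : ℝ) ^ 2 := by
    rw [show √(B : ℝ) ^ 4 = (√(B : ℝ) ^ 2) ^ 2 by ring, h2]
  rw [h2, h4]
  have h5 := entrySum_le_of_forall (norm_blockTrace_res_le hr F (fun k => cut B (w k)) x)
  refine mul_le_mul (by gcongr) ?_ ?_ (by positivity)
  · have : ∀ k ∈ F, entrySum (blockForm (res r (F.erase k) (fun k => cut B (w k)) x) (x k) -
        (τ : ℂ) • blockTrace (res r F (fun k => cut B (w k)) x)) ≤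
        entrySum (formError r τ (F.erase k) (fun k => cut B (w k)) x (x k)) +
          τ * (L ^ 2 * (1 / (N * r))) := by
      intro k hk
      have e : blockForm (res r (F.erase k) (fun k => cut B (w k)) x) (x k) -
          (τ : ℂ) • blockTrace (res r F (fun k => cut B (w k)) x) =
          formError r τ (F.erase k) (fun k => cut B (w k)) x (x k) +
          (-(τ : ℂ)) • (blockTrace (res r F (fun k => cut B (w k)) x) -
            blockTrace (res r (F.erase k) (fun k => cut B (w k)) x)) := by
        rw [formError]
        module
      rw [e]
      refine (entrySum_add_le _ _).trans (add_le_add_right ?_ _)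
      have := entrySum_le_of_forall (M := (-(τ : ℂ)) •
        (blockTrace (res r F (fun k => cut B (w k)) x) -
          blockTrace (res r (F.erase k) (fun k => cut B (w k)) x)))
        (e := τ * (1 / (N * r))) (fun i j => by
          rw [Matrix.smul_apply, smul_eq_mul, norm_mul, norm_neg, Complex.norm_real,
            Real.norm_of_nonneg hτ]
          exact mul_le_mul_of_nonneg_left (norm_blockTrace_res_erase_le hr hk i j) hτ)
      linarith
    refine (mul_le_mul_of_nonneg_left (Finset.sum_le_sum this) (by positivity)).trans
      (le_of_eq ?_)
    rw [Finset.sum_add_distrib, Finset.sum_const, nsmul_eq_mul]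
    ring
  · exact mul_nonneg (by positivity) (Finset.sum_nonneg fun _ _ => entrySum_nonneg _)

end Deterministic

/-! ### Convergence along a fixed realization. -/

section Pathwise

/-- The choices are made in the order B, n, N. No uniformity in the auxiliary parameters is needed,
because e depends on neither of them. -/
lemma tendsto_zero_of_iterated_bound {e : ℕ → ℝ} {U : ℕ → ℕ → ℕ → ℝ} {u : ℕ → ℕ → ℝ} {v : ℕ → ℝ}
    (he : ∀ N, 0 ≤ e N) (hU : ∀ n B, ∀ᶠ N in atTop, e N ≤ U n B N)
    (hu : ∀ n B, Tendsto (U n B) atTop (𝓝 (u n B)))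
    (hv : ∀ B, Tendsto (fun n => u n B) atTop (𝓝 (v B))) (h0 : Tendsto v atTop (𝓝 0)) :
    Tendsto e atTop (𝓝 0) := by
  refine tendsto_order.2 ⟨fun x hx => Eventually.of_forall fun N => hx.trans_le (he N),
    fun x hx => ?_⟩
  obtain ⟨B, hB⟩ := (h0.eventually_lt_const hx).exists
  obtain ⟨n, hn⟩ := ((hv B).eventually_lt_const hB).exists
  filter_upwards [hU n B, (hu n B).eventually_lt_const hn] with N h1 h2
  exact h1.trans_lt h2

/-- The rectangle of N rows and K columns is enclosed in the square of side max(N, K), whose ratio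
to N tends to max(1, c). The strong law is available for squares. -/
lemma sum_columns_bound {K : ℕ → ℕ} {c : ℝ} (hK : Tendsto (fun N : ℕ => (K N : ℝ) / N) atTop (𝓝 c))
    {f : ℕ → ℕ → ℝ} (hf : ∀ i j, 0 ≤ f i j) {l : ℝ}
    (h : Tendsto (fun n : ℕ => (∑ i ∈ Finset.range n, ∑ j ∈ Finset.range n, f i j) / (n : ℝ) ^ 2)
      atTop (𝓝 l)) :
    ∃ d : ℕ → ℝ, Tendsto d atTop (𝓝 (max 1 c ^ 2 * l)) ∧ ∀ N : ℕ, N ≠ 0 →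
      ∑ k ∈ Finset.Ico 1 (K N), ∑ i : Fin N, f i k ≤ d N * (N : ℝ) ^ 2 := by
  set M : ℕ → ℕ := fun N => max N (K N) with hM
  have hM1 : Tendsto M atTop atTop := tendsto_atTop_mono (fun N => le_max_left _ _) tendsto_id
  have hM2 : Tendsto (fun N : ℕ => (M N : ℝ) / N) atTop (𝓝 (max 1 c)) := by
    refine (tendsto_const_nhds.max hK).congr' ?_
    filter_upwards [eventually_ne_atTop 0] with N hN
    have hN' : (0 : ℝ) < N := by positivity
    simp only [hM, Nat.cast_max]
    rw [← max_div_div_right hN'.le, div_self hN'.ne']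
  refine ⟨fun N => ((M N : ℝ) / N) ^ 2 * ((∑ i ∈ Finset.range (M N),
    ∑ j ∈ Finset.range (M N), f i j) / (M N : ℝ) ^ 2), (hM2.pow 2).mul (h.comp hM1),
    fun N hN => ?_⟩
  have hN' : (0 : ℝ) < N := by positivity
  have hM' : (0 : ℝ) < M N := hN'.trans_le (by exact_mod_cast le_max_left _ _)
  have e : ((M N : ℝ) / N) ^ 2 * ((∑ i ∈ Finset.range (M N),
      ∑ j ∈ Finset.range (M N), f i j) / (M N : ℝ) ^ 2) * (N : ℝ) ^ 2 =
      ∑ i ∈ Finset.range (M N), ∑ j ∈ Finset.range (M N), f i j := by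
    field_simp
  rw [e, Finset.sum_comm (s := Finset.range (M N))]
  calc ∑ k ∈ Finset.Ico 1 (K N), ∑ i : Fin N, f i k =
        ∑ k ∈ Finset.Ico 1 (K N), ∑ i ∈ Finset.range N, f i k :=
        Finset.sum_congr rfl fun k _ => Fin.sum_univ_eq_sum_range (fun i => f i k) N
    _ ≤ ∑ k ∈ Finset.range (M N), ∑ i ∈ Finset.range N, f i k :=
        Finset.sum_le_sum_of_subset_of_nonneg (fun k hk => Finset.mem_range.2
          ((Finset.mem_Ico.1 hk).2.trans_le (le_max_right _ _)))
          fun k _ _ => Finset.sum_nonneg fun i _ => hf i k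
    _ ≤ ∑ k ∈ Finset.range (M N), ∑ i ∈ Finset.range (M N), f i k :=
        Finset.sum_le_sum fun k _ => Finset.sum_le_sum_of_subset_of_nonneg
          (Finset.range_mono (le_max_left _ _)) fun i _ _ => hf i k

variable {L : ℕ}

lemma norm_blockForm_sub_le_sqrt {N : ℕ} {r : ℝ} (hr : 0 < r) (F : Finset ℕ)
    (w : ℕ → Fin L → ℂ) (x : ℕ → Fin N → ℂ) (u v : Fin N → ℂ) (ℓ ℓ' : Fin L) :
    ‖(blockForm (res r F w x) u - blockForm (res r F w x) v) ℓ ℓ'‖ ≤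
      1 / r * (2 * (√(nsq (u - v) / N) * √(nsq u / N)) + nsq (u - v) / N) := by
  refine (norm_blockForm_sub_le hr F w x u v ℓ ℓ').trans ?_
  have h := sum_l2_mul_le {0} (fun _ => u) (fun _ => v)
  simp only [Finset.sum_singleton] at h
  refine (mul_le_mul_of_nonneg_left h (by positivity)).trans (le_of_eq ?_)
  rw [Real.sqrt_div' _ (Nat.cast_nonneg N), Real.sqrt_div' _ (Nat.cast_nonneg N),
    div_mul_div_comm, Real.mul_self_sqrt (Nat.cast_nonneg N), one_div, one_div, mul_inv]
  ring

/-- The error in the approximation of the quadratic forms by the limit, for fixed truncations of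
the entries and of the weights. -/
lemma norm_blockForm_sub_diagonal_le {N : ℕ} (hN : N ≠ 0) {r : ℝ} (hr : 0 < r) {a : Fin L → ℝ}
    (ha : ∀ m, 0 < a m) {τ : ℝ} (hτ : 0 ≤ τ) (F : Finset ℕ) (w : ℕ → Fin L → ℂ)
    (x x' : ℕ → Fin N → ℂ) (u v : Fin N → ℂ) {B : ℕ} (hB : 1 ≤ B) {d e : ℝ}
    (hd : ∑ k ∈ F, nsq (x k - x' k) ≤ d * (N : ℝ) ^ 2)
    (he : ∑ k ∈ F, nsq (x k) ≤ e * (N : ℝ) ^ 2) (i j : Fin L) :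
    ‖(blockForm (res r F w x) u - Matrix.diagonal fun i => (a i : ℂ)) i j‖ ≤
      1 / r * (2 * (√(nsq (u - v) / N) * √(nsq u / N)) + nsq (u - v) / N) +
      ‖formError r τ F w x v i j‖ + |τ - 1| * (1 / r) +
      1 / r * ((1 / (N : ℝ)) * ∑ k ∈ F, tailFun B (sqAbs (w k))) +
      B / r ^ 2 * (2 * (√d * √e) + d) +
      2 * (L * (((∑ m, (a m)⁻¹) *
        (|τ - 1| * (F.card / N) + (1 / (N : ℝ)) * ∑ k ∈ F, tailFun B (sqAbs (w k))) +
        entrySum (fracSum N F w a + (r : ℂ) • 1 - Matrix.diagonal fun i => ((a i)⁻¹ : ℂ))) +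
        (∑ m, (a m)⁻¹) * ((B + (B : ℝ) ^ 2 * (τ * (L ^ 2 * (1 / r)))) * ((1 / (N : ℝ)) *
          ∑ k ∈ F, entrySum (formError r τ (F.erase k) (fun k => cut B (w k)) x' (x' k)) +
          τ * (F.card / N) * (L ^ 2 * (1 / (N * r)))))) / r) * (a i + a j) := by
  have hb : 0 ≤ ∑ m, (a m)⁻¹ := Finset.sum_nonneg fun m _ => (inv_pos.2 (ha m)).le
  have hT : 0 ≤ (1 / (N : ℝ)) * ∑ k ∈ F, tailFun B (sqAbs (w k)) :=
    mul_nonneg (by positivity) (Finset.sum_nonneg fun k _ => tailFun_nonneg _ _)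
  have hE : 0 ≤ (1 / (N : ℝ)) *
      ∑ k ∈ F, entrySum (formError r τ (F.erase k) (fun k => cut B (w k)) x' (x' k)) :=
    mul_nonneg (by positivity) (Finset.sum_nonneg fun k _ => entrySum_nonneg _)
  have h1 := norm_blockForm_sub_le_sqrt hr F w x u v i j
  have h4 := norm_blockTrace_res_cut_le hr F w x hB i j
  have h5 := norm_blockTrace_res_cut_sub_le hr F w x x' B hd he hN i j
  have h6 := norm_sub_diagonal_le
    (scaledAntitone_weightSum N hτ F (fun k => cut B (w k))) ha
    (posDef_blockTrace hN (posDef_res hr F (fun k => cut B (w k)) x')) hr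
    (η := (∑ m, (a m)⁻¹) *
        (|τ - 1| * (F.card / N) + (1 / (N : ℝ)) * ∑ k ∈ F, tailFun B (sqAbs (w k))) +
        entrySum (fracSum N F w a + (r : ℂ) • 1 - Matrix.diagonal fun i => ((a i)⁻¹ : ℂ)))
    (η' := (B + (B : ℝ) ^ 2 * (τ * (L ^ 2 * (1 / r)))) * ((1 / (N : ℝ)) *
          ∑ k ∈ F, entrySum (formError r τ (F.erase k) (fun k => cut B (w k)) x' (x' k)) +
          τ * (F.card / N) * (L ^ 2 * (1 / (N * r)))))
    (b := ∑ m, (a m)⁻¹)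
    (add_nonneg (mul_nonneg hb (add_nonneg (by positivity) hT)) (entrySum_nonneg _))
    (mul_nonneg (by positivity) (add_nonneg hE (by positivity)))
    (fun i => Finset.single_le_sum (f := fun m => (a m)⁻¹)
      (fun m _ => (inv_pos.2 (ha m)).le) (Finset.mem_univ i))
    (fun i j => by
      have e : weightSum N τ F (fun k => cut B (w k)) (Matrix.diagonal fun i => (a i : ℂ)) +
          (r : ℂ) • 1 - Matrix.diagonal (fun i => ((a i)⁻¹ : ℂ)) =
          (weightSum N τ F (fun k => cut B (w k)) (Matrix.diagonal fun i => (a i : ℂ)) -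
            fracSum N F w a) +
          (fracSum N F w a + (r : ℂ) • 1 - Matrix.diagonal fun i => ((a i)⁻¹ : ℂ)) := by abel
      rw [e, Matrix.add_apply]
      exact (norm_add_le _ _).trans (add_le_add
        (norm_weightSum_sub_fracSum_le ha hτ F w hB i j) (norm_le_entrySum _ i j)))
    (norm_weightSum_equation_cut_le hN hr hτ F w x' B) i j
  rw [Fintype.card_fin] at h6
  have h3 : ‖(((τ - 1 : ℝ) : ℂ) • blockTrace (res r F w x)) i j‖ ≤ |τ - 1| * (1 / r) := by
    rw [Matrix.smul_apply, smul_eq_mul, norm_mul, Complex.norm_real, Real.norm_eq_abs]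
    exact mul_le_mul_of_nonneg_left (norm_blockTrace_res_le hr F w x i j) (abs_nonneg _)
  -- The chain of replacements: truncate the tested column, pass from forms to traces with factor τ,
  -- replace τ by 1, cut the weights, truncate the remaining columns, and apply stability of the
  -- fixed point equation.
  have e : blockForm (res r F w x) u - Matrix.diagonal (fun i => (a i : ℂ)) =
      (blockForm (res r F w x) u - blockForm (res r F w x) v) + formError r τ F w x v +
      ((τ - 1 : ℝ) : ℂ) • blockTrace (res r F w x) +
      (blockTrace (res r F w x) - blockTrace (res r F (fun k => cut B (w k)) x)) +
      (blockTrace (res r F (fun k => cut B (w k)) x) -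
        blockTrace (res r F (fun k => cut B (w k)) x')) +
      (blockTrace (res r F (fun k => cut B (w k)) x') -
        Matrix.diagonal (fun i => (a i : ℂ))) := by
    rw [formError]
    push_cast
    module
  rw [e]
  simp only [Matrix.add_apply]
  exact norm_add_le_of_le (norm_add_le_of_le (norm_add_le_of_le (norm_add_le_of_le
    (norm_add_le_of_le h1 le_rfl) h3) h4) h5) h6

/-- Convergence of the quadratic forms of the resolvent along a fixed realization. -/
theorem tendsto_blockForm {K : ℕ → ℕ} {c r : ℝ} (hc : 0 < c) (hr : 0 < r)
    (hK : Tendsto (fun N : ℕ => (K N : ℝ) / N) atTop (𝓝 c)) {a : Fin L → ℝ} (ha : ∀ m, 0 < a m)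
    {s : ℕ → ℕ → ℂ} {g : ℕ → ℂ → ℂ} {τ δ κ : ℕ → ℝ} (w : ℕ → ℕ → Fin L → ℂ)
    (hτ0 : ∀ n, 0 ≤ τ n) (hτ : Tendsto τ atTop (𝓝 1)) (hδ : Tendsto δ atTop (𝓝 0))
    (hκ : Tendsto κ atTop (𝓝 0))
    (hcol : Tendsto (fun N : ℕ => (∑ i ∈ Finset.range N, ‖s i 0‖ ^ 2) / N) atTop (𝓝 1))
    (hcol' : ∀ n, Tendsto (fun N : ℕ => (∑ i ∈ Finset.range N, ‖s i 0 - g n (s i 0)‖ ^ 2) / N)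
      atTop (𝓝 (δ n)))
    (hsq : Tendsto (fun N : ℕ => (∑ i ∈ Finset.range N, ∑ j ∈ Finset.range N, ‖s i j‖ ^ 2) /
      (N : ℝ) ^ 2) atTop (𝓝 1))
    (hsq' : ∀ n, Tendsto (fun N : ℕ => (∑ i ∈ Finset.range N, ∑ j ∈ Finset.range N,
      ‖s i j - g n (s i j)‖ ^ 2) / (N : ℝ) ^ 2) atTop (𝓝 (δ n)))
    (htail : ∀ B, Tendsto (fun N : ℕ => (1 / (N : ℝ)) *
      ∑ k ∈ Finset.Ico 1 (K N), tailFun B (sqAbs (w N k))) atTop (𝓝 (κ B)))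
    (hfrac : Tendsto (fun N : ℕ => entrySum (fracSum N (Finset.Ico 1 (K N)) (w N) a +
      (r : ℂ) • 1 - Matrix.diagonal fun i => ((a i)⁻¹ : ℂ))) atTop (𝓝 0))
    (hform : ∀ n B : ℕ, Tendsto (fun N : ℕ => (1 / (N : ℝ)) * ∑ k ∈ Finset.Ico 1 (K N),
      entrySum (formError r (τ n) ((Finset.Ico 1 (K N)).erase k) (fun k => cut B (w N k))
        (cols (g n) s N) (cols (g n) s N k))) atTop (𝓝 0))
    (hform₀ : ∀ n i j, Tendsto (fun N : ℕ => formError r (τ n) (Finset.Ico 1 (K N)) (w N)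
      (cols id s N) (cols (g n) s N 0) i j) atTop (𝓝 0)) :
    Tendsto (fun N : ℕ => entrySum (blockForm (res r (Finset.Ico 1 (K N)) (w N) (cols id s N))
      (cols id s N 0) - Matrix.diagonal fun i => (a i : ℂ))) atTop (𝓝 0) := by
  obtain ⟨e, he, he'⟩ := sum_columns_bound hK (fun i j => sq_nonneg ‖s i j‖) hsq
  choose d hd hd' using fun n =>
    sum_columns_bound hK (fun i j => sq_nonneg ‖s i j - g n (s i j)‖) (hsq' n)
  have hcard : Tendsto (fun N : ℕ => ((Finset.Ico 1 (K N)).card : ℝ) / N) atTop (𝓝 c) := by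
    simpa only [Nat.card_Ico] using (tendsto_users_div hK hc).2
  have hinv : Tendsto (fun N : ℕ => 1 / ((N : ℝ) * r)) atTop (𝓝 0) := by
    simpa [one_div, mul_inv] using (tendsto_inv_atTop_nhds_zero_nat (𝕜 := ℝ)).const_mul r⁻¹
  suffices H : ∀ i j, Tendsto (fun N : ℕ =>
      ‖(blockForm (res r (Finset.Ico 1 (K N)) (w N) (cols id s N)) (cols id s N 0) -
        Matrix.diagonal fun i => (a i : ℂ)) i j‖) atTop (𝓝 0) by
    have := tendsto_finsetSum Finset.univ fun i (_ : i ∈ Finset.univ) =>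
      tendsto_finsetSum Finset.univ fun j (_ : j ∈ Finset.univ) => H i j
    simpa [entrySum] using this
  intro i j
  have h1 : ∀ n, Tendsto (fun N : ℕ => nsq (cols id s N 0 - cols (g n) s N 0) / (N : ℝ)) atTop
      (𝓝 (δ n)) := fun n => (hcol' n).congr fun N => by
    rw [nsq, ← Fin.sum_univ_eq_sum_range (fun i => ‖s i 0 - g n (s i 0)‖ ^ 2) N]
    rfl
  have h2 : Tendsto (fun N : ℕ => nsq (cols id s N 0) / (N : ℝ)) atTop (𝓝 1) :=
    hcol.congr fun N => by
      rw [nsq, ← Fin.sum_univ_eq_sum_range (fun i => ‖s i 0‖ ^ 2) N]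
      rfl
  -- The weights are cut at level B + 1, because the bound requires a level of at least 1.
  have hb := fun n B : ℕ => (eventually_ne_atTop 0).mono fun N (hN : N ≠ 0) =>
    norm_blockForm_sub_diagonal_le hN hr ha (hτ0 n) (Finset.Ico 1 (K N)) (w N)
      (cols id s N) (cols (g n) s N) (cols id s N 0) (cols (g n) s N 0)
      (Nat.le_add_left 1 B) (hd' n N hN) (he' N hN) i j
  -- The intermediate limits are left open and filled in by the first two goals below. The limit in
  -- n precedes the one in B: the term with factor (B + 1)/r² vanishes only as the truncation error
  -- tends to 0 with B fixed. After it only the tails κ remain.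
  refine tendsto_zero_of_iterated_bound (u := ?u) (v := ?v) (fun N => norm_nonneg _) hb
    (fun n B => ?_) (fun B => ?_) ?_
  rotate_left 2
  · refine Tendsto.add (Tendsto.add (Tendsto.add (Tendsto.add (Tendsto.add
      (Tendsto.const_mul (1 / r) (Tendsto.add (Tendsto.const_mul 2
        (Tendsto.mul (h1 n).sqrt h2.sqrt)) (h1 n))) (hform₀ n i j).norm)
      (tendsto_const_nhds (x := |τ n - 1| * (1 / r)))) ((htail (B + 1)).const_mul (1 / r)))
      (Tendsto.const_mul (((B + 1 : ℕ) : ℝ) / r ^ 2) (Tendsto.add (Tendsto.const_mul 2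
        (Tendsto.mul (hd n).sqrt he.sqrt)) (hd n)))) (Tendsto.mul_const (a i + a j)
      (Tendsto.const_mul 2 (Tendsto.div_const (Tendsto.const_mul (L : ℝ) (Tendsto.add
        (Tendsto.add (Tendsto.const_mul (∑ m, (a m)⁻¹) (Tendsto.add
          (hcard.const_mul |τ n - 1|) (htail (B + 1)))) hfrac)
        (Tendsto.const_mul (∑ m, (a m)⁻¹) (Tendsto.const_mul
          (((B + 1 : ℕ) : ℝ) + ((B + 1 : ℕ) : ℝ) ^ 2 * (τ n * (L ^ 2 * (1 / r))))
          (Tendsto.add (hform n (B + 1)) (Tendsto.mul (hcard.const_mul (τ n))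
            (hinv.const_mul ((L : ℝ) ^ 2)))))))) r)))
  · have ht1 : Tendsto (fun n => |τ n - 1|) atTop (𝓝 0) := by
      simpa using (hτ.sub_const 1).abs
    refine Tendsto.add (Tendsto.add (Tendsto.add (Tendsto.add (Tendsto.add
      (Tendsto.const_mul (1 / r) (Tendsto.add (Tendsto.const_mul 2
        (Tendsto.mul hδ.sqrt tendsto_const_nhds)) hδ)) tendsto_const_nhds)
      (ht1.mul_const (1 / r))) tendsto_const_nhds)
      (Tendsto.const_mul (((B + 1 : ℕ) : ℝ) / r ^ 2) (Tendsto.add (Tendsto.const_mul 2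
        (Tendsto.mul (hδ.const_mul (max 1 c ^ 2)).sqrt tendsto_const_nhds))
        (hδ.const_mul (max 1 c ^ 2))))) (Tendsto.mul_const (a i + a j)
      (Tendsto.const_mul 2 (Tendsto.div_const (Tendsto.const_mul (L : ℝ) (Tendsto.add
        (Tendsto.add (Tendsto.const_mul (∑ m, (a m)⁻¹) (Tendsto.add
          (ht1.mul_const c) tendsto_const_nhds)) tendsto_const_nhds)
        (Tendsto.const_mul (∑ m, (a m)⁻¹) (Tendsto.mul
          (Tendsto.const_add ((B + 1 : ℕ) : ℝ) (Tendsto.const_mul (((B + 1 : ℕ) : ℝ) ^ 2)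
            (hτ.mul_const (L ^ 2 * (1 / r)))))
          (Tendsto.const_add 0 (Tendsto.mul_const ((L : ℝ) ^ 2 * 0) (hτ.mul_const c)))))))
            r)))
  · have hκ' := (tendsto_add_atTop_iff_nat 1).2 hκ
    have := ((hκ'.const_mul (1 / r)).add ((((hκ'.const_mul (∑ m, (a m)⁻¹)).const_mul
      (L : ℝ)).div_const r).const_mul 2 |>.mul_const (a i + a j)))
    simpa using this

end Pathwise

/-! ### From the signal-to-interference ratio to block forms. -/

section Gains

variable {L : ℕ}

/-- The weights `√T γ(ℓ)`. -/
noncomputable def gain (T : ℝ) (γ : Fin L → ℂ) : Fin L → ℂ := fun ℓ => (Real.sqrt T : ℂ) * γ ℓ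

lemma beta_eq_tens {N : ℕ} (T : ℝ) (γ : Fin L → ℂ) (v : Fin N → ℂ) :
    beta T γ v = tens (gain T γ) v := by
  ext p
  simp only [beta, tens, gain, mul_assoc]

lemma interference_eq_cov (N K : ℕ) (s : ℕ → ℕ → ℂ) (T : ℕ → ℝ) (γ : ℕ → Fin L → ℂ) :
    interference N K s T γ =
      cov (Finset.Ico 1 K) (fun k => gain (T k) (γ k)) (cols id s N) := by
  have : (1 / (N : ℂ)) = ((1 / (N : ℝ) : ℝ) : ℂ) := by push_cast; rfl
  rw [interference, cov, this]
  simp only [beta_eq_tens]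
  rfl

/-- Separates the gains of user 0 from a matrix of fixed size L, so no assumption on the behaviour
of these gains is needed for the convergence of the matrix. -/
lemma SIR_eq (N K : ℕ) (σ : ℝ) (s : ℕ → ℕ → ℂ) (T : ℕ → ℝ) (γ : ℕ → Fin L → ℂ) :
    SIR N K σ s T γ = star (gain (T 0) (γ 0)) ⬝ᵥ
      blockForm (res (σ ^ 2) (Finset.Ico 1 K) (fun k => gain (T k) (γ k)) (cols id s N))
        (cols id s N 0) *ᵥ gain (T 0) (γ 0) := by
  rw [dotProduct_blockForm, SIR, interference_eq_cov, beta_eq_tens, res, Complex.ofReal_pow]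
  rfl

lemma ofReal_sqrt_mul_self {T : ℝ} (hT : 0 ≤ T) : (Real.sqrt T : ℂ) * Real.sqrt T = T := by
  rw [← Complex.ofReal_mul, Real.mul_self_sqrt hT]

lemma star_gain_mul {T : ℝ} (hT : 0 ≤ T) (γ : Fin L → ℂ) (i j : Fin L) :
    star (gain T γ i) * gain T γ j = T * (star (γ i) * γ j) := by
  rw [← ofReal_sqrt_mul_self hT]
  simp only [gain, star_mul', Complex.star_def, Complex.conj_ofReal]
  ring

lemma gain_mul_star {T : ℝ} (hT : 0 ≤ T) (γ : Fin L → ℂ) (i j : Fin L) :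
    gain T γ i * star (gain T γ j) = T * γ i * star (γ j) := by
  rw [mul_comm, star_gain_mul hT]
  ring

lemma norm_gain_sq {T : ℝ} (hT : 0 ≤ T) (γ : Fin L → ℂ) (i : Fin L) :
    ‖gain T γ i‖ ^ 2 = T * ‖γ i‖ ^ 2 := by
  rw [gain, norm_mul, mul_pow, Complex.norm_real, Real.norm_of_nonneg (Real.sqrt_nonneg T),
    Real.sq_sqrt hT]

lemma limitSIR_eq (A : Matrix (Fin L) (Fin L) ℂ) {T : ℝ} (hT : 0 ≤ T) (γ : Fin L → ℂ) :
    limitSIR A T γ = star (gain T γ) ⬝ᵥ A *ᵥ gain T γ := by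
  simp only [limitSIR, dotProduct, Matrix.mulVec, Finset.mul_sum, Pi.star_apply]
  refine Finset.sum_congr rfl fun i _ => Finset.sum_congr rfl fun j _ => ?_
  rw [mul_left_comm, mul_comm (A i j), ← mul_assoc, ← mul_assoc, star_gain_mul hT]
  ring

lemma norm_form_le (M : Matrix (Fin L) (Fin L) ℂ) (v : Fin L → ℂ) :
    ‖star v ⬝ᵥ M *ᵥ v‖ ≤ nsq v * entrySum M := by
  simp only [dotProduct, Matrix.mulVec, Finset.mul_sum, Pi.star_apply, entrySum]
  refine (norm_sum_le _ _).trans (Finset.sum_le_sum fun i _ => (norm_sum_le _ _).trans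
    (Finset.sum_le_sum fun j _ => ?_))
  rw [norm_mul, norm_mul, norm_star]
  nlinarith [mul_le_mul_of_nonneg_left (norm_mul_le_nsq v i j) (norm_nonneg (M i j))]

lemma norm_SIR_sub_limitSIR_le (N K : ℕ) (σ : ℝ) (s : ℕ → ℕ → ℂ) (T : ℕ → ℝ)
    (γ : ℕ → Fin L → ℂ) (A : Matrix (Fin L) (Fin L) ℂ) (hT : 0 ≤ T 0) :
    ‖SIR N K σ s T γ - limitSIR A (T 0) (γ 0)‖ ≤ (T 0 * ∑ ℓ, ‖γ 0 ℓ‖ ^ 2) *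
      entrySum (blockForm (res (σ ^ 2) (Finset.Ico 1 K) (fun k => gain (T k) (γ k))
        (cols id s N)) (cols id s N 0) - A) := by
  have h : nsq (gain (T 0) (γ 0)) = T 0 * ∑ ℓ, ‖γ 0 ℓ‖ ^ 2 := by
    rw [nsq, Finset.mul_sum]
    exact Finset.sum_congr rfl fun i _ => norm_gain_sq hT _ i
  rw [SIR_eq, limitSIR_eq A hT, ← dotProduct_sub, ← Matrix.sub_mulVec, ← h]
  exact norm_form_le _ _

lemma continuous_limitSIR (A : Matrix (Fin L) (Fin L) ℂ) :
    Continuous fun p : ℝ × (Fin L → ℂ) => limitSIR A p.1 p.2 := by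
  unfold limitSIR
  fun_prop

lemma measurable_gain : Measurable fun p : ℝ × (Fin L → ℂ) => gain p.1 p.2 := by
  have : Continuous fun p : ℝ × (Fin L → ℂ) => gain p.1 p.2 := by
    unfold gain
    fun_prop
  exact this.measurable

lemma measurable_cut (B : ℕ) : Measurable (cut B : (Fin L → ℂ) → Fin L → ℂ) := by
  have : Measurable fun v : Fin L → ℂ => nsq v := by
    have : Continuous fun v : Fin L → ℂ => nsq v := by
      unfold nsq
      fun_prop
    exact this.measurable
  exact Measurable.ite (measurableSet_le this measurable_const) measurable_id measurable_const

/-- The averages in the fixed point equation converge to the values given by `G`. -/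
lemma tendsto_fracSum {K : ℕ → ℕ} {c σ : ℝ} (hc : 0 < c)
    (hK : Tendsto (fun N : ℕ => (K N : ℝ) / N) atTop (𝓝 c)) {T : ℕ → ℕ → ℝ}
    {γ : ℕ → ℕ → Fin L → ℂ} (hT : ∀ N, ∀ k < K N, 0 ≤ T N k)
    {G : ProbabilityMeasure (Fin L → ℝ)} (hG0 : ∀ᵐ δ ∂(G : Measure (Fin L → ℝ)), ∀ m, 0 ≤ δ m)
    (hG : Tendsto (fun N => empirical (K N) (fun k => fun ℓ : Fin L => T N k * ‖γ N k ℓ‖ ^ 2))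
      atTop (𝓝 G.toFiniteMeasure)) {a : Fin L → ℝ} (ha : ∀ m, 0 < a m) (hA : SolvesDiag c σ G a)
    (hcross : ∀ i j, i ≠ j →
      Tendsto (fun N => crossAverage (K N) (T N) (γ N) a i j) atTop (𝓝 0)) :
    Tendsto (fun N : ℕ => entrySum (fracSum N (Finset.Ico 1 (K N))
      (fun k => gain (T N k) (γ N k)) a + ((σ ^ 2 : ℝ) : ℂ) • 1 -
        Matrix.diagonal fun i => ((a i)⁻¹ : ℂ))) atTop (𝓝 0) := by
  suffices H : ∀ i j, Tendsto (fun N : ℕ => (fracSum N (Finset.Ico 1 (K N))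
      (fun k => gain (T N k) (γ N k)) a + ((σ ^ 2 : ℝ) : ℂ) • 1 -
        Matrix.diagonal fun i => ((a i)⁻¹ : ℂ)) i j) atTop (𝓝 0) by
    have := tendsto_finsetSum Finset.univ fun i (_ : i ∈ Finset.univ) =>
      tendsto_finsetSum Finset.univ fun j (_ : j ∈ Finset.univ) => (H i j).norm
    simpa [entrySum] using this
  have hsum : ∀ N i j, fracSum N (Finset.Ico 1 (K N)) (fun k => gain (T N k) (γ N k)) a i j =
      ((1 / (N : ℝ) : ℝ) : ℂ) * ∑ k ∈ Finset.Ico 1 (K N), (T N k : ℂ) * γ N k i *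
        star (γ N k j) / ((1 + ∑ m, a m * (T N k * ‖γ N k m‖ ^ 2) : ℝ) : ℂ) := by
    intro N i j
    simp only [fracSum, Matrix.of_apply]
    congr 1
    refine Finset.sum_congr rfl fun k hk => ?_
    have h0 := hT N k (Finset.mem_Ico.1 hk).2
    simp only [gain_mul_star h0, norm_gain_sq h0]
  intro i j
  simp only [Matrix.sub_apply, Matrix.add_apply, Matrix.smul_apply, smul_eq_mul]
  by_cases hij : i = j
  · subst hij
    -- On the diagonal, weak convergence gives c E[δ_i / (1 + ∑ a_m δ_m)], and the fixed point
    -- equation says that adding σ² yields exactly 1/a_i.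
    have h1 := tendsto_average_of_empirical hc hK hG (fracFun ha i)
    have h2 : ∫ δ, fracFun ha i δ ∂(G : Measure (Fin L → ℝ)) =
        ∫ δ, δ i / (1 + ∑ m, a m * δ m) ∂(G : Measure (Fin L → ℝ)) :=
      integral_congr_ae (hG0.mono fun δ hδ => fracFun_apply ha i hδ)
    have h3 : (a i)⁻¹ = c * ∫ δ, δ i / (1 + ∑ m, a m * δ m) ∂(G : Measure (Fin L → ℝ)) + σ ^ 2 := by
      rw [hA i, one_div, inv_inv]
    rw [h2] at h1
    have h4 := (Complex.continuous_ofReal.tendsto _).comp ((h1.add_const (σ ^ 2)).sub_const (a i)⁻¹)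
    rw [← h3, sub_self, Complex.ofReal_zero] at h4
    refine h4.congr fun N => ?_
    rw [hsum, Matrix.one_apply_eq, Matrix.diagonal_apply_eq]
    simp only [Function.comp]
    rw [Complex.ofReal_sub, Complex.ofReal_add, Complex.ofReal_mul, Complex.ofReal_sum, mul_one,
      Complex.ofReal_inv]
    congr 3
    refine Finset.sum_congr rfl fun k hk => ?_
    rw [fracFun_apply ha i fun m => mul_nonneg (hT N k (Finset.mem_Ico.1 hk).2) (by positivity),
      Complex.ofReal_div, mul_assoc, Complex.star_def, Complex.mul_conj, Complex.normSq_eq_norm_sq,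
      Complex.ofReal_mul]
  -- Off the diagonal the entry is the cross average times (K - 1)/N, a factor that converges.
  · have h1 := (Complex.continuous_ofReal.tendsto _).comp (tendsto_users_div hK hc).2
    have h2 := h1.mul (hcross i j hij)
    rw [mul_zero] at h2
    refine h2.congr' ?_
    filter_upwards [(tendsto_users_div hK hc).1] with N hN
    rw [hsum, Matrix.one_apply_ne hij, Matrix.diagonal_apply_ne _ hij, mul_zero, add_zero, sub_zero]
    simp only [Function.comp, crossAverage]
    by_cases h0 : K N = 1
    · simp [h0]
    · have h5 : (K N : ℂ) - 1 ≠ 0 := by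
        rw [sub_ne_zero]
        exact_mod_cast h0
      rw [← mul_assoc]
      congr 1
      rw [Nat.cast_sub hN]
      push_cast
      field_simp

end Gains

/-! ### Almost sure vanishing of the form errors. -/

section AlmostSure

/-- From t ≤ θ + t⁴/θ³ with θ = 1/(B + 1): first N → ∞, then θ → 0. -/
lemma tendsto_average_of_fourth_power {L : ℕ} {K : ℕ → ℕ} {c : ℝ}
    (hK : Tendsto (fun N : ℕ => (K N : ℝ) / N) atTop (𝓝 c))
    {E : ℕ → ℕ → Matrix (Fin L) (Fin L) ℂ}
    (h : Tendsto (fun N : ℕ => (1 / (N : ℝ)) * ∑ k ∈ Finset.Ico 1 (K N), ∑ i, ∑ j,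
      ‖E N k i j‖ ^ 4) atTop (𝓝 0)) :
    Tendsto (fun N : ℕ => (1 / (N : ℝ)) * ∑ k ∈ Finset.Ico 1 (K N), entrySum (E N k))
      atTop (𝓝 0) := by
  have key : ∀ t θ : ℝ, 0 < θ → 0 ≤ t → t ≤ θ + t ^ 4 / θ ^ 3 := by
    intro t θ hθ ht
    rcases le_total t θ with h | h
    · exact h.trans (le_add_of_nonneg_right (by positivity))
    · have : t ≤ t ^ 4 / θ ^ 3 := by
        rw [le_div_iff₀ (by positivity)]
        have := mul_le_mul_of_nonneg_left (pow_le_pow_left₀ hθ.le h 3) ht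
        nlinarith
      linarith
  refine tendsto_zero_of_iterated_bound (u := fun _ B => (1 / ((B : ℝ) + 1)) * (L ^ 2 * c) + 0)
    (v := fun B => (1 / ((B : ℝ) + 1)) * (L ^ 2 * c) + 0)
    (U := fun _ B N => (1 / ((B : ℝ) + 1)) * (L ^ 2 * ((K N : ℝ) / N)) +
      ((1 / (N : ℝ)) * ∑ k ∈ Finset.Ico 1 (K N), ∑ i, ∑ j, ‖E N k i j‖ ^ 4) /
        (1 / ((B : ℝ) + 1)) ^ 3)
    (fun N => mul_nonneg (by positivity) (Finset.sum_nonneg fun k _ => entrySum_nonneg _))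
    (fun n B => Eventually.of_forall fun N => ?_) (fun n B => ?_) (fun B => tendsto_const_nhds) ?_
  · set θ : ℝ := 1 / ((B : ℝ) + 1) with hθ
    have hθ0 : 0 < θ := by positivity
    have h1 : ∀ k, entrySum (E N k) ≤ (L : ℝ) ^ 2 * θ + (∑ i, ∑ j, ‖E N k i j‖ ^ 4) / θ ^ 3 := by
      intro k
      calc entrySum (E N k) ≤ ∑ i, ∑ j, (θ + ‖E N k i j‖ ^ 4 / θ ^ 3) :=
            Finset.sum_le_sum fun i _ => Finset.sum_le_sum fun j _ => key _ _ hθ0 (norm_nonneg _)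
        _ = _ := by
            simp only [Finset.sum_add_distrib, Finset.sum_div]
            simp
            ring
    have hc : ((Finset.Ico 1 (K N)).card : ℝ) ≤ K N := by
      rw [Nat.card_Ico]
      exact_mod_cast Nat.sub_le _ _
    calc (1 / (N : ℝ)) * ∑ k ∈ Finset.Ico 1 (K N), entrySum (E N k) ≤
          (1 / (N : ℝ)) * ∑ k ∈ Finset.Ico 1 (K N),
            ((L : ℝ) ^ 2 * θ + (∑ i, ∑ j, ‖E N k i j‖ ^ 4) / θ ^ 3) :=
          mul_le_mul_of_nonneg_left (Finset.sum_le_sum fun k _ => h1 k) (by positivity)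
      _ = (1 / (N : ℝ)) * ((Finset.Ico 1 (K N)).card * ((L : ℝ) ^ 2 * θ)) +
          ((1 / (N : ℝ)) * ∑ k ∈ Finset.Ico 1 (K N), ∑ i, ∑ j, ‖E N k i j‖ ^ 4) / θ ^ 3 := by
          rw [Finset.sum_add_distrib, Finset.sum_const, nsmul_eq_mul, ← Finset.sum_div]
          ring
      _ ≤ (1 / (N : ℝ)) * (K N * ((L : ℝ) ^ 2 * θ)) +
          ((1 / (N : ℝ)) * ∑ k ∈ Finset.Ico 1 (K N), ∑ i, ∑ j, ‖E N k i j‖ ^ 4) / θ ^ 3 := by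
          gcongr
      _ = _ := by ring
  · have := (hK.const_mul ((L : ℝ) ^ 2)).const_mul (1 / ((B : ℝ) + 1))
    refine this.add ?_
    have h0 := h.div_const ((1 / ((B : ℝ) + 1)) ^ 3)
    rwa [zero_div] at h0
  · simpa using (tendsto_one_div_add_atTop_nhds_zero_nat (𝕜 := ℝ)).mul_const ((L : ℝ) ^ 2 * c)

variable {Ω : Type*} [MeasurableSpace Ω] {P : Measure Ω} [IsProbabilityMeasure P]
  {L : ℕ} {K : ℕ → ℕ} {c r : ℝ} {s : ℕ → ℕ → Ω → ℂ} {T : ℕ → ℕ → Ω → ℝ}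
  {γ : ℕ → ℕ → Ω → Fin L → ℂ}

/-- Each user has a fourth moment of order 1/N², and so has their average because K/N is bounded.
Averaging suffices, so no maximum over the users has to be controlled. -/
lemma ae_tendsto_average_formError (hr : 0 < r)
    (hK : Tendsto (fun N : ℕ => (K N : ℝ) / N) atTop (𝓝 c))
    (hs_meas : ∀ i j, Measurable (s i j)) (hs_indep : iIndepFun (fun p : ℕ × ℕ => s p.1 p.2) P)
    {g h : ℂ → ℂ} {b τ : ℝ} (hg : Measurable g) (hh : Measurable h) (hb : ∀ z, ‖g z‖ ≤ b)
    (hmean : ∀ i j, ∫ ω, g (s i j ω) ∂P = 0) (hvar : ∀ i j, ∫ ω, ‖g (s i j ω)‖ ^ 2 ∂P = τ)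
    (hT : ∀ N, ∀ k < K N, Measurable (T N k)) (hγ : ∀ N, ∀ k < K N, Measurable (γ N k))
    (hind : ∀ N, IndepFun (fun ω => fun k : Fin (K N) => (T N k ω, γ N k ω))
      (fun ω => fun (i : Fin N) (k : Fin (K N)) => s i k ω) P)
    {φ : ℝ × (Fin L → ℂ) → Fin L → ℂ} (hφ : Measurable φ) :
    ∀ᵐ ω ∂P, Tendsto (fun N : ℕ => (1 / (N : ℝ)) * ∑ k ∈ Finset.Ico 1 (K N),
      entrySum (formError r τ ((Finset.Ico 1 (K N)).erase k) (fun k => φ (T N k ω, γ N k ω))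
        (cols h (fun i j => s i j ω) N) (cols g (fun i j => s i j ω) N k))) atTop (𝓝 0) := by
  have key := ae_tendsto_zero_of_lintegral_le (P := P) (V := fun N ω => ENNReal.ofReal (1 / N) *
    ∑ k ∈ Finset.Ico 1 (K N), ∑ i : Fin L, ∑ j : Fin L, ENNReal.ofReal (‖formError r τ
      ((Finset.Ico 1 (K N)).erase k) (fun k => φ (T N k ω, γ N k ω))
        (cols h (fun i j => s i j ω) N) (cols g (fun i j => s i j ω) N k) i j‖ ^ 4))
    ((c + 1) * (L ^ 2 * momentConst r b)) ?_
  · filter_upwards [key] with ω hω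
    refine tendsto_average_of_fourth_power hK (E := fun N k => formError r τ
      ((Finset.Ico 1 (K N)).erase k) (fun k => φ (T N k ω, γ N k ω))
        (cols h (fun i j => s i j ω) N) (cols g (fun i j => s i j ω) N k)) ?_
    have h1 := (ENNReal.tendsto_toReal ENNReal.zero_ne_top).comp hω
    rw [ENNReal.toReal_zero] at h1
    refine h1.congr fun N => ?_
    have e : ∀ N : ℕ, ∀ f : ℕ → Fin L → Fin L → ℝ, (∀ k i j, 0 ≤ f k i j) →
        (ENNReal.ofReal (1 / N) * ∑ k ∈ Finset.Ico 1 (K N), ∑ i : Fin L, ∑ j : Fin L,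
          ENNReal.ofReal (f k i j)).toReal =
        (1 / N) * ∑ k ∈ Finset.Ico 1 (K N), ∑ i : Fin L, ∑ j : Fin L, f k i j := by
      intro N f hf
      have e1 : ∀ k, ∑ i : Fin L, ∑ j : Fin L, ENNReal.ofReal (f k i j) =
          ENNReal.ofReal (∑ i : Fin L, ∑ j : Fin L, f k i j) := fun k => by
        rw [ENNReal.ofReal_sum_of_nonneg fun i _ => Finset.sum_nonneg fun j _ => hf k i j]
        exact Finset.sum_congr rfl fun i _ =>
          (ENNReal.ofReal_sum_of_nonneg fun j _ => hf k i j).symm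
      have p : ∀ k, 0 ≤ ∑ i : Fin L, ∑ j : Fin L, f k i j := fun k =>
        Finset.sum_nonneg fun i _ => Finset.sum_nonneg fun j _ => hf k i j
      simp only [e1]
      rw [← ENNReal.ofReal_sum_of_nonneg fun k _ => p k, ← ENNReal.ofReal_mul (by positivity),
        ENNReal.toReal_ofReal (mul_nonneg (by positivity) (Finset.sum_nonneg fun k _ => p k))]
    exact e N _ fun _ _ _ => by positivity
  · filter_upwards [eventually_ne_atTop 0, hK.eventually_le_const (lt_add_one c)] with N hN hKN
    have hN' : (0 : ℝ) < N := by positivity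
    have hb' := fun k (hk : k ∈ Finset.Ico 1 (K N)) i j =>
      lintegral_formError_random_le hN hr hs_meas hs_indep hg hh hb hmean hvar (hT N) (hγ N)
        (hind N) hφ (F := (Finset.Ico 1 (K N)).erase k)
        (fun j hj => (Finset.mem_Ico.1 (Finset.mem_of_mem_erase hj)).2)
        (Finset.mem_Ico.1 hk).2 (Finset.notMem_erase k _) i j
    have hm2 : ∀ k ∈ Finset.Ico 1 (K N), ∀ i : Fin L, Measurable fun ω => ∑ j : Fin L,
        ENNReal.ofReal (‖formError r τ
        ((Finset.Ico 1 (K N)).erase k) (fun k => φ (T N k ω, γ N k ω))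
        (cols h (fun i j => s i j ω) N) (cols g (fun i j => s i j ω) N k) i j‖ ^ 4) :=
      fun k hk i => Finset.measurable_sum _ fun j _ => (hb' k hk i j).1
    have hm1 : ∀ k ∈ Finset.Ico 1 (K N), Measurable fun ω => ∑ i : Fin L, ∑ j : Fin L,
        ENNReal.ofReal (‖formError r τ
        ((Finset.Ico 1 (K N)).erase k) (fun k => φ (T N k ω, γ N k ω))
        (cols h (fun i j => s i j ω) N) (cols g (fun i j => s i j ω) N k) i j‖ ^ 4) :=
      fun k hk => Finset.measurable_sum _ fun i _ => hm2 k hk i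
    have hm0 := Finset.measurable_sum _ hm1
    refine ⟨hm0.const_mul _, ?_⟩
    rw [lintegral_const_mul _ hm0, lintegral_finsetSum' _ fun k hk => (hm1 k hk).aemeasurable]
    have h1 : ∀ k ∈ Finset.Ico 1 (K N), ∫⁻ ω, ∑ i : Fin L, ∑ j : Fin L,
        ENNReal.ofReal (‖formError r τ
        ((Finset.Ico 1 (K N)).erase k) (fun k => φ (T N k ω, γ N k ω))
        (cols h (fun i j => s i j ω) N) (cols g (fun i j => s i j ω) N k) i j‖ ^ 4) ∂P ≤
        ENNReal.ofReal (L ^ 2 * (momentConst r b / (N : ℝ) ^ 2)) := by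
      intro k hk
      rw [lintegral_finsetSum' _ fun i _ => (hm2 k hk i).aemeasurable]
      calc ∑ i : Fin L, ∫⁻ ω, ∑ j : Fin L, _ ∂P ≤ ∑ i : Fin L, ∑ j : Fin L,
            ENNReal.ofReal (momentConst r b / (N : ℝ) ^ 2) := by
            refine Finset.sum_le_sum fun i _ => ?_
            rw [lintegral_finsetSum' _ fun j _ => (hb' k hk i j).1.aemeasurable]
            exact Finset.sum_le_sum fun j _ => (hb' k hk i j).2
        _ = _ := by
            rw [ENNReal.ofReal_mul (by positivity)]
            simp only [Finset.sum_const, Finset.card_univ, Fintype.card_fin, nsmul_eq_mul]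
            rw [← mul_assoc, ENNReal.ofReal_pow (Nat.cast_nonneg L), ENNReal.ofReal_natCast]
            ring
    refine (mul_le_mul_right (Finset.sum_le_sum h1) _).trans ?_
    rw [Finset.sum_const, nsmul_eq_mul, ← ENNReal.ofReal_natCast,
      ← ENNReal.ofReal_mul (Nat.cast_nonneg _), ← ENNReal.ofReal_mul (by positivity)]
    refine ENNReal.ofReal_le_ofReal ?_
    have hc : ((Finset.Ico 1 (K N)).card : ℝ) ≤ K N := by
      rw [Nat.card_Ico]
      exact_mod_cast Nat.sub_le _ _
    have hM := momentConst_nonneg r b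
    calc 1 / (N : ℝ) * (((Finset.Ico 1 (K N)).card : ℝ) *
          ((L : ℝ) ^ 2 * (momentConst r b / (N : ℝ) ^ 2))) =
          (((Finset.Ico 1 (K N)).card : ℝ) / N) *
          ((L : ℝ) ^ 2 * (momentConst r b / (N : ℝ) ^ 2)) := by ring
      _ ≤ (c + 1) * ((L : ℝ) ^ 2 * (momentConst r b / (N : ℝ) ^ 2)) :=
          mul_le_mul_of_nonneg_right
            ((div_le_div_of_nonneg_right hc hN'.le).trans hKN) (by positivity)
      _ = _ := by ring

/-- User 0 is absent from the resolvent, so its column is independent of all the columns used there.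
-/
lemma ae_tendsto_formError (hr : 0 < r) (hc : 0 < c)
    (hK : Tendsto (fun N : ℕ => (K N : ℝ) / N) atTop (𝓝 c))
    (hs_meas : ∀ i j, Measurable (s i j)) (hs_indep : iIndepFun (fun p : ℕ × ℕ => s p.1 p.2) P)
    {g h : ℂ → ℂ} {b τ : ℝ} (hg : Measurable g) (hh : Measurable h) (hb : ∀ z, ‖g z‖ ≤ b)
    (hmean : ∀ i j, ∫ ω, g (s i j ω) ∂P = 0) (hvar : ∀ i j, ∫ ω, ‖g (s i j ω)‖ ^ 2 ∂P = τ)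
    (hT : ∀ N, ∀ k < K N, Measurable (T N k)) (hγ : ∀ N, ∀ k < K N, Measurable (γ N k))
    (hind : ∀ N, IndepFun (fun ω => fun k : Fin (K N) => (T N k ω, γ N k ω))
      (fun ω => fun (i : Fin N) (k : Fin (K N)) => s i k ω) P)
    {φ : ℝ × (Fin L → ℂ) → Fin L → ℂ} (hφ : Measurable φ) (i j : Fin L) :
    ∀ᵐ ω ∂P, Tendsto (fun N : ℕ => formError r τ (Finset.Ico 1 (K N))
      (fun k => φ (T N k ω, γ N k ω)) (cols h (fun i j => s i j ω) N)
      (cols g (fun i j => s i j ω) N 0) i j) atTop (𝓝 0) := by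
  have key := ae_tendsto_zero_of_lintegral_le (P := P) (V := fun N ω =>
    ENNReal.ofReal (‖formError r τ (Finset.Ico 1 (K N)) (fun k => φ (T N k ω, γ N k ω))
      (cols h (fun i j => s i j ω) N) (cols g (fun i j => s i j ω) N 0) i j‖ ^ 4))
    (momentConst r b) ?_
  · filter_upwards [key] with ω hω
    have h1 := (ENNReal.tendsto_toReal ENNReal.zero_ne_top).comp hω
    rw [ENNReal.toReal_zero] at h1
    have h2 := h1.sqrt.sqrt
    simp only [Real.sqrt_zero] at h2
    refine tendsto_zero_iff_norm_tendsto_zero.2 (h2.congr fun N => ?_)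
    simp only [Function.comp]
    have e : ∀ t : ℝ, 0 ≤ t → √√(ENNReal.ofReal (t ^ 4)).toReal = t := fun t ht => by
      rw [ENNReal.toReal_ofReal (by positivity), show t ^ 4 = (t ^ 2) ^ 2 by ring,
        Real.sqrt_sq (by positivity), Real.sqrt_sq ht]
    exact e _ (norm_nonneg _)
  · filter_upwards [eventually_ne_atTop 0, (tendsto_users_div hK hc).1] with N hN hKN
    exact lintegral_formError_random_le hN hr hs_meas hs_indep hg hh hb hmean hvar (hT N) (hγ N)
      (hind N) hφ (fun j hj => (Finset.mem_Ico.1 hj).2) hKN (by simp) i j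

end AlmostSure

/-! ### Assembly of the almost sure statements. -/

section Main

variable {Ω : Type*} [MeasurableSpace Ω] {P : Measure Ω} [IsProbabilityMeasure P]
  {L : ℕ} {K : ℕ → ℕ} {c σ : ℝ} {s : ℕ → ℕ → Ω → ℂ} {T : ℕ → ℕ → Ω → ℝ}
  {γ : ℕ → ℕ → Ω → Fin L → ℂ} {G : ProbabilityMeasure (Fin L → ℝ)}

/-- Almost surely, the quadratic forms of the blocks of the resolvent at the first signature
sequence converge to the diagonal matrix of the solution of the fixed point equations. -/
theorem ae_tendsto_blockForm (hc : 0 < c) (hσ : 0 < σ)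
    (hK : Tendsto (fun N : ℕ => (K N : ℝ) / N) atTop (𝓝 c))
    (hs_meas : ∀ i j, Measurable (s i j)) (hs_indep : iIndepFun (fun p : ℕ × ℕ => s p.1 p.2) P)
    (hs_ident : ∀ i j, IdentDistrib (s i j) (s 0 0) P P)
    (hs_mean : ∫ ω, s 0 0 ω ∂P = 0) (hs_var : ∫ ω, ‖s 0 0 ω‖ ^ 2 ∂P = 1)
    (hT : ∀ N, ∀ k < K N, Measurable (T N k)) (hγ : ∀ N, ∀ k < K N, Measurable (γ N k))
    (hT0 : ∀ N, ∀ k < K N, ∀ ω, 0 ≤ T N k ω)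
    (hind : ∀ N, IndepFun (fun ω => fun k : Fin (K N) => (T N k ω, γ N k ω))
      (fun ω => fun (i : Fin N) (k : Fin (K N)) => s i k ω) P)
    (hG0 : ∀ᵐ δ ∂(G : Measure (Fin L → ℝ)), ∀ m, 0 ≤ δ m)
    (hG : ∀ᵐ ω ∂P, Tendsto
      (fun N => empirical (K N) (fun k => fun ℓ : Fin L => T N k ω * ‖γ N k ω ℓ‖ ^ 2))
      atTop (𝓝 G.toFiniteMeasure)) {a : Fin L → ℝ} (ha : ∀ m, 0 < a m) (hA : SolvesDiag c σ G a)
    (hcross : ∀ ℓ ℓ' : Fin L, ℓ ≠ ℓ' → ∀ᵐ ω ∂P, Tendsto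
      (fun N => crossAverage (K N) (fun k => T N k ω) (fun k => γ N k ω) a ℓ ℓ') atTop (𝓝 0)) :
    ∀ᵐ ω ∂P, Tendsto (fun N : ℕ => entrySum (blockForm (res (σ ^ 2) (Finset.Ico 1 (K N))
      (fun k => gain (T N k ω) (γ N k ω)) (cols id (fun i j => s i j ω) N))
      (cols id (fun i j => s i j ω) N 0) - Matrix.diagonal fun i => (a i : ℂ))) atTop (𝓝 0) := by
  have hS := hs_meas 0 0
  -- The integral of a non-integrable function is 0 by convention, so the value 1 forces
  -- integrability.
  have h2 : Integrable (fun ω => ‖s 0 0 ω‖ ^ 2) P := by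
    by_contra h
    rw [integral_undef h] at hs_var
    exact zero_ne_one hs_var
  have hr : 0 < σ ^ 2 := by positivity
  set g := trunc P (s 0 0) with hg
  set τ := truncVar P (s 0 0) with hτ
  have hgm : ∀ n, Measurable (g n) := measurable_trunc (s 0 0)
  have hmean : ∀ n i j, ∫ ω, g n (s i j ω) ∂P = 0 := fun n i j =>
    integral_trunc hS (hs_ident i j) n
  have hvar : ∀ n i j, ∫ ω, ‖g n (s i j ω)‖ ^ 2 ∂P = τ n := fun n i j =>
    integral_trunc_sq (hs_ident i j) n
  have hb : ∀ n z, ‖g n z‖ ≤ 2 * n := norm_trunc_le (s 0 0)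
  have hsqm : Measurable fun z : ℂ => ‖z‖ ^ 2 := measurable_norm.pow_const 2
  have herm : ∀ n, Measurable fun z => ‖z - g n z‖ ^ 2 := fun n =>
    (measurable_id.sub (hgm n)).norm.pow_const 2
  have a1 := ae_tendsto_average_column hs_indep hs_ident hsqm h2
  have a2 := ae_all_iff.2 fun n => ae_tendsto_average_column hs_indep hs_ident (herm n)
    (integrable_truncErr hS h2 n)
  have a3 := ae_tendsto_average_square hs_indep hs_ident hsqm h2
  have a4 := ae_all_iff.2 fun n => ae_tendsto_average_square hs_indep hs_ident (herm n)
    (integrable_truncErr hS h2 n)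
  -- For the interferers the fixed point equation is established with truncated columns and cut
  -- weights.
  have a5 := ae_all_iff.2 fun n => ae_all_iff.2 fun B =>
    ae_tendsto_average_formError hr hK hs_meas hs_indep (hgm n) (hgm n) (hb n) (hmean n) (hvar n)
      hT hγ hind ((measurable_cut B).comp (measurable_gain (L := L)))
  -- For user 0 only the tested column is truncated; the resolvent keeps the original entries and
  -- weights.
  have a6 := ae_all_iff.2 fun n => ae_all_iff.2 fun i => ae_all_iff.2 fun j =>
    ae_tendsto_formError hr hc hK hs_meas hs_indep (hgm n) measurable_id (hb n) (hmean n) (hvar n)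
      hT hγ hind (measurable_gain (L := L)) i j
  have a7 : ∀ᵐ ω ∂P, ∀ ℓ ℓ' : Fin L, ℓ ≠ ℓ' → Tendsto
      (fun N => crossAverage (K N) (fun k => T N k ω) (fun k => γ N k ω) a ℓ ℓ') atTop (𝓝 0) := by
    refine ae_all_iff.2 fun ℓ => ae_all_iff.2 fun ℓ' => ?_
    by_cases h : ℓ = ℓ'
    · exact Eventually.of_forall fun ω hne => absurd h hne
    · filter_upwards [hcross ℓ ℓ' h] with ω hω _ using hω
  filter_upwards [a1, a2, a3, a4, a5, a6, a7, hG] with ω b1 b2 b3 b4 b5 b6 b7 b8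
  rw [hs_var] at b1 b3
  refine tendsto_blockForm hc hr hK ha (g := g) (τ := τ) (δ := truncErr P (s 0 0))
    (κ := fun B => c * ∫ δ, tailFun B δ ∂(G : Measure (Fin L → ℝ)))
    (s := fun i j => s i j ω) (fun N k => gain (T N k ω) (γ N k ω)) (truncVar_nonneg _)
    (tendsto_truncVar hS h2 hs_mean hs_var) (tendsto_truncErr hS h2 hs_mean)
    (by simpa using (tendsto_integral_tailFun G).const_mul c) b1 b2 b3 b4 (fun B => ?_)
    (tendsto_fracSum hc hK (fun N k hk => hT0 N k hk ω) hG0 b8 ha hA b7) b5 b6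
  refine (tendsto_average_of_empirical hc hK b8 (tailFun B)).congr fun N => ?_
  congr 1
  refine Finset.sum_congr rfl fun k hk => ?_
  congr 1
  funext ℓ
  exact (norm_gain_sq (hT0 N k (Finset.mem_Ico.1 hk).2 ω) _ ℓ).symm

end Main

end CDMA

theorem corollary1p2 {Ω : Type*} [MeasurableSpace Ω] (P : Measure Ω) [IsProbabilityMeasure P]
    (L : ℕ) (K : ℕ → ℕ) (c σ : ℝ) (hc : 0 < c) (hσ : 0 < σ)
    (hK : Tendsto (fun N : ℕ => (K N : ℝ) / N) atTop (𝓝 c))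
    -- the doubly infinite array of i.i.d. standardized entries
    (s : ℕ → ℕ → Ω → ℂ)
    (hs_meas : ∀ i j, Measurable (s i j))
    (hs_indep : iIndepFun (fun p : ℕ × ℕ => s p.1 p.2) P)
    (hs_ident : ∀ i j, IdentDistrib (s i j) (s 0 0) P P)
    (hs_mean : ∫ ω, s 0 0 ω ∂P = 0)
    (hs_var : ∫ ω, ‖s 0 0 ω‖ ^ 2 ∂P = 1)
    -- powers `T N k` and gains `γ N k ℓ` of the users `k < K N`
    (T : ℕ → ℕ → Ω → ℝ) (γ : ℕ → ℕ → Ω → Fin L → ℂ)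
    (hT_meas : ∀ N, ∀ k < K N, Measurable (T N k))
    (hγ_meas : ∀ N, ∀ k < K N, Measurable (γ N k))
    (hT_nonneg : ∀ N, ∀ k < K N, ∀ ω, 0 ≤ T N k ω)
    (h_indep : ∀ N, IndepFun
      (fun ω => fun k : Fin (K N) => (T N k ω, γ N k ω))
      (fun ω => fun (i : Fin N) (k : Fin (K N)) => s i k ω) P)
    -- convergence of the empirical distribution of `T_k (|γ_k(1)|², …, |γ_k(L)|²)`
    (G : ProbabilityMeasure (Fin L → ℝ))
    (hG : ∀ᵐ ω ∂P, Tendsto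
      (fun N => CDMA.empirical (K N) (fun k => fun ℓ : Fin L => T N k ω * ‖γ N k ω ℓ‖ ^ 2))
      atTop (𝓝 G.toFiniteMeasure))
    -- vanishing cross averages; the exceptional null set may depend on `a`
    (h_cross : ∀ ℓ ℓ' : Fin L, ℓ ≠ ℓ' → ∀ a : Fin L → ℝ, (∀ m, 0 < a m) →
      ∀ᵐ ω ∂P, Tendsto
        (fun N => CDMA.crossAverage (K N) (fun k => T N k ω) (fun k => γ N k ω) a ℓ ℓ')
        atTop (𝓝 0)) :
    ∃ A : Matrix (Fin L) (Fin L) ℂ,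
      -- `A` is Hermitian positive definite, and it is the diagonal matrix of the unique positive
      -- solution of the fixed point equations
      A.PosDef ∧
      (∃ a : Fin L → ℝ, A = Matrix.diagonal (fun ℓ => (a ℓ : ℂ)) ∧
        (∀ ℓ, 0 < a ℓ) ∧ CDMA.SolvesDiag c σ G a ∧
        ∀ b : Fin L → ℝ, (∀ ℓ, 0 < b ℓ) → CDMA.SolvesDiag c σ G b → b = a) ∧
      -- `A` is the unique Hermitian positive definite solution of the matrix equation, for every
      -- law `H` compatible with `G` and with vanishing cross moments
      (∀ H : ProbabilityMeasure (Fin L → ℂ),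
        (H : Measure (Fin L → ℂ)).map (fun α => fun ℓ : Fin L => ‖α ℓ‖ ^ 2) = G →
        CDMA.CrossMomentsVanish H →
        CDMA.SolvesMatrix c σ H A ∧
        ∀ B : Matrix (Fin L) (Fin L) ℂ, B.PosDef → CDMA.SolvesMatrix c σ H B → B = A) ∧
      -- almost surely, `SIR₁` tends to `T₁ ∑ conj(γ₁(ℓ)) γ₁(ℓ') a_{ℓ,ℓ'}`
      ∀ᵐ ω ∂P,
        ((fun N => CDMA.SIR N (K N) σ (fun i j => s i j ω) (fun k => T N k ω) (fun k => γ N k ω)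
            - CDMA.limitSIR A (T N 0 ω) (γ N 0 ω))
          =o[atTop] fun N => T N 0 ω * ∑ ℓ, ‖γ N 0 ω ℓ‖ ^ 2) ∧
        ((∃ M : ℝ, ∀ N, T N 0 ω * ∑ ℓ, ‖γ N 0 ω ℓ‖ ^ 2 ≤ M) →
          Tendsto (fun N =>
            CDMA.SIR N (K N) σ (fun i j => s i j ω) (fun k => T N k ω) (fun k => γ N k ω)
              - CDMA.limitSIR A (T N 0 ω) (γ N 0 ω)) atTop (𝓝 0)) ∧
        (∀ (t : ℝ) (g : Fin L → ℂ),
          Tendsto (fun N => T N 0 ω) atTop (𝓝 t) → Tendsto (fun N => γ N 0 ω) atTop (𝓝 g) →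
          Tendsto (fun N =>
            CDMA.SIR N (K N) σ (fun i j => s i j ω) (fun k => T N k ω) (fun k => γ N k ω))
            atTop (𝓝 (CDMA.limitSIR A t g))) := by
  -- Since G is not random, a single good realization suffices.
  have hG0 : ∀ᵐ δ ∂(G : Measure (Fin L → ℝ)), ∀ m, 0 ≤ δ m := by
    obtain ⟨ω, hω⟩ := hG.exists
    exact CDMA.ae_nonneg_of_empirical hc hK
      (fun N k hk ℓ => mul_nonneg (hT_nonneg N k hk ω) (by positivity)) hω
  obtain ⟨a, ha, hA⟩ := CDMA.exists_solvesDiag hG0 hc hσ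
  refine ⟨Matrix.diagonal fun ℓ => (a ℓ : ℂ), CDMA.posDef_diagonal_ofReal ha,
    ⟨a, rfl, ha, hA, fun b hb hB => CDMA.solvesDiag_unique hG0 hc hσ ha hb hA hB⟩,
    fun H hH hcr => ?_, ?_⟩
  · have h := CDMA.solvesMatrix_diagonal hG0 hc hσ ha hA hH hcr
    exact ⟨(Matrix.inv_eq_right_inv h).symm,
      fun B hB hBs => CDMA.solvesMatrix_unique hc hσ ha h hB hBs⟩
  · have h := CDMA.ae_tendsto_blockForm hc hσ hK hs_meas hs_indep hs_ident hs_mean hs_var hT_meas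
      hγ_meas hT_nonneg h_indep hG0 hG ha hA fun ℓ ℓ' hne => h_cross ℓ ℓ' hne a ha
    filter_upwards [h] with ω hω
    set E : ℕ → ℝ := fun N => CDMA.entrySum (CDMA.blockForm (CDMA.res (σ ^ 2)
      (Finset.Ico 1 (K N)) (fun k => CDMA.gain (T N k ω) (γ N k ω))
      (CDMA.cols id (fun i j => s i j ω) N)) (CDMA.cols id (fun i j => s i j ω) N 0) -
      Matrix.diagonal fun i => (a i : ℂ)) with hE
    set X : ℕ → ℝ := fun N => T N 0 ω * ∑ ℓ, ‖γ N 0 ω ℓ‖ ^ 2 with hX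
    have hE0 : ∀ N, 0 ≤ E N := fun N => CDMA.entrySum_nonneg _
    have hK1 := (CDMA.tendsto_users_div hK hc).1
    have hX0 : ∀ᶠ N in atTop, 0 ≤ X N := hK1.mono fun N hN =>
      mul_nonneg (hT_nonneg N 0 hN ω) (Finset.sum_nonneg fun ℓ _ => by positivity)
    -- The error is at most X N * E N with E → 0. The three forms of the conclusion differ only in
    -- what is known about X: nothing, boundedness, or convergence.
    have hbound : ∀ᶠ N in atTop,
        ‖CDMA.SIR N (K N) σ (fun i j => s i j ω) (fun k => T N k ω) (fun k => γ N k ω) -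
          CDMA.limitSIR (Matrix.diagonal fun ℓ => (a ℓ : ℂ)) (T N 0 ω) (γ N 0 ω)‖ ≤
        X N * E N := hK1.mono fun N hN =>
      CDMA.norm_SIR_sub_limitSIR_le N (K N) σ _ _ _ _ (hT_nonneg N 0 hN ω)
    refine ⟨?_, ?_, ?_⟩
    · refine isLittleO_iff.2 fun ε hε => ?_
      filter_upwards [hbound, hX0, hω.eventually_le_const hε] with N h1 h2 h3
      rw [Real.norm_of_nonneg h2, mul_comm]
      exact h1.trans (mul_le_mul_of_nonneg_left h3 h2)
    · rintro ⟨M, hM⟩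
      refine squeeze_zero_norm' ?_ (by simpa using hω.const_mul M)
      filter_upwards [hbound] with N h1
      exact h1.trans (mul_le_mul_of_nonneg_right (hM N) (hE0 N))
    · intro t g ht hg
      have hXt : Tendsto X atTop (𝓝 (t * ∑ ℓ, ‖g ℓ‖ ^ 2)) :=
        ht.mul (tendsto_finsetSum _ fun ℓ _ => ((tendsto_pi_nhds.1 hg ℓ).norm.pow 2))
      have h1 := squeeze_zero_norm' hbound (by simpa using hXt.mul hω)
      have h2 := ((CDMA.continuous_limitSIR (Matrix.diagonal fun ℓ => (a ℓ : ℂ))).tendsto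
        (t, g)).comp (ht.prodMk_nhds hg)
      simpa using h1.add h2
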